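/- Let $k,m\ge 1$, $n=k+m$, and let $X$ be a random vector in $\mathbb{R}^n$ with Lebesgue density $\rho$ and law $P_X$, where either $P_X$ is the uniform distribution on a non-empty open bounded convex set, or $P_X=\mathcal N(0,I)$. Put $\mathcal X=\{\rho>0\}$. Let $f:\mathcal X\to\mathbb{R}$ be measurable with partial derivatives at every point of $\mathcal X$ that are square integrable with respect to $P_X$. Let $$C_f=\int_{\mathcal X}\nabla f(x)\,\nabla f(x)^\top\rho(x)\,dx=W\Lambda W^\top,\qquad \Lambda=\operatorname{diag}(\lambda_1,\dots,\lambda_n),\quad \lambda_1\ge\dots\ge\lambda_n,$$ with $W=[W_1\ W_2]$ orthogonal, $W_1\in\mathbb{R}^{n\times k}$, $W_2\in\mathbb{R}^{n\times m}$. Set $Y=W_1^\top X$ with law $P_Y$, $Z=W_2^\top X$, $\mathcal Y=W_1^\top\mathcal X$, and for $y\in\mathcal Y$ let $P^y$ be the conditional law of $Z$ given $Y=y$, i.e. the law on $\mathbb{R}^m$ with density $$\rho_{Z|Y}(z|y)=\frac{\rho(W_1y+W_2z)}{\int_{\mathbb{R}^m}\rho(W_1y+W_2z')\,dz'}.$$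 Define $g(y)=\int f(W_1y+W_2z)\,dP^y(z)$ and $f_g(x)=g(W_1^\top x)$. Given $N\ge1$ and a probability space $(\Omega,\mathcal A,\mathbb P)$, let $Z_1^y,\dots,Z_N^y:\Omega\to\mathbb{R}^m$, $y\in\mathcal Y$, be such that each $(y,\omega)\mapsto Z_j^y(\omega)$ is measurable on $\mathcal Y\times\Omega$ and, for each fixed $y\in\mathcal Y$, the $Z_j^y$ are independent with law $P^y$; define $$g_N(y,\omega)=\frac1N\sum_{j=1}^N f\bigl(W_1y+W_2Z_j^y(\omega)\bigr),\qquad f_{g_N}(x,\omega)=g_N(W_1^\top x,\omega).$$ Let $C=\sup_{y\in\mathcal Y}C_y$, where $C_y$ is the Poincaré constant of $P^y$: the infimum of all $c\in[0,\infty]$ with $\operatorname{Var}_{P^y}(h)\le c\int|\nabla h|^2\,dP^y$ for all continuously differentiable $h:\mathbb{R}^m\to\mathbb{R}$ in $L^2(P^y)$. Then $0<C<\infty$; the integral defining $g(y)$ converges for $P_Y$-almost every $y$; samples $Z_j^y$ as above exist on a suitable probability space; and for every such choice of samples $(y,\omega)\mapsto g(y)-g_N(y,\omega)$ is $P_Y\otimes\mathbb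 P$-almost everywhere equal to a measurable function and $$\mathbb E\Bigl[\mathbb E_X\bigl[(f_g(X)-f_{g_N}(X,\cdot))^2\bigr]\Bigr]=\mathbb E\Bigl[\mathbb E_Y\bigl[(g(Y)-g_N(Y,\cdot))^2\bigr]\Bigr]\le\frac{C}{N}\,(\lambda_{k+1}+\dots+\lambda_n),$$ where $\mathbb E_X$, $\mathbb E_Y$ denote integration with respect to $P_X$, $P_Y$ for fixed $\omega$, and $\mathbb E$ denotes integration over $\omega$. -/

import Mathlib

open MeasureTheory ProbabilityTheory Set
open scoped ENNReal NNReal Matrix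

noncomputable section

namespace ActiveSubspace

/-- `ℝ^d` with the Euclidean norm. -/
abbrev E (d : ℕ) : Type := EuclideanSpace ℝ (Fin d)

/-! ### The density of `X` and the averaged outer product of the gradient -/

/-- The set `𝒳` of all points with a positive density value. -/
def posSet {d : ℕ} (ρ : E d → ℝ) : Set (E d) := {x | 0 < ρ x}

/-- The measure with Lebesgue density `ρ`; for `ρ = ρ_X` this is the law `P_X` of `X`. -/
def law {d : ℕ} (ρ : E d → ℝ) : Measure (E d) :=
  volume.withDensity fun x => ENNReal.ofReal (ρ x)

/-- `ρ` is the density of the uniform distribution on a (non-empty, open) bounded convex set. -/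
def IsUniformOnBoundedConvex {d : ℕ} (ρ : E d → ℝ) : Prop :=
  ∃ U : Set (E d), IsOpen U ∧ U.Nonempty ∧ Bornology.IsBounded U ∧ Convex ℝ U ∧
    ρ = U.indicator fun _ => (volume.real U)⁻¹

/-- `ρ` is the density of the standard normal distribution `N(0, I)` on `ℝ^d`. -/
def IsStdGaussianDensity {d : ℕ} (ρ : E d → ℝ) : Prop :=
  ρ = fun x => ∏ i, gaussianPDFReal 0 1 (x i)

/-- The `i`-th (classical) partial derivative of `f`. -/
def partialDeriv {d : ℕ} (f : E d → ℝ) (i : Fin d) (x : E d) : ℝ :=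
  lineDeriv ℝ f x (EuclideanSpace.single i 1)

/-- Standing assumptions on `f : 𝒳 → ℝ`: it is measurable, it has all partial derivatives at every
point of `𝒳`, and these are square integrable with respect to `ρ`. Values of `f` outside `𝒳` are
irrelevant. -/
structure IsAdmissible {d : ℕ} (ρ f : E d → ℝ) : Prop where
  measurable : Measurable ((posSet ρ).domRestrict f)
  hasPartialDeriv : ∀ x ∈ posSet ρ, ∀ i, LineDifferentiableAt ℝ f x (EuclideanSpace.single i 1)
  memLp_partialDeriv : ∀ i, MemLp (partialDeriv f i) 2 (law ρ)

/-- The matrix `C = ∫_𝒳 ∇f(x) ∇f(x)ᵀ ρ(x) dx`. -/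
def gradMatrix {d : ℕ} (ρ f : E d → ℝ) : Matrix (Fin d) (Fin d) ℝ :=
  Matrix.of fun i j => ∫ x in posSet ρ, partialDeriv f i x * partialDeriv f j x * ρ x

/-- `C = W Λ Wᵀ` is an orthogonal eigendecomposition with descending eigenvalues `lam`. -/
structure IsEigendecomposition {d : ℕ} (C W : Matrix (Fin d) (Fin d) ℝ) (lam : Fin d → ℝ) :
    Prop where
  orthogonal : W ∈ Matrix.orthogonalGroup (Fin d) ℝ
  antitone : Antitone lam
  eq : C = W * Matrix.diagonal lam * Wᵀ

/-! ### Active and inactive variables -/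

variable {k m : ℕ}

/-- The first `k` columns of `W`. -/
def W₁ (W : Matrix (Fin (k + m)) (Fin (k + m)) ℝ) : Matrix (Fin (k + m)) (Fin k) ℝ :=
  W.submatrix id (Fin.castAdd m)

/-- The last `m` columns of `W`. -/
def W₂ (W : Matrix (Fin (k + m)) (Fin (k + m)) ℝ) : Matrix (Fin (k + m)) (Fin m) ℝ :=
  W.submatrix id (Fin.natAdd k)

/-- The active variable `y = W₁ᵀ x`. -/
def active (W : Matrix (Fin (k + m)) (Fin (k + m)) ℝ) (x : E (k + m)) : E k :=
  WithLp.toLp 2 ((W₁ W)ᵀ *ᵥ WithLp.ofLp x)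

/-- The point `⟦y, z⟧ = W₁ y + W₂ z`. -/
def join (W : Matrix (Fin (k + m)) (Fin (k + m)) ℝ) (y : E k) (z : E m) : E (k + m) :=
  WithLp.toLp 2 (W₁ W *ᵥ WithLp.ofLp y + W₂ W *ᵥ WithLp.ofLp z)

/-- The domain `𝒴 = W₁ᵀ 𝒳` of the active variable. -/
def activeSet (ρ : E (k + m) → ℝ) (W : Matrix (Fin (k + m)) (Fin (k + m)) ℝ) : Set (E k) :=
  active W '' posSet ρ

/-- The law `P_Y` of `Y = W₁ᵀ X`. -/
def activeLaw (ρ : E (k + m) → ℝ) (W : Matrix (Fin (k + m)) (Fin (k + m)) ℝ) : Measure (E k) :=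
  (law ρ).map (active W)

/-- The marginal density `ρ_Y(y) = ∫ ρ_{Y,Z}(y, z) dz`, where `ρ_{Y,Z}(y, z) = ρ(⟦y, z⟧)`. -/
def activeDensity (ρ : E (k + m) → ℝ) (W : Matrix (Fin (k + m)) (Fin (k + m)) ℝ) (y : E k) : ℝ :=
  ∫ z, ρ (join W y z)

/-- The conditional density `ρ_{Z|Y}(z|y) = ρ_{Y,Z}(y, z) / ρ_Y(y)`. -/
def condDensity (ρ : E (k + m) → ℝ) (W : Matrix (Fin (k + m)) (Fin (k + m)) ℝ) (y : E k)
    (z : E m) : ℝ :=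
  ρ (join W y z) / activeDensity ρ W y

/-- The conditional law of `Z` given `Y = y`, with density `ρ_{Z|Y}(·|y)`. -/
def condLaw (ρ : E (k + m) → ℝ) (W : Matrix (Fin (k + m)) (Fin (k + m)) ℝ) (y : E k) :
    Measure (E m) :=
  law (condDensity ρ W y)

/-! ### The approximations of `f` -/

/-- `g(y) = ∫ f(⟦y, z⟧) ρ_{Z|Y}(z|y) dz`, the conditional expectation of `f(X)` given `Y = y`. -/
def g (ρ f : E (k + m) → ℝ) (W : Matrix (Fin (k + m)) (Fin (k + m)) ℝ) (y : E k) : ℝ :=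
  ∫ z, f (join W y z) ∂(condLaw ρ W y)

/-- `f_g(x) = g(W₁ᵀ x)`. -/
def fg (ρ f : E (k + m) → ℝ) (W : Matrix (Fin (k + m)) (Fin (k + m)) ℝ) (x : E (k + m)) : ℝ :=
  g ρ f W (active W x)

/-- A family `(y, ω) ↦ Z_j^y(ω)`, `j = 1, …, N`, of Monte Carlo samples on a probability space:
product measurable on `𝒴 × Ω`, and for each fixed `y ∈ 𝒴` independent and distributed according
to the conditional law of `Z` given `Y = y`. Values for `y ∉ 𝒴` are irrelevant. -/
structure IsMonteCarloSample {Ω : Type*} [MeasurableSpace Ω] (P : Measure Ω)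
    (ρ : E (k + m) → ℝ) (W : Matrix (Fin (k + m)) (Fin (k + m)) ℝ) {N : ℕ}
    (Z : Fin N → E k → Ω → E m) : Prop where
  measurable : ∀ j, Measurable fun p : activeSet ρ W × Ω => Z j p.1 p.2
  indep : ∀ y ∈ activeSet ρ W, iIndepFun (fun j => Z j y) P
  map_eq : ∀ y ∈ activeSet ρ W, ∀ j, P.map (Z j y) = condLaw ρ W y

/-- `g_N(y, ω) = (1/N) ∑_j f(⟦y, Z_j^y(ω)⟧)`. -/
def gN {Ω : Type*} (f : E (k + m) → ℝ) (W : Matrix (Fin (k + m)) (Fin (k + m)) ℝ) {N : ℕ}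
    (Z : Fin N → E k → Ω → E m) (y : E k) (ω : Ω) : ℝ :=
  (1 / (N : ℝ)) * ∑ j, f (join W y (Z j y ω))

/-- `f_{g_N}(x, ω) = g_N(W₁ᵀ x, ω)`. -/
def fgN {Ω : Type*} (f : E (k + m) → ℝ) (W : Matrix (Fin (k + m)) (Fin (k + m)) ℝ) {N : ℕ}
    (Z : Fin N → E k → Ω → E m) (x : E (k + m)) (ω : Ω) : ℝ :=
  gN f W Z (active W x) ω

/-! ### The Poincaré constant -/

/-- The (optimal) Poincaré constant of a measure `μ` on `ℝ^d`: the infimum of all `c ∈ [0, ∞]` such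
that `Var_μ(h) ≤ c ∫ |∇h|² dμ` for every continuously differentiable `h ∈ L²(μ)`. It is `∞` if no
finite `c` has this property. -/
def poincareConst {d : ℕ} (μ : Measure (E d)) : ℝ≥0∞ :=
  sInf {c | ∀ h : E d → ℝ, ContDiff ℝ 1 h → MemLp h 2 μ →
    evariance h μ ≤ c * ∫⁻ z, ‖gradient h z‖ₑ ^ 2 ∂μ}

/-- The supremum over `y ∈ 𝒴` of the Poincaré constants of the conditional laws of `Z` given
`Y = y`. -/
def poincareSup (ρ : E (k + m) → ℝ) (W : Matrix (Fin (k + m)) (Fin (k + m)) ℝ) : ℝ≥0∞ :=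
  ⨆ y ∈ activeSet ρ W, poincareConst (condLaw ρ W y)

end ActiveSubspace

end

open ActiveSubspace

/-!
Given `Y = y`, the average of `N` independent samples has mean square error `Var(f_y) / N`, where
`f_y(z) = f(⟦y, z⟧)` is considered under the conditional law `P^y`
(`IsMonteCarloSample.lintegral_sub_gN_sq`). After an exchange of the integrals over `y` and `ω` it
remains to bound the mean conditional variance `∫ Var_{P^y}(f_y) dP_Y(y) = ‖f - f_g‖²` in `L²(P_X)`
by `C (λ_{k+1} + ⋯ + λ_n)`. Formally this is the Poincaré inequality for `P^y`, integrated over `y`: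
the gradient of `f_y` is `W₂ᵀ ∇f`, and `∫ |W₂ᵀ ∇f|² dP_X` is the sum of the trailing eigenvalues
(`eLpNorm_columnDeriv_sq`).

However, `f` only has partial derivatives along the coordinate axes, which may be discontinuous. It
need not be differentiable in the directions of the columns of `W₂`, while the Poincaré constant is
defined by functions in `C¹`. Also the square integrability of `f` is not assumed. Therefore `f` is
approximated on the whole of `𝒳` before slicing: there are functions `F ∈ C¹_c(ℝⁿ)` such that `F → f`
and `∂_i F → ∂_i f` in `L²(P_X)` (`C1Approx`, `IsModelDensity.memLp_and_c1Approx`). The inequality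
`‖F - F_g‖² ≤ C ∑_j ‖(W₂ᵀ ∇F)_j‖²` is legitimate for such `F`, and both sides are continuous under
this convergence (`C1Approx.eLpNorm_sub_fg_sq_le`).

The approximation is by mollification. For a compactly supported function on `ℝⁿ` with partial
derivatives at every point, integration by parts along lines shows that these commute with
convolution (`partialDeriv_convolution`). A bounded function on `𝒳` is reduced to this case by a
smooth cut-off, in the convex case after a contraction of `𝒳` into itself. An unbounded `f` is
truncated smoothly by a scaled arctangent; the Poincaré inequality for `P_X`, applied to the
truncations, and Fatou's lemma give `f ∈ L²(P_X)`, and the truncations converge to `f`.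

Poincaré inequalities are proved by elementary interpolation: along segments for the uniform
distribution on a bounded convex set (`setLIntegral_sub_sq_le`), with a constant depending on the
dimension and the diameter only, and along quarter circles for the normal distribution
(`lintegral_sub_sq_le_stdGaussian`). The conditional laws `P^y` are again of these two types, with
diameters at most that of `𝒳`, so `C < ∞`. Testing with a coordinate function gives `C > 0`. Samples
exist because the kernel `y ↦ P^y` is represented by a jointly measurable function of `y` and a
uniform variable on `[0, 1]` (`exists_isMonteCarloSample`).
-/

noncomputable section

namespace ActiveSubspace

open Filter Topology
open scoped Convolution

/-! ### Second moments and `L²` norms -/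

section

section SecondMoments

variable {α : Type*} [MeasurableSpace α]

lemma eLpNorm_two_sq {F : Type*} [NormedAddCommGroup F] (f : α → F) (μ : Measure α) :
    eLpNorm f 2 μ ^ 2 = ∫⁻ x, ‖f x‖ₑ ^ 2 ∂μ := by
  have h := eLpNorm_nnreal_pow_eq_lintegral (f := f) (μ := μ) (p := 2) (by norm_num)
  norm_num at h
  exact_mod_cast h

lemma enorm_integral_sq_le {μ : Measure α} [IsProbabilityMeasure μ] (f : α → ℝ) :
    ‖∫ x, f x ∂μ‖ₑ ^ 2 ≤ ∫⁻ x, ‖f x‖ₑ ^ 2 ∂μ := by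
  by_cases hf : AEStronglyMeasurable f μ
  · rw [← eLpNorm_two_sq]
    gcongr
    calc ‖∫ x, f x ∂μ‖ₑ ≤ ∫⁻ x, ‖f x‖ₑ ∂μ := enorm_integral_le_lintegral_enorm f
      _ = eLpNorm f 1 μ := eLpNorm_one_eq_lintegral_enorm.symm
      _ ≤ eLpNorm f 2 μ := eLpNorm_le_eLpNorm_of_exponent_le (by norm_num) hf
  · rw [integral_undef fun h => hf h.1]
    simp

lemma enorm_sub_sq_le_two_mul (a b : ℝ) : ‖a - b‖ₑ ^ 2 ≤ 2 * (‖a‖ₑ ^ 2 + ‖b‖ₑ ^ 2) := by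
  simp only [Real.enorm_eq_ofReal_abs, ← ENNReal.ofReal_pow (abs_nonneg _), sq_abs]
  rw [← ENNReal.ofReal_add (sq_nonneg _) (sq_nonneg _),
    show (2 : ℝ≥0∞) = ENNReal.ofReal 2 by simp, ← ENNReal.ofReal_mul (by norm_num)]
  exact ENNReal.ofReal_le_ofReal (by nlinarith [sq_nonneg (a + b)])

end SecondMoments

variable {d : ℕ}

/-! ### Continuity of affine changes of variables in `L²` -/

lemma lintegral_comp_affine (φ : E d → ℝ≥0∞) {s : ℝ} (hs : s ≠ 0) (a : E d) :
    ∫⁻ x, φ (s • x + a) = ENNReal.ofReal |(s ^ d)⁻¹| * ∫⁻ x, φ x := by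
  have h := (Homeomorph.smulOfNeZero s hs).measurableEmbedding.lintegral_map
    (μ := (volume : Measure (E d))) (fun x => φ (x + a))
  simp only [Homeomorph.smulOfNeZero_apply] at h
  rw [← h]
  have h2 := Measure.map_addHaar_smul (volume : Measure (E d)) hs
  rw [h2, lintegral_smul_measure, lintegral_add_right_eq_self φ a]
  simp

lemma eLpNorm_comp_affine_le (w : E d → ℝ) {s : ℝ} (hs : 1 / 2 ≤ s) (a : E d) :
    eLpNorm (fun x => w (s • x + a)) 2 volume ≤ 2 ^ d * eLpNorm w 2 volume := by
  rw [← ENNReal.pow_le_pow_left_iff (n := 2) (by norm_num), mul_pow, eLpNorm_two_sq,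
    eLpNorm_two_sq, lintegral_comp_affine (fun x => ‖w x‖ₑ ^ 2) (by linarith : s ≠ 0) a]
  gcongr
  have h1 : |(s ^ d)⁻¹| ≤ 2 ^ d := by
    rw [abs_of_nonneg (by positivity), ← inv_pow]
    gcongr
    rw [inv_le_comm₀ (by linarith) (by norm_num)]
    linarith
  calc ENNReal.ofReal |(s ^ d)⁻¹| ≤ ENNReal.ofReal (2 ^ d) := ENNReal.ofReal_le_ofReal h1
    _ = 2 ^ d := by rw [ENNReal.ofReal_pow (by norm_num)]; simp
    _ ≤ (2 ^ d) ^ 2 := le_self_pow₀ (one_le_pow₀ (by norm_num)) (by norm_num)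

lemma quasiMeasurePreserving_affine {s : ℝ} (hs : s ≠ 0) (a : E d) :
    Measure.QuasiMeasurePreserving (fun x : E d => s • x + a) volume volume := by
  refine ⟨by fun_prop, fun t ht => ?_⟩
  have hm : Measurable fun x : E d => s • x + a := by fun_prop
  obtain ⟨t', htt, ht'm, ht'⟩ := exists_measurable_superset_of_null ht
  refine measure_mono_null htt ?_
  rw [Measure.map_apply hm ht'm, ← lintegral_indicator_one (hm ht'm)]
  have := lintegral_comp_affine (t'.indicator 1) hs a
  rw [lintegral_indicator_one ht'm, ht', mul_zero] at this
  exact this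

lemma memLp_comp_affine {w : E d → ℝ} (hw : MemLp w 2 volume) {s : ℝ} (hs : 1 / 2 ≤ s)
    (a : E d) : MemLp (fun x => w (s • x + a)) 2 volume :=
  ⟨hw.1.comp_quasiMeasurePreserving (quasiMeasurePreserving_affine (by linarith) a),
    (eLpNorm_comp_affine_le w hs a).trans_lt
      (ENNReal.mul_lt_top (by finiteness) hw.2)⟩

lemma tendsto_eLpNorm_comp_affine_of_continuous {g : E d → ℝ} (hg : Continuous g)
    (hgs : HasCompactSupport g) :
    Tendsto (fun p : ℝ × E d => eLpNorm (fun x => g (p.1 • x + p.2) - g x) 2 volume)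
      (𝓝 (1, 0)) (𝓝 0) := by
  obtain ⟨R, hR⟩ := hgs.isCompact.isBounded.subset_closedBall (0 : E d)
  obtain ⟨M, hM⟩ := hg.bounded_above_of_compact_support hgs
  have hsupp : ∀ x, R < ‖x‖ → g x = 0 := fun x hx => by
    refine image_eq_zero_of_notMem_tsupport fun hx' => ?_
    have := hR hx'
    simp at this
    linarith
  have key : Tendsto (fun p : ℝ × E d => ∫⁻ x, ‖g (p.1 • x + p.2) - g x‖ₑ ^ 2)
      (𝓝 (1, 0)) (𝓝 (∫⁻ _ : E d, 0)) := by
    refine tendsto_lintegral_filter_of_dominated_convergence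
      ((Metric.closedBall (0 : E d) (2 * R + 2)).indicator fun _ => ENNReal.ofReal (2 * M) ^ 2)
      (Eventually.of_forall fun p => by fun_prop) ?_ ?_ ?_
    · have h1 : ∀ᶠ p : ℝ × E d in 𝓝 (1, 0), 1 / 2 < p.1 :=
        (continuous_fst.tendsto (1, (0 : E d))).eventually (lt_mem_nhds (by norm_num))
      have h2 : ∀ᶠ p : ℝ × E d in 𝓝 (1, 0), ‖p.2‖ < 1 := by
        have : Tendsto (fun p : ℝ × E d => ‖p.2‖) (𝓝 (1, 0)) (𝓝 ‖(0 : E d)‖) :=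
          (continuous_snd.norm).tendsto (1, (0 : E d))
        exact this.eventually (gt_mem_nhds (by simp))
      filter_upwards [h1, h2] with p hp1 hp2
      refine Eventually.of_forall fun x => ?_
      -- for `1 / 2 < s` and `‖a‖ < 1`, `x ↦ s • x + a` maps points of norm above `2 R + 2` to
      -- points of norm above `R`, where `g` vanishes
      by_cases hx : x ∈ Metric.closedBall (0 : E d) (2 * R + 2)
      · rw [indicator_of_mem hx]
        gcongr
        rw [Real.enorm_eq_ofReal_abs]
        refine ENNReal.ofReal_le_ofReal ?_
        have a1 := hM (p.1 • x + p.2)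
        have a2 := hM x
        rw [Real.norm_eq_abs] at a1 a2
        linarith [abs_sub (g (p.1 • x + p.2)) (g x)]
      · simp only [Metric.mem_closedBall, dist_zero_right, not_le] at hx
        by_cases hR0 : 0 ≤ R
        · have e1 : g x = 0 := hsupp x (by linarith)
          have e2 : g (p.1 • x + p.2) = 0 := by
            refine hsupp _ ?_
            have := norm_sub_le (p.1 • x + p.2) p.2
            rw [add_sub_cancel_right, norm_smul, Real.norm_of_nonneg (by linarith)] at this
            nlinarith
          simp [e1, e2]
        · have e0 : ∀ x, g x = 0 := fun x => hsupp x (by linarith [norm_nonneg x])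
          simp [e0]
    · rw [lintegral_indicator Metric.isClosed_closedBall.measurableSet, setLIntegral_const]
      exact ENNReal.mul_ne_top (by finiteness) measure_closedBall_lt_top.ne
    · refine Eventually.of_forall fun x => ?_
      have : Continuous fun p : ℝ × E d => ‖g (p.1 • x + p.2) - g x‖ₑ ^ 2 := by fun_prop
      have h := this.tendsto (1, 0)
      simpa using! h
  simp only [lintegral_zero] at key
  have h2 := (ENNReal.continuous_rpow_const (y := 1 / 2)).tendsto 0 |>.comp key
  have e : ∀ p : ℝ × E d, (∫⁻ x, ‖g (p.1 • x + p.2) - g x‖ₑ ^ 2) ^ (1 / 2 : ℝ) =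
      eLpNorm (fun x => g (p.1 • x + p.2) - g x) 2 volume := fun p => by
    rw [← eLpNorm_two_sq, ← ENNReal.rpow_natCast, ← ENNReal.rpow_mul]
    norm_num
  refine Tendsto.congr e ?_
  simpa [Function.comp_def] using! h2

/-- Dilations and translations act continuously on `L²`: `w ∘ T → w` as the affine map `T` tends
to the identity. -/
lemma tendsto_eLpNorm_comp_affine {w : E d → ℝ} (hw : MemLp w 2 volume) :
    Tendsto (fun p : ℝ × E d => eLpNorm (fun x => w (p.1 • x + p.2) - w x) 2 volume)
      (𝓝 (1, 0)) (𝓝 0) := by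
  rw [ENNReal.tendsto_nhds_zero]
  intro ε hε
  obtain ⟨η, hη, hηε⟩ : ∃ η : ℝ≥0∞, η ≠ 0 ∧ 2 ^ d * η + η + η ≤ ε := by
    refine ⟨ε / (2 ^ d + 2), ?_, ?_⟩
    · simp [hε.ne', ENNReal.add_eq_top]
    · have h : 2 ^ d * (ε / (2 ^ d + 2)) + ε / (2 ^ d + 2) + ε / (2 ^ d + 2)
        = (2 ^ d + 2) * (ε / (2 ^ d + 2)) := by ring
      rw [h]
      exact ENNReal.mul_div_le
  obtain ⟨g, hgs, hgw, hg, hgm⟩ := hw.exists_hasCompactSupport_eLpNorm_sub_le (by norm_num) hη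
  have h1 : ∀ᶠ p : ℝ × E d in 𝓝 (1, 0), 1 / 2 < p.1 :=
    (continuous_fst.tendsto (1, (0 : E d))).eventually (lt_mem_nhds (by norm_num))
  have h2 := ENNReal.tendsto_nhds_zero.1 (tendsto_eLpNorm_comp_affine_of_continuous hg hgs) η
    (pos_iff_ne_zero.2 hη)
  filter_upwards [h1, h2] with p hp1 hp2
  have m1 := memLp_comp_affine (hw.sub hgm) hp1.le p.2
  have m2 := (memLp_comp_affine hgm hp1.le p.2).sub hgm
  have e : (fun x => w (p.1 • x + p.2) - w x) =
      ((fun x => (w - g) (p.1 • x + p.2)) + fun x => g (p.1 • x + p.2) - g x) + (g - w) := by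
    ext x; simp
  calc eLpNorm (fun x => w (p.1 • x + p.2) - w x) 2 volume
      ≤ eLpNorm (fun x => (w - g) (p.1 • x + p.2)) 2 volume
        + eLpNorm (fun x => g (p.1 • x + p.2) - g x) 2 volume + eLpNorm (g - w) 2 volume := by
        rw [e]
        refine (eLpNorm_add_le (m1.1.add m2.1) (hgm.1.sub hw.1) (by norm_num)).trans ?_
        gcongr
        exact eLpNorm_add_le m1.1 m2.1 (by norm_num)
    _ ≤ 2 ^ d * η + η + η := by
        gcongr
        · exact (eLpNorm_comp_affine_le _ hp1.le _).trans (by gcongr)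
        · rw [eLpNorm_sub_comm]; exact hgw
    _ ≤ ε := hηε

/-! ### Mollification -/

/-- A mollification is an average of translates, so by Jensen's inequality its `L²` distance to `w`
is at most the largest distance of these translates to `w`. -/
lemma eLpNorm_convolution_sub_le_of_measurable {w : E d → ℝ} (hwm : Measurable w)
    (hw : MemLp w 2 volume) (ψ : ContDiffBump (0 : E d)) {ε : ℝ≥0∞}
    (hε : ∀ t : E d, ‖t‖ < ψ.rOut → eLpNorm (fun x => w (x - t) - w x) 2 volume ≤ ε) :
    eLpNorm (fun x => (ψ.normed volume ⋆[ContinuousLinearMap.lsmul ℝ ℝ, volume] w) x - w x) 2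
      volume ≤ ε := by
  set ν : Measure (E d) := volume.withDensity fun t => ENNReal.ofReal (ψ.normed volume t) with hν
  have hψm : Measurable fun t => ENNReal.ofReal (ψ.normed volume t) :=
    (ψ.continuous_normed.measurable).ennreal_ofReal
  have hν1 : IsProbabilityMeasure ν := by
    refine ⟨?_⟩
    rw [hν, withDensity_apply _ MeasurableSet.univ, Measure.restrict_univ,
      ← ofReal_integral_eq_lintegral_ofReal (ψ.integrable_normed (μ := volume))
        (Eventually.of_forall ψ.nonneg_normed), ψ.integral_normed (μ := volume), ENNReal.ofReal_one]
  have hloc : LocallyIntegrable w volume := hw.locallyIntegrable (by norm_num)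
  have hint : ∀ h : E d → ℝ, ∫ t, h t ∂ν = ∫ t, ψ.normed volume t * h t := fun h => by
    rw [hν, integral_withDensity_eq_integral_toReal_smul hψm
      (Eventually.of_forall fun _ => ENNReal.ofReal_lt_top)]
    simp [ENNReal.toReal_ofReal (ψ.nonneg_normed _)]
  have hrepr : ∀ x, (ψ.normed volume ⋆[ContinuousLinearMap.lsmul ℝ ℝ, volume] w) x - w x
      = ∫ t, (w (x - t) - w x) ∂ν := fun x => by
    have hex := (ψ.hasCompactSupport_normed (μ := volume)).convolutionExists_left
      (ContinuousLinearMap.lsmul ℝ ℝ) ψ.continuous_normed hloc x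
    have hi : Integrable (fun t => ψ.normed volume t * w (x - t)) volume := hex
    rw [hint, convolution]
    simp only [ContinuousLinearMap.lsmul_apply, smul_eq_mul, mul_sub]
    rw [integral_sub hi (ψ.integrable_normed.mul_const _), integral_mul_const,
      ψ.integral_normed (μ := volume),
      one_mul]
  rw [← ENNReal.pow_le_pow_left_iff (n := 2) (by norm_num), eLpNorm_two_sq]
  have hmeas : Measurable (Function.uncurry fun x t : E d => ‖w (x - t) - w x‖ₑ ^ 2) := by
    unfold Function.uncurry
    fun_prop
  calc ∫⁻ x, ‖(ψ.normed volume ⋆[ContinuousLinearMap.lsmul ℝ ℝ, volume] w) x - w x‖ₑ ^ 2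
      ≤ ∫⁻ x, ∫⁻ t, ‖w (x - t) - w x‖ₑ ^ 2 ∂ν := by
        refine lintegral_mono fun x => ?_
        simp only [hrepr]
        exact enorm_integral_sq_le _
    _ = ∫⁻ t, (∫⁻ x, ‖w (x - t) - w x‖ₑ ^ 2) ∂ν := lintegral_lintegral_swap hmeas.aemeasurable
    _ ≤ ∫⁻ _, ε ^ 2 ∂ν := by
        refine lintegral_mono_ae ?_
        rw [hν]
        refine (ae_withDensity_iff hψm).2 (Eventually.of_forall fun t ht => ?_)
        have hts : t ∈ Function.support (ψ.normed volume) := fun h0 => ht (by simp [h0])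
        rw [ψ.support_normed_eq, mem_ball_zero_iff] at hts
        rw [← eLpNorm_two_sq]
        gcongr
        exact hε t hts
    _ = ε ^ 2 := by simp

lemma exists_eLpNorm_convolution_sub_le {w : E d → ℝ} (hw : MemLp w 2 volume) {ε : ℝ≥0∞}
    (hε : ε ≠ 0) : ∃ δ > 0, ∀ ψ : ContDiffBump (0 : E d), ψ.rOut < δ →
      eLpNorm (fun x => (ψ.normed volume ⋆[ContinuousLinearMap.lsmul ℝ ℝ, volume] w) x - w x) 2
        volume ≤ ε := by
  obtain ⟨w', hw'm, hww'⟩ : ∃ w' : E d → ℝ, Measurable w' ∧ w =ᵐ[volume] w' :=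
    ⟨hw.1.mk w, hw.1.stronglyMeasurable_mk.measurable, hw.1.ae_eq_mk⟩
  have hw' : MemLp w' 2 volume := (memLp_congr_ae hww').1 hw
  have h1 := ENNReal.tendsto_nhds_zero.1 (tendsto_eLpNorm_comp_affine hw') ε
    (pos_iff_ne_zero.2 hε)
  obtain ⟨δ, hδ, H⟩ := Metric.eventually_nhds_iff.1 h1
  refine ⟨δ, hδ, fun ψ hψ => ?_⟩
  have h2 := eLpNorm_convolution_sub_le_of_measurable hw'm hw' ψ (ε := ε) fun t ht => by
    have := @H (1, -t) (by
      rw [Prod.dist_eq]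
      simp only [dist_self, dist_zero_right, norm_neg]
      exact max_lt hδ (ht.trans hψ))
    simpa [sub_eq_add_neg] using! this
  rw [convolution_congr _ (ae_eq_refl _) hww']
  refine le_of_eq_of_le (eLpNorm_congr_ae ?_) h2
  filter_upwards [hww'] with x hx
  rw [hx]

end

/-! ### Approximation by smooth functions together with the partial derivatives -/

section

variable {d : ℕ}

/-- `u` together with the would-be gradient `v` is a limit in `L²(μ)` of compactly supported `C¹`
functions on the whole space together with their gradients. -/
def C1Approx (μ : Measure (E d)) (u : E d → ℝ) (v : Fin d → E d → ℝ) : Prop :=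
  ∀ ε : ℝ≥0∞, ε ≠ 0 → ∃ F : E d → ℝ, ContDiff ℝ 1 F ∧ HasCompactSupport F ∧
    eLpNorm (fun x => F x - u x) 2 μ ≤ ε ∧
    ∀ i, eLpNorm (fun x => partialDeriv F i x - v i x) 2 μ ≤ ε

lemma partialDeriv_eq_fderiv {F : E d → ℝ} {x : E d} (hF : DifferentiableAt ℝ F x) (i : Fin d) :
    partialDeriv F i x = fderiv ℝ F x (EuclideanSpace.single i 1) :=
  hF.lineDeriv_eq_fderiv

lemma continuous_partialDeriv {F : E d → ℝ} (hF : ContDiff ℝ 1 F) (i : Fin d) :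
    Continuous (partialDeriv F i) := by
  have h : partialDeriv F i = fun x => fderiv ℝ F x (EuclideanSpace.single i 1) :=
    funext fun x => partialDeriv_eq_fderiv (hF.differentiable one_ne_zero x) i
  rw [h]
  exact (hF.continuous_fderiv one_ne_zero).clm_apply continuous_const

lemma hasCompactSupport_partialDeriv {F : E d → ℝ} (hF : ContDiff ℝ 1 F)
    (hFs : HasCompactSupport F) (i : Fin d) : HasCompactSupport (partialDeriv F i) := by
  have h : partialDeriv F i = fun x => fderiv ℝ F x (EuclideanSpace.single i 1) :=
    funext fun x => partialDeriv_eq_fderiv (hF.differentiable one_ne_zero x) i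
  rw [h]
  exact hFs.fderiv_apply ℝ _

lemma norm_gradient_sq {F : E d → ℝ} {x : E d} (hF : DifferentiableAt ℝ F x) :
    ‖gradient F x‖ ^ 2 = ∑ i, partialDeriv F i x ^ 2 := by
  rw [EuclideanSpace.norm_sq_eq]
  refine Finset.sum_congr rfl fun i _ => ?_
  rw [partialDeriv_eq_fderiv hF, Real.norm_eq_abs, sq_abs, gradient,
    ← InnerProductSpace.toDual_symm_apply, EuclideanSpace.inner_single_right]
  simp

/-- The partial derivative of a mollification is the mollification of the partial derivative: as
the line derivative of `u` exists everywhere, integration by parts moves it from the kernel to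
`u`. -/
lemma partialDeriv_convolution {u : E d → ℝ} {v : Fin d → E d → ℝ} (hu : MemLp u 2 volume)
    (hv : ∀ i, MemLp (v i) 2 volume)
    (h : ∀ i x, HasLineDerivAt ℝ u (v i x) x (EuclideanSpace.single i 1))
    {ψ : E d → ℝ} (hψ : ContDiff ℝ 1 ψ) (hψs : HasCompactSupport ψ) (i : Fin d) (x : E d) :
    partialDeriv (ψ ⋆[ContinuousLinearMap.lsmul ℝ ℝ, volume] u) i x =
      (ψ ⋆[ContinuousLinearMap.lsmul ℝ ℝ, volume] v i) x := by
  have hul : LocallyIntegrable u volume := hu.locallyIntegrable (by norm_num)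
  have hvl : LocallyIntegrable (v i) volume := (hv i).locallyIntegrable (by norm_num)
  have hF := hψs.hasFDerivAt_convolution_left (ContinuousLinearMap.lsmul ℝ ℝ) hψ hul x
  rw [partialDeriv_eq_fderiv hF.differentiableAt, hF.fderiv]
  have hψ'c := hψ.continuous_fderiv one_ne_zero
  have hψ'e : Continuous fun t => fderiv ℝ ψ t (EuclideanSpace.single i (1 : ℝ)) :=
    hψ'c.clm_apply continuous_const
  have hψ'es : HasCompactSupport fun t => fderiv ℝ ψ t (EuclideanSpace.single i (1 : ℝ)) :=
    hψs.fderiv_apply ℝ _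
  have i1 : Integrable (fun t => (fderiv ℝ ψ t (EuclideanSpace.single i (1 : ℝ))) * u (x - t)) :=
    hψ'es.convolutionExists_left (ContinuousLinearMap.lsmul ℝ ℝ) hψ'e hul x
  have i2 : Integrable (fun t => ψ t * v i (x - t)) :=
    hψs.convolutionExists_left (ContinuousLinearMap.lsmul ℝ ℝ) hψ.continuous hvl x
  have i3 : Integrable (fun t => ψ t * u (x - t)) :=
    hψs.convolutionExists_left (ContinuousLinearMap.lsmul ℝ ℝ) hψ.continuous hul x
  have e1 : ((fderiv ℝ ψ ⋆[(ContinuousLinearMap.lsmul ℝ ℝ).precompL (E d), volume] u) x)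
      (EuclideanSpace.single i 1) =
      ∫ t, (fderiv ℝ ψ t (EuclideanSpace.single i (1 : ℝ))) * u (x - t) := by
    have := (hψs.fderiv ℝ).convolutionExists_left
      ((ContinuousLinearMap.lsmul ℝ ℝ : ℝ →L[ℝ] ℝ →L[ℝ] ℝ).precompL (E d)) hψ'c hul x
    rw [convolution, ContinuousLinearMap.integral_apply this]
    simp [ContinuousLinearMap.precompL_apply]
  rw [e1]
  have hibp := integral_bilinear_hasLineDerivAt_right_eq_neg_left_of_integrable
    (μ := (volume : Measure (E d))) (B := ContinuousLinearMap.mul ℝ ℝ)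
    (f := ψ) (f' := fun t => fderiv ℝ ψ t (EuclideanSpace.single i (1 : ℝ)))
    (g := fun t => u (x - t)) (g' := fun t => -v i (x - t)) (v := EuclideanSpace.single i 1)
    (by simpa using! i1) (by simpa using! i2.neg) (by simpa using! i3)
    (fun t _ => (hψ.differentiable one_ne_zero t).hasFDerivAt.hasLineDerivAt _)
    (fun t _ => by
      have h1 := (h i (x - t)).smul (-1 : ℝ)
      simp only [neg_smul, one_smul] at h1
      unfold HasLineDerivAt at h1 ⊢
      refine h1.congr_of_eventuallyEq (Eventually.of_forall fun s => ?_)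
      simp only
      congr 1
      module)
  simp only [ContinuousLinearMap.mul_apply', mul_neg, integral_neg] at hibp
  rw [← neg_inj, ← hibp]
  rfl

lemma contDiff_one_convolution {u ψ : E d → ℝ} (hψs : HasCompactSupport ψ) (hψ : ContDiff ℝ 1 ψ)
    (hu : LocallyIntegrable u volume) :
    ContDiff ℝ 1 (ψ ⋆[ContinuousLinearMap.lsmul ℝ ℝ, volume] u) :=
  hψs.contDiff_convolution_left (n := 1) (ContinuousLinearMap.lsmul ℝ ℝ) hψ hu

/-- A compactly supported `L²` function with line derivatives along the axes at every point, all of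
them in `L²`, is approximated by its mollifications. -/
lemma c1Approx_of_hasLineDerivAt {u : E d → ℝ} {v : Fin d → E d → ℝ} (hus : HasCompactSupport u)
    (hu : MemLp u 2 volume) (hv : ∀ i, MemLp (v i) 2 volume)
    (h : ∀ i x, HasLineDerivAt ℝ u (v i x) x (EuclideanSpace.single i 1)) :
    C1Approx volume u v := by
  intro ε hε
  obtain ⟨δ₀, hδ₀, H₀⟩ := exists_eLpNorm_convolution_sub_le hu hε
  choose δ hδ H using fun i => exists_eLpNorm_convolution_sub_le (hv i) hε
  obtain ⟨r, hr, hr₀, hri⟩ : ∃ r > 0, r < δ₀ ∧ ∀ i, r < δ i := by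
    have h1 : ∀ᶠ r : ℝ in 𝓝[>] 0, r < δ₀ := nhdsWithin_le_nhds (gt_mem_nhds hδ₀)
    have h2 : ∀ᶠ r : ℝ in 𝓝[>] 0, ∀ i, r < δ i :=
      eventually_all.2 fun i => nhdsWithin_le_nhds (gt_mem_nhds (hδ i))
    obtain ⟨r, ⟨h1, h2⟩, h3⟩ := ((h1.and h2).and self_mem_nhdsWithin).exists
    exact ⟨r, h3, h1, h2⟩
  obtain ⟨ψ, hψr⟩ : ∃ ψ : ContDiffBump (0 : E d), ψ.rOut = r :=
    ⟨⟨r / 2, r, by positivity, by linarith⟩, rfl⟩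
  have hψ : ContDiff ℝ 1 (ψ.normed (volume : Measure (E d))) := ψ.contDiff_normed (n := 1)
  have hψs := ψ.hasCompactSupport_normed (μ := (volume : Measure (E d)))
  refine ⟨ψ.normed volume ⋆[ContinuousLinearMap.lsmul ℝ ℝ, volume] u, ?_, ?_, H₀ ψ (hψr ▸ hr₀), ?_⟩
  · exact contDiff_one_convolution hψs hψ (hu.locallyIntegrable (by norm_num))
  · exact hψs.convolution (ContinuousLinearMap.lsmul ℝ ℝ) hus
  · intro i
    simp only [partialDeriv_convolution hu hv h hψ hψs]
    exact H i ψ (hψr ▸ hri i)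

lemma C1Approx.mono_measure {μ ν : Measure (E d)} {u : E d → ℝ} {v : Fin d → E d → ℝ}
    (h : C1Approx ν u v) {c : ℝ≥0∞} (hc : c ≠ ∞) (hμ : μ ≤ c • ν) : C1Approx μ u v := by
  intro ε hε
  have hle : ∀ w : E d → ℝ, eLpNorm w 2 μ ≤ (c + 1) * eLpNorm w 2 ν := fun w => by
    rw [← ENNReal.pow_le_pow_left_iff (n := 2) (by norm_num), mul_pow, eLpNorm_two_sq,
      eLpNorm_two_sq]
    calc ∫⁻ x, ‖w x‖ₑ ^ 2 ∂μ ≤ ∫⁻ x, ‖w x‖ₑ ^ 2 ∂(c • ν) := lintegral_mono' hμ le_rfl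
      _ = c * ∫⁻ x, ‖w x‖ₑ ^ 2 ∂ν := by rw [lintegral_smul_measure, smul_eq_mul]
      _ ≤ (c + 1) ^ 2 * ∫⁻ x, ‖w x‖ₑ ^ 2 ∂ν := by
        gcongr
        exact le_self_add.trans (le_self_pow₀ le_add_self (by norm_num))
  obtain ⟨F, hF, hFs, h1, h2⟩ := h (ε / (c + 1)) (by
    simp [hε, hc])
  have hm : (c + 1) * (ε / (c + 1)) ≤ ε := ENNReal.mul_div_le
  exact ⟨F, hF, hFs, (hle _).trans ((mul_le_mul_right h1 _).trans hm),
    fun i => (hle _).trans ((mul_le_mul_right (h2 i) _).trans hm)⟩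

lemma C1Approx.congr_ae {μ : Measure (E d)} {u u' : E d → ℝ} {v v' : Fin d → E d → ℝ}
    (h : C1Approx μ u v) (hu : u =ᵐ[μ] u') (hv : ∀ i, v i =ᵐ[μ] v' i) : C1Approx μ u' v' := by
  intro ε hε
  obtain ⟨F, hF, hFs, h1, h2⟩ := h ε hε
  refine ⟨F, hF, hFs, ?_, fun i => ?_⟩
  · refine le_of_eq_of_le (eLpNorm_congr_ae ?_) h1
    filter_upwards [hu] with x hx
    rw [hx]
  · refine le_of_eq_of_le (eLpNorm_congr_ae ?_) (h2 i)
    filter_upwards [hv i] with x hx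
    rw [hx]

/-- Limits in `L²` of approximable pairs are approximable. -/
lemma C1Approx.of_tendsto {ι : Type*} {l : Filter ι} [l.NeBot] {μ : Measure (E d)} {u : E d → ℝ}
    {v : Fin d → E d → ℝ} {U : ι → E d → ℝ} {V : ι → Fin d → E d → ℝ}
    (hu : AEStronglyMeasurable u μ) (hv : ∀ i, AEStronglyMeasurable (v i) μ)
    (hU : ∀ᶠ n in l, AEStronglyMeasurable (U n) μ)
    (hV : ∀ i, ∀ᶠ n in l, AEStronglyMeasurable (V n i) μ)
    (h : ∀ᶠ n in l, C1Approx μ (U n) (V n))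
    (hUu : Tendsto (fun n => eLpNorm (fun x => U n x - u x) 2 μ) l (𝓝 0))
    (hVv : ∀ i, Tendsto (fun n => eLpNorm (fun x => V n i x - v i x) 2 μ) l (𝓝 0)) :
    C1Approx μ u v := by
  intro ε hε
  have hε2 : ε / 2 ≠ 0 := by simp [hε]
  have h1 := ENNReal.tendsto_nhds_zero.1 hUu (ε / 2) (pos_iff_ne_zero.2 hε2)
  have h2 : ∀ᶠ n in l, ∀ i, eLpNorm (fun x => V n i x - v i x) 2 μ ≤ ε / 2 :=
    eventually_all.2 fun i =>
      ENNReal.tendsto_nhds_zero.1 (hVv i) (ε / 2) (pos_iff_ne_zero.2 hε2)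
  obtain ⟨n, hn1, hn2, hnU, hnV, hn⟩ :=
    (h1.and (h2.and (hU.and ((eventually_all.2 hV).and h)))).exists
  obtain ⟨F, hF, hFs, hF1, hF2⟩ := hn (ε / 2) hε2
  have tri : ∀ a b c : E d → ℝ, AEStronglyMeasurable a μ → AEStronglyMeasurable b μ →
      AEStronglyMeasurable c μ → eLpNorm (fun x => a x - b x) 2 μ ≤ ε / 2 →
      eLpNorm (fun x => b x - c x) 2 μ ≤ ε / 2 → eLpNorm (fun x => a x - c x) 2 μ ≤ ε := by
    intro a b c ha hb hc h1 h2
    have e : (fun x => a x - c x) = (fun x => a x - b x) + fun x => b x - c x := by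
      ext x; simp
    rw [e, ← ENNReal.add_halves ε]
    exact (eLpNorm_add_le (ha.sub hb) (hb.sub hc) (by norm_num)).trans (add_le_add h1 h2)
  exact ⟨F, hF, hFs, tri _ _ _ hF.continuous.aestronglyMeasurable hnU hu hF1 hn1, fun i =>
    tri _ _ _ (continuous_partialDeriv hF i).aestronglyMeasurable (hnV i) (hv i) (hF2 i) (hn2 i)⟩

end

/-! ### The two kinds of densities -/

section

variable {d : ℕ}

lemma ae_mem_posSet {ρ : E d → ℝ} (hρ : Measurable ρ) : ∀ᵐ x ∂(law ρ), x ∈ posSet ρ := by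
  rw [law, ae_withDensity_iff hρ.ennreal_ofReal]
  exact Eventually.of_forall fun x hx => by simpa [posSet] using hx

lemma measureReal_pos_of_isOpen {U : Set (E d)} (hU : IsOpen U) (hne : U.Nonempty)
    (hb : Bornology.IsBounded U) : 0 < volume.real U :=
  ENNReal.toReal_pos (hU.measure_pos volume hne).ne' hb.measure_lt_top.ne

lemma posSet_uniform {U : Set (E d)} (hU : IsOpen U) (hne : U.Nonempty)
    (hb : Bornology.IsBounded U) : posSet (U.indicator fun _ => (volume.real U)⁻¹) = U := by
  ext x
  have := measureReal_pos_of_isOpen hU hne hb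
  by_cases hx : x ∈ U <;> simp [posSet, hx, this]

lemma law_uniform {U : Set (E d)} (hU : IsOpen U) (hne : U.Nonempty)
    (hb : Bornology.IsBounded U) :
    law (U.indicator fun _ => (volume.real U)⁻¹) = (volume U)⁻¹ • volume.restrict U := by
  have h0 := measureReal_pos_of_isOpen hU hne hb
  have e : (fun x => ENNReal.ofReal (U.indicator (fun _ => (volume.real U)⁻¹) x)) =
      U.indicator fun _ => (volume U)⁻¹ := by
    ext x
    by_cases hx : x ∈ U
    · simp only [indicator_of_mem hx]
      rw [ENNReal.ofReal_inv_of_pos h0, ofReal_measureReal hb.measure_lt_top.ne]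
    · simp [hx]
  rw [law, e, withDensity_indicator hU.measurableSet, withDensity_const]

lemma isProbabilityMeasure_law_uniform {U : Set (E d)} (hU : IsOpen U) (hne : U.Nonempty)
    (hb : Bornology.IsBounded U) :
    IsProbabilityMeasure (law (U.indicator fun _ => (volume.real U)⁻¹)) := by
  refine ⟨?_⟩
  rw [law_uniform hU hne hb]
  simp only [Measure.smul_apply, Measure.restrict_apply_univ, smul_eq_mul]
  exact ENNReal.inv_mul_cancel (hU.measure_pos volume hne).ne' hb.measure_lt_top.ne

lemma IsStdGaussianDensity.pos {ρ : E d → ℝ} (h : IsStdGaussianDensity ρ) (x : E d) : 0 < ρ x := by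
  rw [h]
  exact Finset.prod_pos fun i _ => gaussianPDFReal_pos _ _ _ (by simp)

lemma IsStdGaussianDensity.continuous {ρ : E d → ℝ} (h : IsStdGaussianDensity ρ) :
    Continuous ρ := by
  rw [h]
  refine continuous_finsetProd _ fun i _ => ?_
  have : Continuous (gaussianPDFReal 0 1) := by
    unfold gaussianPDFReal
    fun_prop
  exact this.comp (by fun_prop)

lemma IsStdGaussianDensity.le_one {ρ : E d → ℝ} (h : IsStdGaussianDensity ρ) (x : E d) :
    ρ x ≤ 1 := by
  rw [h]
  refine Finset.prod_le_one (fun i _ => gaussianPDFReal_nonneg _ _ _) fun i _ => ?_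
  rw [gaussianPDFReal]
  have h1 : (√(2 * Real.pi * ((1 : ℝ≥0) : ℝ)))⁻¹ ≤ 1 := by
    refine inv_le_one_of_one_le₀ ?_
    rw [Real.one_le_sqrt]
    have := Real.pi_gt_three
    norm_num
    linarith
  have h2 : Real.exp (-(x i - 0) ^ 2 / (2 * ((1 : ℝ≥0) : ℝ))) ≤ 1 := by
    rw [Real.exp_le_one_iff]
    norm_num
    have := sq_nonneg (x i)
    linarith
  exact mul_le_one₀ h1 (Real.exp_pos _).le h2

lemma IsStdGaussianDensity.posSet_eq {ρ : E d → ℝ} (h : IsStdGaussianDensity ρ) :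
    posSet ρ = univ := by
  ext x
  simp [posSet, h.pos x]

/-- The density of `N(0, I)` as a product of one-dimensional densities gives Mathlib's standard
Gaussian measure. -/
lemma IsStdGaussianDensity.law_eq {ρ : E d → ℝ} (h : IsStdGaussianDensity ρ) :
    law ρ = stdGaussian (E d) := by
  have hm : Measurable ρ := h.continuous.measurable
  rw [← map_pi_eq_stdGaussian]
  have hpi : Measure.pi (fun _ : Fin d => gaussianReal 0 1) =
      volume.withDensity fun x : Fin d → ℝ => ENNReal.ofReal (∏ i, gaussianPDFReal 0 1 (x i)) := by
    refine Measure.pi_eq fun s hs => ?_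
    rw [withDensity_apply _ (MeasurableSet.univ_pi hs), volume_pi, Measure.restrict_pi_pi]
    rw [← ofReal_integral_eq_lintegral_ofReal
      (Integrable.fintype_prod fun i => (integrable_gaussianPDFReal 0 1).restrict)
      (Eventually.of_forall fun x => Finset.prod_nonneg fun i _ => gaussianPDFReal_nonneg _ _ _),
      integral_fintype_prod_eq_prod, ENNReal.ofReal_prod_of_nonneg
        fun i _ => integral_nonneg fun x => gaussianPDFReal_nonneg _ _ _]
    exact Finset.prod_congr rfl fun i _ =>
      (gaussianReal_apply_eq_integral _ (by simp) _).symm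
  rw [hpi]
  refine Measure.ext fun s hs => ?_
  rw [Measure.map_apply (by fun_prop) hs, withDensity_apply _ (by measurability), law,
    withDensity_apply _ hs, h,
    ← (PiLp.volume_preserving_toLp (Fin d)).setLIntegral_comp_preimage_emb
      (MeasurableEquiv.toLp 2 (Fin d → ℝ)).measurableEmbedding]

/-! ### Functions with partial derivatives on an open set -/

/-- `f` is measurable on `X` and has at every point of `X` the partial derivatives `v i`. -/
structure HasGradOn (X : Set (E d)) (f : E d → ℝ) (v : Fin d → E d → ℝ) : Prop where
  measurable : Measurable (X.indicator f)
  hasLineDerivAt : ∀ i, ∀ x ∈ X, HasLineDerivAt ℝ f (v i x) x (EuclideanSpace.single i 1)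

/-- `u` is a compactly supported `L²` function on the whole space with partial derivatives `w i` at
every point, and these are in `L²` as well. -/
structure HasGlobalGrad (u : E d → ℝ) (w : Fin d → E d → ℝ) : Prop where
  hasCompactSupport : HasCompactSupport u
  memLp : MemLp u 2 volume
  memLp_grad : ∀ i, MemLp (w i) 2 volume
  hasLineDerivAt : ∀ i x, HasLineDerivAt ℝ u (w i x) x (EuclideanSpace.single i 1)

lemma HasGlobalGrad.c1Approx {u : E d → ℝ} {w : Fin d → E d → ℝ} (h : HasGlobalGrad u w) :
    C1Approx volume u w :=
  c1Approx_of_hasLineDerivAt h.1 h.2 h.3 h.4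

lemma HasGlobalGrad.comp_affine {u : E d → ℝ} {w : Fin d → E d → ℝ} (h : HasGlobalGrad u w)
    {s : ℝ} (hs : 1 / 2 ≤ s) (a : E d) :
    HasGlobalGrad (fun x => u (s • x + a)) (fun i x => s * w i (s • x + a)) := by
  have hs0 : s ≠ 0 := by linarith
  refine ⟨?_, memLp_comp_affine h.2 hs a, fun i => (memLp_comp_affine (h.3 i) hs a).const_mul s,
    fun i x => ?_⟩
  · exact h.1.comp_homeomorph ((Homeomorph.smulOfNeZero s hs0).trans (Homeomorph.addRight a))
  · have h1 := (h.4 i (s • x + a)).smul s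
    unfold HasLineDerivAt at h1 ⊢
    refine HasDerivAt.congr_of_eventuallyEq (by simpa using! h1)
      (Eventually.of_forall fun t => ?_)
    simp only
    congr 1
    module

/-- Multiplication by a smooth cut-off function supported in `X` turns a bounded function with
partial derivatives on `X` into a globally defined one. -/
lemma HasGradOn.hasGlobalGrad_cutoff {X : Set (E d)} (hX : IsOpen X) {f : E d → ℝ}
    {v : Fin d → E d → ℝ} (hf : HasGradOn X f v) {M : ℝ} (hM : ∀ x ∈ X, |f x| ≤ M)
    {χ : E d → ℝ} (hχ : ContDiff ℝ 1 χ) (hχs : HasCompactSupport χ) (hχX : tsupport χ ⊆ X)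
    (hv : ∀ i, MemLp (v i) 2 (volume.restrict (tsupport χ))) :
    HasGlobalGrad (fun x => χ x * X.indicator f x)
      (fun i x => χ x * X.indicator (v i) x + partialDeriv χ i x * X.indicator f x) := by
  have hfb : ∀ x, ‖X.indicator f x‖ ≤ |M| := fun x => by
    by_cases hx : x ∈ X
    · simpa [hx] using (hM x hx).trans (le_abs_self M)
    · simp [hx]
  have hbdd : ∀ c : E d → ℝ, Continuous c → HasCompactSupport c →
      MemLp (fun x => c x * X.indicator f x) 2 volume := fun c hc hcs => by
    have h1 : MemLp c 2 volume := hc.memLp_of_hasCompactSupport hcs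
    refine MemLp.of_le_mul (c := |M|) h1 (hc.measurable.mul hf.1).aestronglyMeasurable ?_
    refine Eventually.of_forall fun x => ?_
    rw [norm_mul, mul_comm]
    gcongr
    exact hfb x
  refine ⟨hχs.mul_right, hbdd χ hχ.continuous hχs, fun i => ?_, fun i x => ?_⟩
  · refine MemLp.add ?_ (hbdd _ (continuous_partialDeriv hχ i)
      (hasCompactSupport_partialDeriv hχ hχs i))
    obtain ⟨C, hC⟩ := hχ.continuous.bounded_above_of_compact_support hχs
    have e : (fun x => χ x * X.indicator (v i) x) =
        (tsupport χ).indicator fun x => χ x * v i x := by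
      ext x
      by_cases hx : x ∈ tsupport χ
      · simp [hx, hχX hx]
      · simp [hx, image_eq_zero_of_notMem_tsupport hx]
    rw [e, memLp_indicator_iff_restrict (isClosed_tsupport χ).measurableSet]
    refine MemLp.of_le_mul (c := C) (hv i)
      (hχ.continuous.aestronglyMeasurable.mul (hv i).1) (Eventually.of_forall fun x => ?_)
    rw [norm_mul]
    gcongr
    exact hC x
  · have hline : Tendsto (fun t : ℝ => x + t • EuclideanSpace.single i (1 : ℝ)) (𝓝 0) (𝓝 x) := by
      have : Continuous fun t : ℝ => x + t • EuclideanSpace.single i (1 : ℝ) := by fun_prop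
      simpa using! this.tendsto 0
    by_cases hx : x ∈ X
    · have h1 := hf.2 i x hx
      have h2 : HasLineDerivAt ℝ χ (partialDeriv χ i x) x (EuclideanSpace.single i 1) := by
        have hd := hχ.differentiable one_ne_zero x
        rw [partialDeriv_eq_fderiv hd]
        exact hd.hasFDerivAt.hasLineDerivAt _
      unfold HasLineDerivAt at h1 h2 ⊢
      have h3 := h2.mul h1
      refine HasDerivAt.congr_of_eventuallyEq (f := fun t : ℝ =>
        χ (x + t • EuclideanSpace.single i 1) * f (x + t • EuclideanSpace.single i 1)) ?_ ?_
      · convert! h3 using 1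
        simp [hx]
        ring
      · filter_upwards [hline.eventually (hX.mem_nhds hx)] with t ht
        rw [indicator_of_mem ht]
    · have hx' : x ∉ tsupport χ := fun h => hx (hχX h)
      have h0 : χ =ᶠ[𝓝 x] 0 := notMem_tsupport_iff_eventuallyEq.1 hx'
      unfold HasLineDerivAt
      refine HasDerivAt.congr_of_eventuallyEq (f := fun _ : ℝ => (0 : ℝ)) ?_ ?_
      · simpa [hx] using hasDerivAt_const (0 : ℝ) (0 : ℝ)
      · filter_upwards [hline.eventually h0] with t ht
        simp [ht]

/-- The cut-off function is `1` in a neighbourhood of `K`, so its partial derivatives vanish on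
`K`. -/
lemma exists_smooth_cutoff {X K : Set (E d)} (hX : IsOpen X) (hK : IsCompact K) (hKX : K ⊆ X) :
    ∃ χ : E d → ℝ, ContDiff ℝ 1 χ ∧ HasCompactSupport χ ∧ tsupport χ ⊆ X ∧
      ∀ x ∈ K, χ x = 1 ∧ ∀ i, partialDeriv χ i x = 0 := by
  obtain ⟨L, hL, hKL, hLX⟩ := exists_compact_between hK hX hKX
  obtain ⟨χ, h1, h0, -⟩ := exists_contMDiffMap_one_nhds_of_subset_interior
    (modelWithCornersSelf ℝ (E d)) (n := 1) hK.isClosed hKL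
  have hsub : tsupport χ ⊆ L := by
    refine closure_minimal (fun x hx => ?_) hL.isClosed
    by_contra hxL
    exact hx (h0 x hxL)
  have hd : ContDiff ℝ 1 χ := by
    have := χ.contMDiff
    rwa [contMDiff_iff_contDiff] at this
  refine ⟨χ, hd, hL.of_isClosed_subset (isClosed_tsupport _) hsub, hsub.trans hLX,
    fun x hx => ?_⟩
  have hx1 : ∀ᶠ y in 𝓝 x, χ y = 1 := h1.filter_mono (nhds_le_nhdsSet hx)
  refine ⟨hx1.self_of_nhds, fun i => ?_⟩
  rw [partialDeriv_eq_fderiv (hd.differentiable one_ne_zero x)]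
  have : (χ : E d → ℝ) =ᶠ[𝓝 x] fun _ => 1 := hx1
  rw [this.fderiv_eq]
  simp

end

/-! ### Approximation of bounded functions -/

section

variable {d : ℕ}

lemma tendsto_eLpNorm_two_of_dominated {α : Type*} [MeasurableSpace α] {μ : Measure α}
    {F : ℕ → α → ℝ} {f G : α → ℝ} (hF : ∀ n, AEStronglyMeasurable (F n) μ)
    (hf : AEStronglyMeasurable f μ) (hG : MemLp G 2 μ)
    (hb : ∀ n, ∀ᵐ x ∂μ, |F n x - f x| ≤ G x)
    (hlim : ∀ᵐ x ∂μ, Tendsto (fun n => F n x) atTop (𝓝 (f x))) :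
    Tendsto (fun n => eLpNorm (fun x => F n x - f x) 2 μ) atTop (𝓝 0) := by
  have key : Tendsto (fun n => ∫⁻ x, ‖F n x - f x‖ₑ ^ 2 ∂μ) atTop (𝓝 (∫⁻ _, 0 ∂μ)) := by
    refine tendsto_lintegral_of_dominated_convergence' (fun x => ‖G x‖ₑ ^ 2)
      (fun n => ((hF n).sub hf).enorm.pow_const 2) (fun n => ?_) ?_ ?_
    · filter_upwards [hb n] with x hx
      gcongr
      rw [enorm_le_iff_norm_le]
      exact hx.trans (le_abs_self _)
    · rw [← eLpNorm_two_sq]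
      exact ENNReal.pow_ne_top hG.2.ne
    · filter_upwards [hlim] with x hx
      have h1 : Tendsto (fun n => F n x - f x) atTop (𝓝 0) := by
        simpa using hx.sub_const (f x)
      have h2 : Continuous fun t : ℝ => ‖t‖ₑ ^ 2 := by fun_prop
      simpa using! (h2.tendsto 0).comp h1
  rw [lintegral_zero] at key
  have h2 := (ENNReal.continuous_rpow_const (y := 1 / 2)).tendsto 0 |>.comp key
  have e : ∀ n, (∫⁻ x, ‖F n x - f x‖ₑ ^ 2 ∂μ) ^ (1 / 2 : ℝ) =
      eLpNorm (fun x => F n x - f x) 2 μ := fun n => by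
    rw [← eLpNorm_two_sq, ← ENNReal.rpow_natCast, ← ENNReal.rpow_mul]
    norm_num
  refine Tendsto.congr e ?_
  simpa [Function.comp_def] using! h2

/-- On a bounded convex open set the approximating functions are obtained by first shrinking the
set towards one of its points, which gives room for a cut-off. -/
lemma c1Approx_convex_of_bounded {U : Set (E d)} (hU : IsOpen U) (hne : U.Nonempty)
    (hb : Bornology.IsBounded U) (hc : Convex ℝ U) {f : E d → ℝ} {v : Fin d → E d → ℝ}
    (hf : HasGradOn U f v) {M : ℝ} (hM : ∀ x ∈ U, |f x| ≤ M)
    (hv : ∀ i, MemLp (v i) 2 (volume.restrict U)) : C1Approx (volume.restrict U) f v := by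
  obtain ⟨x₀, hx₀⟩ := hne
  have hfL : MemLp (U.indicator f) 2 volume := by
    rw [memLp_indicator_iff_restrict hU.measurableSet]
    have : IsFiniteMeasure (volume.restrict U) := ⟨by simpa using hb.measure_lt_top⟩
    refine MemLp.of_bound ?_ M ?_
    · exact (aestronglyMeasurable_indicator_iff hU.measurableSet).1 hf.1.aestronglyMeasurable
    · filter_upwards [ae_restrict_mem hU.measurableSet] with x hx
      exact hM x hx
  have hvL : ∀ i, MemLp (U.indicator (v i)) 2 volume := fun i => by
    rw [memLp_indicator_iff_restrict hU.measurableSet]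
    exact hv i
  have hres : (volume : Measure (E d)).restrict U ≤ (1 : ℝ≥0∞) • volume := by
    rw [one_smul]; exact Measure.restrict_le_self
  have hs1 : ∀ᶠ s : ℝ in 𝓝[<] 1, 1 / 2 < s ∧ s < 1 :=
    (eventually_nhdsWithin_of_eventually_nhds
      (lt_mem_nhds (by norm_num : (1 / 2 : ℝ) < 1))).and self_mem_nhdsWithin
  -- the contraction `x ↦ x₀ + s (x - x₀)` tends to the identity as `s ↑ 1`
  have hT : Tendsto (fun s : ℝ => (s, (1 - s) • x₀)) (𝓝[<] 1) (𝓝 ((1 : ℝ), (0 : E d))) := by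
    have : Continuous fun s : ℝ => (s, (1 - s) • x₀) := by fun_prop
    simpa using! (this.tendsto 1).mono_left nhdsWithin_le_nhds
  have happ : ∀ s : ℝ, 1 / 2 < s → s < 1 →
      C1Approx (volume.restrict U) (fun x => U.indicator f (s • x + (1 - s) • x₀))
        (fun i x => s * U.indicator (v i) (s • x + (1 - s) • x₀)) := by
    intro s hs hs'
    have hK : IsCompact ((fun x => s • x + (1 - s) • x₀) '' closure U) :=
      (Metric.isCompact_of_isClosed_isBounded isClosed_closure hb.closure).image (by fun_prop)
    have hKU : (fun x => s • x + (1 - s) • x₀) '' closure U ⊆ U := by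
      rintro _ ⟨x, hx, rfl⟩
      have := hc.combo_interior_closure_mem_interior (by rwa [hU.interior_eq]) hx
        (by linarith : 0 < 1 - s) (by linarith : 0 ≤ s) (by ring)
      rw [hU.interior_eq, add_comm] at this
      exact this
    obtain ⟨χ, hχ, hχs, hχU, hχ1⟩ := exists_smooth_cutoff hU hK hKU
    have hg := hf.hasGlobalGrad_cutoff hU hM hχ hχs hχU fun i =>
      (hv i).mono_measure (Measure.restrict_mono_set _ hχU)
    have h1 := (hg.comp_affine hs.le ((1 - s) • x₀)).c1Approx.mono_measure
      ENNReal.one_ne_top hres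
    refine h1.congr_ae ?_ fun i => ?_
    · filter_upwards [ae_restrict_mem hU.measurableSet] with x hx
      have := hχ1 _ (mem_image_of_mem _ (subset_closure hx))
      simp [this.1]
    · filter_upwards [ae_restrict_mem hU.measurableSet] with x hx
      have := hχ1 _ (mem_image_of_mem _ (subset_closure hx))
      simp [this.1, this.2 i]
  have hlim : C1Approx (volume.restrict U) (U.indicator f) (fun i => U.indicator (v i)) := by
    refine C1Approx.of_tendsto (l := 𝓝[<] (1 : ℝ)) hfL.1.restrict (fun i => (hvL i).1.restrict)
      ?_ (fun i => ?_) (hs1.mono fun s hs => happ s hs.1 hs.2) ?_ fun i => ?_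
    · exact hs1.mono fun s hs => (memLp_comp_affine hfL hs.1.le _).1.restrict
    · exact hs1.mono fun s hs => ((memLp_comp_affine (hvL i) hs.1.le _).1.const_mul s).restrict
    · refine tendsto_of_tendsto_of_tendsto_of_le_of_le tendsto_const_nhds
        ((tendsto_eLpNorm_comp_affine hfL).comp hT) (fun _ => zero_le) fun s => ?_
      exact eLpNorm_mono_measure _ Measure.restrict_le_self
    · have h2 := (tendsto_eLpNorm_comp_affine (hvL i)).comp hT
      have h3 : Tendsto (fun s : ℝ => ENNReal.ofReal (1 - s) * eLpNorm (U.indicator (v i)) 2 volume)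
          (𝓝[<] 1) (𝓝 0) := by
        have h4 : Tendsto (fun s : ℝ => ENNReal.ofReal (1 - s)) (𝓝[<] 1) (𝓝 0) := by
          have : Continuous fun s : ℝ => ENNReal.ofReal (1 - s) :=
            ENNReal.continuous_ofReal.comp (by fun_prop)
          simpa using! (this.tendsto 1).mono_left nhdsWithin_le_nhds
        simpa using ENNReal.Tendsto.mul_const h4 (Or.inr (hvL i).2.ne)
      have h5 := h2.add h3
      rw [add_zero] at h5
      refine tendsto_of_tendsto_of_tendsto_of_le_of_le' tendsto_const_nhds h5
        (Eventually.of_forall fun _ => zero_le) (hs1.mono fun s hs => ?_)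
      have m1 := ((memLp_comp_affine (hvL i) hs.1.le ((1 - s) • x₀)).sub (hvL i)).const_mul s
      have m2 := (hvL i).const_mul (1 - s)
      have e : (fun x => s * U.indicator (v i) (s • x + (1 - s) • x₀) - U.indicator (v i) x) =
          (fun x => s * (U.indicator (v i) (s • x + (1 - s) • x₀) - U.indicator (v i) x))
            - fun x => (1 - s) * U.indicator (v i) x := by
        ext x; simp; ring
      refine (eLpNorm_mono_measure _ Measure.restrict_le_self).trans ?_
      rw [e]
      refine (eLpNorm_sub_le m1.1 m2.1 (by norm_num)).trans ?_
      gcongr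
      · have := eLpNorm_const_smul s
          (fun x => U.indicator (v i) (s • x + (1 - s) • x₀) - U.indicator (v i) x) 2 volume
        change eLpNorm (s • fun x => U.indicator (v i) (s • x + (1 - s) • x₀)
          - U.indicator (v i) x) 2 volume ≤ _
        rw [this]
        refine mul_le_of_le_one_left' ?_
        rw [Real.enorm_eq_ofReal (by linarith [hs.1])]
        exact ENNReal.ofReal_le_one.2 hs.2.le
      · change eLpNorm ((1 - s) • U.indicator (v i)) 2 volume ≤ _
        rw [eLpNorm_const_smul, Real.enorm_eq_ofReal (by linarith [hs.2])]
  refine hlim.congr_ae ?_ fun i => ?_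
  · filter_upwards [ae_restrict_mem hU.measurableSet] with x hx
    simp [hx]
  · filter_upwards [ae_restrict_mem hU.measurableSet] with x hx
    simp [hx]

lemma partialDeriv_comp_smul {χ : E d → ℝ} (hχ : ContDiff ℝ 1 χ) (c : ℝ) (i : Fin d) (x : E d) :
    partialDeriv (fun y => χ (c • y)) i x = c * partialDeriv χ i (c • x) := by
  have hd := hχ.differentiable one_ne_zero
  have h1 : HasFDerivAt (fun y : E d => χ (c • y))
      ((fderiv ℝ χ (c • x)).comp (c • ContinuousLinearMap.id ℝ (E d))) x :=
    (hd (c • x)).hasFDerivAt.comp x ((hasFDerivAt_id x).const_smul c)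
  rw [partialDeriv_eq_fderiv h1.differentiableAt, h1.fderiv, partialDeriv_eq_fderiv (hd _)]
  simp

/-- For a positive continuous density on the whole space, cut-offs with growing supports suffice. -/
lemma c1Approx_of_continuous_density {ρ : E d → ℝ} (hρc : Continuous ρ) (hρ0 : ∀ x, 0 < ρ x)
    (hρ1 : ∀ x, ρ x ≤ 1) (hfin : IsFiniteMeasure (law ρ)) {f : E d → ℝ} {v : Fin d → E d → ℝ}
    (hf : HasGradOn univ f v) {M : ℝ} (hM : ∀ x, |f x| ≤ M)
    (hv : ∀ i, MemLp (v i) 2 (law ρ)) : C1Approx (law ρ) f v := by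
  have hfm : Measurable f := by simpa using hf.1
  let χ : ContDiffBump (0 : E d) := ⟨1, 2, by norm_num, by norm_num⟩
  have hχ : ContDiff ℝ 1 χ := χ.contDiff
  have hlaw : law ρ ≤ (1 : ℝ≥0∞) • volume := by
    rw [one_smul, law]
    refine Measure.le_iff.2 fun s hs => ?_
    rw [withDensity_apply _ hs]
    calc ∫⁻ x in s, ENNReal.ofReal (ρ x) ≤ ∫⁻ _ in s, 1 :=
          lintegral_mono fun x => ENNReal.ofReal_le_one.2 (hρ1 x)
      _ = volume s := by simp
  -- on compact sets the density is bounded below, so `L²(ρ)` controls `L²` of Lebesgue measure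
  have hvK : ∀ K : Set (E d), IsCompact K → ∀ i, MemLp (v i) 2 (volume.restrict K) := by
    intro K hK i
    obtain ⟨c, hc, hcK⟩ : ∃ c > 0, ∀ x ∈ K, c ≤ ρ x := by
      rcases K.eq_empty_or_nonempty with rfl | hKne
      · exact ⟨1, one_pos, by simp⟩
      · obtain ⟨x, -, hx⟩ := hK.exists_isMinOn hKne hρc.continuousOn
        exact ⟨ρ x, hρ0 x, fun y hy => hx hy⟩
    refine (hv i).of_measure_le_smul (c := (ENNReal.ofReal c)⁻¹) (by simp [hc]) ?_
    refine Measure.le_iff.2 fun s hs => ?_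
    rw [Measure.restrict_apply hs, Measure.smul_apply, law, withDensity_apply _ hs, smul_eq_mul]
    have h1 : ENNReal.ofReal c * volume (s ∩ K) ≤ ∫⁻ x in s, ENNReal.ofReal (ρ x) := by
      calc ENNReal.ofReal c * volume (s ∩ K) = ∫⁻ _ in s ∩ K, ENNReal.ofReal c := by simp
        _ ≤ ∫⁻ x in s ∩ K, ENNReal.ofReal (ρ x) := by
          refine setLIntegral_mono (by fun_prop) fun x hx => ?_
          exact ENNReal.ofReal_le_ofReal (hcK x hx.2)
        _ ≤ ∫⁻ x in s, ENNReal.ofReal (ρ x) := lintegral_mono_set inter_subset_left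
    rw [mul_comm, ← div_eq_mul_inv, ENNReal.le_div_iff_mul_le (by simp [hc]) (by simp), mul_comm]
    exact h1
  let c : ℕ → ℝ := fun n => ((n : ℝ) + 1)⁻¹
  have hc0 : ∀ n, 0 < c n := fun n => by positivity
  have hc1 : ∀ n, c n ≤ 1 := fun n => inv_le_one_of_one_le₀ (by simp)
  have hclim : Tendsto c atTop (𝓝 0) := by
    simpa [c, one_div] using tendsto_one_div_add_atTop_nhds_zero_nat (𝕜 := ℝ)
  have hχn : ∀ n, ContDiff ℝ 1 fun x : E d => χ (c n • x) := fun n =>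
    hχ.comp (contDiff_const_smul (c n))
  have hχns : ∀ n, HasCompactSupport fun x : E d => χ (c n • x) := fun n =>
    χ.hasCompactSupport.comp_homeomorph (Homeomorph.smulOfNeZero (c n) (hc0 n).ne')
  have hχlim : ∀ x : E d, Tendsto (fun n => χ (c n • x)) atTop (𝓝 1) := fun x => by
    have h1 : Tendsto (fun n => c n • x) atTop (𝓝 ((0 : ℝ) • x)) := hclim.smul_const x
    rw [zero_smul] at h1
    have h2 := (χ.continuous.tendsto 0).comp h1
    rwa [χ.one_of_mem_closedBall (by simp [χ.rIn_pos.le])] at h2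
  have hχsub : ∀ x, |χ x - 1| ≤ 1 := fun x => by
    rw [abs_le]; constructor <;> linarith [χ.nonneg (x := x), χ.le_one (x := x)]
  have happ : ∀ n, C1Approx (law ρ) (fun x => χ (c n • x) * f x)
      (fun i x => χ (c n • x) * v i x + partialDeriv (fun y => χ (c n • y)) i x * f x) := fun n => by
    have := (hf.hasGlobalGrad_cutoff isOpen_univ (fun x _ => hM x) (hχn n) (hχns n)
      (subset_univ _) (hvK _ (hχns n))).c1Approx.mono_measure ENNReal.one_ne_top hlaw
    simpa using! this
  refine C1Approx.of_tendsto (l := atTop) hfm.aestronglyMeasurable (fun i => (hv i).1)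
    (Eventually.of_forall fun n =>
      ((hχn n).continuous.measurable.mul hfm).aestronglyMeasurable)
    (fun i => Eventually.of_forall fun n => ?_) (Eventually.of_forall happ) ?_ fun i => ?_
  · exact ((hχn n).continuous.aestronglyMeasurable.mul (hv i).1).add
      ((continuous_partialDeriv (hχn n) i).measurable.mul hfm).aestronglyMeasurable
  · refine tendsto_eLpNorm_two_of_dominated (F := fun n x => χ (c n • x) * f x) (G := fun _ => M)
      (fun n => ((hχn n).continuous.measurable.mul hfm).aestronglyMeasurable)
      hfm.aestronglyMeasurable (memLp_const M) (fun n => Eventually.of_forall fun x => ?_)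
      (Eventually.of_forall fun x => ?_)
    · have e : χ (c n • x) * f x - f x = (χ (c n • x) - 1) * f x := by ring
      rw [e, abs_mul]
      exact (mul_le_of_le_one_left (abs_nonneg _) (hχsub _)).trans (hM x)
    · simpa using (hχlim x).mul_const (f x)
  · obtain ⟨C, hC⟩ := (continuous_partialDeriv hχ i).bounded_above_of_compact_support
      (hasCompactSupport_partialDeriv hχ χ.hasCompactSupport i)
    have hC0 : 0 ≤ C := (norm_nonneg _).trans (hC 0)
    refine tendsto_eLpNorm_two_of_dominated (G := fun x => |v i x| + C * M)
      (F := fun n x => χ (c n • x) * v i x + partialDeriv (fun y => χ (c n • y)) i x * f x)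
      (fun n => ((hχn n).continuous.aestronglyMeasurable.mul (hv i).1).add
        ((continuous_partialDeriv (hχn n) i).measurable.mul hfm).aestronglyMeasurable)
      (hv i).1 ((hv i).abs.add (memLp_const _)) (fun n => Eventually.of_forall fun x => ?_)
      (Eventually.of_forall fun x => ?_)
    · rw [partialDeriv_comp_smul hχ]
      have e : χ (c n • x) * v i x + c n * partialDeriv χ i (c n • x) * f x - v i x =
        (χ (c n • x) - 1) * v i x + c n * (partialDeriv χ i (c n • x) * f x) := by ring
      rw [e]
      refine (abs_add_le _ _).trans (add_le_add ?_ ?_)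
      · rw [abs_mul]
        exact mul_le_of_le_one_left (abs_nonneg _) (hχsub _)
      · rw [abs_mul, abs_of_pos (hc0 n), abs_mul]
        refine (mul_le_of_le_one_left (by positivity) (hc1 n)).trans ?_
        exact mul_le_mul (hC _) (hM x) (abs_nonneg _) hC0
    · have h1 : Tendsto (fun n => χ (c n • x) * v i x) atTop (𝓝 (1 * v i x)) :=
        (hχlim x).mul_const _
      have h2 : Tendsto (fun n => partialDeriv (fun y => χ (c n • y)) i x * f x) atTop
          (𝓝 (0 * f x)) := by
        refine Tendsto.mul_const _ ?_
        refine squeeze_zero_norm (a := fun n => c n * C) (fun n => ?_)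
          (by simpa using hclim.mul_const C)
        rw [partialDeriv_comp_smul hχ, norm_mul, Real.norm_of_nonneg (hc0 n).le]
        exact mul_le_mul_of_nonneg_left (hC _) (hc0 n).le
      simpa using h1.add h2

/-- The admissible densities: uniform on a bounded convex open set or standard normal. -/
def IsModelDensity (ρ : E d → ℝ) : Prop := IsUniformOnBoundedConvex ρ ∨ IsStdGaussianDensity ρ

lemma IsModelDensity.measurable {ρ : E d → ℝ} (h : IsModelDensity ρ) : Measurable ρ := by
  obtain ⟨U, hU, -, -, -, rfl⟩ | h := h
  · exact measurable_const.indicator hU.measurableSet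
  · exact h.continuous.measurable

lemma IsModelDensity.nonneg {ρ : E d → ℝ} (h : IsModelDensity ρ) (x : E d) : 0 ≤ ρ x := by
  obtain ⟨U, hU, -, -, -, rfl⟩ | h := h
  · exact indicator_nonneg (fun _ _ => by positivity) x
  · exact (h.pos x).le

lemma IsModelDensity.isOpen_posSet {ρ : E d → ℝ} (h : IsModelDensity ρ) : IsOpen (posSet ρ) := by
  obtain ⟨U, hU, hne, hb, hc, rfl⟩ | h := h
  · rwa [posSet_uniform hU hne hb]
  · rw [h.posSet_eq]; exact isOpen_univ

lemma IsModelDensity.isProbabilityMeasure {ρ : E d → ℝ} (h : IsModelDensity ρ) :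
    IsProbabilityMeasure (law ρ) := by
  obtain ⟨U, hU, hne, hb, hc, rfl⟩ | h := h
  · exact isProbabilityMeasure_law_uniform hU hne hb
  · rw [h.law_eq]; infer_instance

lemma IsModelDensity.c1Approx_of_bounded {ρ : E d → ℝ} (hρ : IsModelDensity ρ) {f : E d → ℝ}
    {v : Fin d → E d → ℝ} (hf : HasGradOn (posSet ρ) f v) {M : ℝ}
    (hM : ∀ x ∈ posSet ρ, |f x| ≤ M) (hv : ∀ i, MemLp (v i) 2 (law ρ)) :
    C1Approx (law ρ) f v := by
  obtain ⟨U, hU, hne, hb, hc, rfl⟩ | h := hρ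
  · rw [posSet_uniform hU hne hb] at hf hM
    have h0 : (volume U)⁻¹ ≠ ∞ := by simpa using (hU.measure_pos volume hne).ne'
    rw [law_uniform hU hne hb] at hv ⊢
    refine (c1Approx_convex_of_bounded hU hne hb hc hf hM fun i => ?_).mono_measure h0 le_rfl
    refine (hv i).of_measure_le_smul (c := volume U) hb.measure_lt_top.ne ?_
    rw [smul_smul, ENNReal.mul_inv_cancel (hU.measure_pos volume hne).ne' hb.measure_lt_top.ne,
      one_smul]
  · rw [h.posSet_eq] at hf hM
    have := (show IsModelDensity ρ from Or.inr h).isProbabilityMeasure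
    exact c1Approx_of_continuous_density h.continuous h.pos h.le_one inferInstance hf
      (fun x => hM x (mem_univ x)) hv

end

/-! ### Poincaré inequalities -/

section

variable {d : ℕ}

lemma lintegral_sq_le {α : Type*} [MeasurableSpace α] {μ : Measure α} {φ : α → ℝ≥0∞}
    (hφ : AEMeasurable φ μ) : (∫⁻ x, φ x ∂μ) ^ 2 ≤ μ univ * ∫⁻ x, φ x ^ 2 ∂μ := by
  have h := ENNReal.lintegral_mul_le_Lp_mul_Lq μ Real.HolderConjugate.two_two
    (aemeasurable_const (b := (1 : ℝ≥0∞))) hφ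
  simp only [Pi.mul_apply, one_mul, lintegral_const, ENNReal.rpow_two, one_pow] at h
  calc (∫⁻ x, φ x ∂μ) ^ 2 ≤ (μ univ ^ (1 / 2 : ℝ) * (∫⁻ x, φ x ^ 2 ∂μ) ^ (1 / 2 : ℝ)) ^ 2 := by
        gcongr
    _ = μ univ * ∫⁻ x, φ x ^ 2 ∂μ := by
        rw [mul_pow, ← ENNReal.rpow_two, ← ENNReal.rpow_two, ← ENNReal.rpow_mul,
          ← ENNReal.rpow_mul]
        norm_num

lemma continuous_gradient {h : E d → ℝ} (hh : ContDiff ℝ 1 h) : Continuous (gradient h) := by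
  unfold gradient
  exact (LinearIsometryEquiv.continuous _).comp (hh.continuous_fderiv one_ne_zero)

/-- The fundamental theorem of calculus along a path, squared by the Cauchy–Schwarz inequality. -/
lemma enorm_sub_sq_le_of_path {h : E d → ℝ} (hh : ContDiff ℝ 1 h) {p p' : ℝ → E d}
    (hp : ∀ t, HasDerivAt p (p' t) t) (hp' : Continuous p') {a b : ℝ} (hab : a ≤ b) :
    ‖h (p b) - h (p a)‖ₑ ^ 2 ≤ ENNReal.ofReal (b - a) *
      ∫⁻ t in Ioc a b, ‖gradient h (p t)‖ₑ ^ 2 * ‖p' t‖ₑ ^ 2 := by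
  have hpc : Continuous p := continuous_iff_continuousAt.2 fun t => (hp t).continuousAt
  have hgc : Continuous fun t => inner ℝ (gradient h (p t)) (p' t) :=
    ((continuous_gradient hh).comp hpc).inner hp'
  have hd : ∀ t, HasDerivAt (fun t => h (p t)) (inner ℝ (gradient h (p t)) (p' t)) t := fun t => by
    have h1 := (hh.differentiable one_ne_zero (p t)).hasGradientAt.hasFDerivAt
    simpa using! h1.comp_hasDerivAt t (hp t)
  have hftc := intervalIntegral.integral_eq_sub_of_hasDerivAt (a := a) (b := b)
    (fun t _ => hd t) (hgc.intervalIntegrable a b)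
  rw [← hftc, intervalIntegral.integral_of_le hab]
  calc ‖∫ t in Ioc a b, inner ℝ (gradient h (p t)) (p' t)‖ₑ ^ 2
      ≤ (∫⁻ t in Ioc a b, ‖inner ℝ (gradient h (p t)) (p' t)‖ₑ) ^ 2 := by
        gcongr
        exact enorm_integral_le_lintegral_enorm _
    _ ≤ (volume.restrict (Ioc a b)) univ *
          ∫⁻ t in Ioc a b, ‖inner ℝ (gradient h (p t)) (p' t)‖ₑ ^ 2 :=
        lintegral_sq_le hgc.measurable.enorm.aemeasurable
    _ ≤ _ := by
        rw [Measure.restrict_apply_univ, Real.volume_Ioc]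
        gcongr with t
        rw [← mul_pow]
        gcongr
        simp only [enorm_eq_nnnorm]
        exact_mod_cast nnnorm_inner_le_nnnorm (𝕜 := ℝ) (gradient h (p t)) (p' t)

/-- The contraction towards a point `c` of a convex set maps the set into itself, with Jacobian
`s ^ d ≥ 2⁻ᵈ`. -/
lemma setLIntegral_comp_convex_le {U : Set (E d)} (hU : MeasurableSet U) (hc : Convex ℝ U)
    (G : E d → ℝ≥0∞) {s : ℝ} (hs : 1 / 2 ≤ s) (hs1 : s ≤ 1) {c : E d} (hcU : c ∈ U) :
    ∫⁻ y in U, G (s • y + (1 - s) • c) ≤ 2 ^ d * ∫⁻ y in U, G y := by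
  have hs0 : s ≠ 0 := by linarith
  calc ∫⁻ y in U, G (s • y + (1 - s) • c)
      = ∫⁻ y, U.indicator (fun y => G (s • y + (1 - s) • c)) y := (lintegral_indicator hU _).symm
    _ ≤ ∫⁻ y, U.indicator G (s • y + (1 - s) • c) := by
        refine lintegral_mono fun y => ?_
        by_cases hy : y ∈ U
        · have : s • y + (1 - s) • c ∈ U := hc hy hcU (by linarith) (by linarith) (by ring)
          simp [hy, this]
        · simp [hy]
    _ = ENNReal.ofReal |(s ^ d)⁻¹| * ∫⁻ y in U, G y := by
        rw [lintegral_comp_affine _ hs0, lintegral_indicator hU]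
    _ ≤ 2 ^ d * ∫⁻ y in U, G y := by
        gcongr
        calc ENNReal.ofReal |(s ^ d)⁻¹| ≤ ENNReal.ofReal (2 ^ d) := by
              refine ENNReal.ofReal_le_ofReal ?_
              rw [abs_of_nonneg (by positivity), ← inv_pow]
              gcongr
              rw [inv_le_comm₀ (by linarith) (by norm_num)]
              linarith
          _ = 2 ^ d := by rw [ENNReal.ofReal_pow (by norm_num)]; simp

/-- A Poincaré inequality on a bounded convex set. The segments between two points of the set stay
inside it; on each of them one of the two endpoints has weight at least `1 / 2`, and integration
over that endpoint costs a Jacobian of at most `2 ^ d`. -/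
lemma setLIntegral_sub_sq_le {U : Set (E d)} (hU : IsOpen U) (hc : Convex ℝ U)
    {D : ℝ≥0∞} (hD : ∀ x ∈ U, ∀ y ∈ U, ‖y - x‖ₑ ≤ D) {h : E d → ℝ} (hh : ContDiff ℝ 1 h) :
    ∫⁻ x in U, ∫⁻ y in U, ‖h y - h x‖ₑ ^ 2 ≤
      D ^ 2 * 2 ^ d * volume U * ∫⁻ z in U, ‖gradient h z‖ₑ ^ 2 := by
  set G : E d → ℝ≥0∞ := fun z => ‖gradient h z‖ₑ ^ 2 with hG
  have hGm : Measurable G := ((continuous_gradient hh).measurable.enorm).pow_const 2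
  have hm3 : Measurable fun q : (E d × E d) × ℝ => G ((1 - q.2) • q.1.1 + q.2 • q.1.2) :=
    hGm.comp (by fun_prop)
  have h1 : ∀ x ∈ U, ∀ y ∈ U, ‖h y - h x‖ₑ ^ 2 ≤
      D ^ 2 * ∫⁻ t in Ioc (0 : ℝ) 1, G ((1 - t) • x + t • y) := fun x hx y hy => by
    have := enorm_sub_sq_le_of_path hh (p := fun t => (1 - t) • x + t • y) (p' := fun _ => y - x)
      (fun t => by
        have h1 := (((hasDerivAt_id t).const_sub 1).smul_const x).add
          ((hasDerivAt_id t).smul_const y)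
        convert! h1 using 1
        module) continuous_const zero_le_one
    simp only [one_smul, zero_smul, sub_self, sub_zero, zero_add, add_zero, ENNReal.ofReal_one,
      one_mul] at this
    refine this.trans ?_
    rw [← lintegral_const_mul _ (by fun_prop)]
    refine lintegral_mono fun t => ?_
    simp only
    rw [mul_comm]
    gcongr
    exact hD x hx y hy
  have h2 : ∀ t ∈ Ioc (0 : ℝ) 1, ∫⁻ x in U, ∫⁻ y in U, G ((1 - t) • x + t • y) ≤
      2 ^ d * volume U * ∫⁻ z in U, G z := fun t ht => by
    have hconst : ∫⁻ _ in U, 2 ^ d * ∫⁻ z in U, G z = 2 ^ d * volume U * ∫⁻ z in U, G z := by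
      rw [setLIntegral_const]; ring
    rw [← hconst]
    rcases le_total (1 / 2) t with h | h
    · refine setLIntegral_mono (by fun_prop) fun x hx => ?_
      have := setLIntegral_comp_convex_le hU.measurableSet hc G h ht.2 hx
      simpa only [add_comm] using this
    · rw [lintegral_lintegral_swap (by unfold Function.uncurry; fun_prop)]
      refine setLIntegral_mono (by fun_prop) fun y hy => ?_
      have := setLIntegral_comp_convex_le hU.measurableSet hc G (s := 1 - t) (by linarith)
        (by linarith [ht.1]) hy
      simpa using this
  calc ∫⁻ x in U, ∫⁻ y in U, ‖h y - h x‖ₑ ^ 2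
      ≤ ∫⁻ x in U, ∫⁻ y in U, D ^ 2 * ∫⁻ t in Ioc (0 : ℝ) 1, G ((1 - t) • x + t • y) := by
        refine setLIntegral_mono' hU.measurableSet fun x hx =>
          setLIntegral_mono' hU.measurableSet fun y hy => h1 x hx y hy
    _ = D ^ 2 * ∫⁻ x in U, ∫⁻ y in U, ∫⁻ t in Ioc (0 : ℝ) 1, G ((1 - t) • x + t • y) := by
        rw [← lintegral_const_mul]
        · refine lintegral_congr fun x => ?_
          rw [lintegral_const_mul]
          exact Measurable.lintegral_prod_right'
            (hm3.comp (f := fun q : E d × ℝ => ((x, q.1), q.2)) (by fun_prop))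
        · exact Measurable.lintegral_prod_right' (f := fun q : E d × E d =>
            ∫⁻ t in Ioc (0 : ℝ) 1, G ((1 - t) • q.1 + t • q.2)) hm3.lintegral_prod_right'
    _ = D ^ 2 * ∫⁻ t in Ioc (0 : ℝ) 1, ∫⁻ x in U, ∫⁻ y in U, G ((1 - t) • x + t • y) := by
        congr 1
        have e1 : ∀ x, ∫⁻ y in U, ∫⁻ t in Ioc (0 : ℝ) 1, G ((1 - t) • x + t • y) =
            ∫⁻ t in Ioc (0 : ℝ) 1, ∫⁻ y in U, G ((1 - t) • x + t • y) := fun x =>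
          lintegral_lintegral_swap
            (hm3.comp (f := fun q : E d × ℝ => ((x, q.1), q.2)) (by fun_prop)).aemeasurable
        simp only [e1]
        refine lintegral_lintegral_swap (Measurable.aemeasurable ?_)
        exact Measurable.lintegral_prod_right' (f := fun q : (E d × ℝ) × E d =>
            G ((1 - q.1.2) • q.1.1 + q.1.2 • q.2))
          (hm3.comp (f := fun q : (E d × ℝ) × E d => ((q.1.1, q.2), q.1.2)) (by fun_prop))
    _ ≤ D ^ 2 * ∫⁻ _ in Ioc (0 : ℝ) 1, 2 ^ d * volume U * ∫⁻ z in U, G z := by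
        gcongr 1
        exact setLIntegral_mono' measurableSet_Ioc h2
    _ = D ^ 2 * 2 ^ d * volume U * ∫⁻ z in U, G z := by
        rw [setLIntegral_const, Real.volume_Ioc]
        simp only [sub_zero, ENNReal.ofReal_one, mul_one]
        ring

lemma lintegral_sub_sq_le_uniform {U : Set (E d)} (hU : IsOpen U) (hne : U.Nonempty)
    (hb : Bornology.IsBounded U) (hc : Convex ℝ U) {D : ℝ≥0∞}
    (hD : ∀ x ∈ U, ∀ y ∈ U, ‖y - x‖ₑ ≤ D) {h : E d → ℝ} (hh : ContDiff ℝ 1 h) :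
    ∫⁻ x, ∫⁻ y, ‖h y - h x‖ₑ ^ 2 ∂(law (U.indicator fun _ => (volume.real U)⁻¹))
        ∂(law (U.indicator fun _ => (volume.real U)⁻¹)) ≤
      D ^ 2 * 2 ^ d *
        ∫⁻ z, ‖gradient h z‖ₑ ^ 2 ∂(law (U.indicator fun _ => (volume.real U)⁻¹)) := by
  rw [law_uniform hU hne hb]
  simp only [lintegral_smul_measure, smul_eq_mul]
  have h0 := (hU.measure_pos volume hne).ne'
  have ht := hb.measure_lt_top (μ := volume).ne
  have hm : Measurable fun x => ∫⁻ y in U, ‖h y - h x‖ₑ ^ 2 := by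
    have := hh.continuous.measurable
    exact Measurable.lintegral_prod_right' (f := fun q : E d × E d => ‖h q.2 - h q.1‖ₑ ^ 2)
      (by fun_prop)
  rw [lintegral_const_mul _ hm]
  calc _ ≤ (volume U)⁻¹ * ((volume U)⁻¹ *
        (D ^ 2 * 2 ^ d * volume U * ∫⁻ z in U, ‖gradient h z‖ₑ ^ 2)) := by
        gcongr
        exact setLIntegral_sub_sq_le hU hc hD hh
    _ = (volume U)⁻¹ * volume U *
          (D ^ 2 * 2 ^ d * ((volume U)⁻¹ * ∫⁻ z in U, ‖gradient h z‖ₑ ^ 2)) := by ring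
    _ = _ := by rw [ENNReal.inv_mul_cancel h0 ht, one_mul]

/-- A Poincaré inequality for the standard normal law: two independent copies are joined by the
quarter circle `cos θ • x + sin θ • y`, along which position and velocity stay independent and
standard normal. -/
lemma lintegral_sub_sq_le_stdGaussian {h : E d → ℝ} (hh : ContDiff ℝ 1 h) :
    ∫⁻ x, ∫⁻ y, ‖h y - h x‖ₑ ^ 2 ∂(stdGaussian (E d)) ∂(stdGaussian (E d)) ≤
      ENNReal.ofReal (Real.pi / 2) ^ 2 * (∫⁻ z, ‖z‖ₑ ^ 2 ∂(stdGaussian (E d))) *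
        ∫⁻ z, ‖gradient h z‖ₑ ^ 2 ∂(stdGaussian (E d)) := by
  set γ := stdGaussian (E d)
  set G : E d → ℝ≥0∞ := fun z => ‖gradient h z‖ₑ ^ 2 with hG
  have hhm := hh.continuous.measurable
  have hGm : Measurable G := ((continuous_gradient hh).measurable.enorm).pow_const 2
  have hΨ : Measurable fun q : E d × E d => G q.1 * ‖q.2‖ₑ ^ 2 := by fun_prop
  have hpt : ∀ q : E d × E d, ‖h q.2 - h q.1‖ₑ ^ 2 ≤ ENNReal.ofReal (Real.pi / 2) *
      ∫⁻ θ in Ioc 0 (Real.pi / 2), G (ContinuousLinearMap.rotation θ q).1 *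
        ‖(ContinuousLinearMap.rotation θ q).2‖ₑ ^ 2 := fun q => by
    have := enorm_sub_sq_le_of_path hh (p := fun θ => (ContinuousLinearMap.rotation θ q).1)
      (p' := fun θ => (ContinuousLinearMap.rotation θ q).2)
      (fun θ => by
        simpa [ContinuousLinearMap.rotation_apply] using!
          ((Real.hasDerivAt_cos θ).smul_const q.1).add ((Real.hasDerivAt_sin θ).smul_const q.2))
      (by simp only [ContinuousLinearMap.rotation_apply]; fun_prop) Real.pi_div_two_pos.le
    simpa [ContinuousLinearMap.rotation_apply] using this
  have hrot : ∀ θ : ℝ, ∫⁻ q, G (ContinuousLinearMap.rotation θ q).1 *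
      ‖(ContinuousLinearMap.rotation θ q).2‖ₑ ^ 2 ∂(γ.prod γ) =
      (∫⁻ z, G z ∂γ) * ∫⁻ z, ‖z‖ₑ ^ 2 ∂γ := fun θ => by
    rw [← lintegral_map (f := fun q : E d × E d => G q.1 * ‖q.2‖ₑ ^ 2) hΨ (by fun_prop),
      IsGaussian.map_rotation_eq_self (by simp [γ]) θ,
      lintegral_prod_mul (g := fun z : E d => ‖z‖ₑ ^ 2) hGm.aemeasurable (by fun_prop)]
  have hm3 : Measurable fun p : (E d × E d) × ℝ => G (ContinuousLinearMap.rotation p.2 p.1).1 *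
      ‖(ContinuousLinearMap.rotation p.2 p.1).2‖ₑ ^ 2 := by
    simp only [ContinuousLinearMap.rotation_apply]
    fun_prop
  calc ∫⁻ x, ∫⁻ y, ‖h y - h x‖ₑ ^ 2 ∂γ ∂γ = ∫⁻ q, ‖h q.2 - h q.1‖ₑ ^ 2 ∂(γ.prod γ) :=
        (lintegral_prod (fun q : E d × E d => ‖h q.2 - h q.1‖ₑ ^ 2) (by fun_prop)).symm
    _ ≤ ∫⁻ q, (ENNReal.ofReal (Real.pi / 2) *
          ∫⁻ θ in Ioc 0 (Real.pi / 2), G (ContinuousLinearMap.rotation θ q).1 *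
            ‖(ContinuousLinearMap.rotation θ q).2‖ₑ ^ 2) ∂(γ.prod γ) := lintegral_mono hpt
    _ = ENNReal.ofReal (Real.pi / 2) * ∫⁻ θ in Ioc 0 (Real.pi / 2),
          (∫⁻ q, G (ContinuousLinearMap.rotation θ q).1 *
            ‖(ContinuousLinearMap.rotation θ q).2‖ₑ ^ 2 ∂(γ.prod γ)) := by
        rw [lintegral_const_mul _ hm3.lintegral_prod_right', lintegral_lintegral_swap
          hm3.aemeasurable]
    _ = _ := by
        simp only [hrot]
        rw [setLIntegral_const, Real.volume_Ioc, sub_zero]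
        ring

lemma lintegral_enorm_sq_stdGaussian_ne_top :
    ∫⁻ z, ‖z‖ₑ ^ 2 ∂(stdGaussian (E d)) ≠ ∞ := by
  have h : MemLp (id : E d → E d) 2 (stdGaussian (E d)) := IsGaussian.memLp_two_id
  rw [← eLpNorm_two_sq (fun z : E d => z)]
  exact ENNReal.pow_ne_top h.2.ne

lemma IsModelDensity.exists_lintegral_sub_sq_le {ρ : E d → ℝ} (hρ : IsModelDensity ρ) :
    ∃ K : ℝ≥0∞, K ≠ ∞ ∧ ∀ h : E d → ℝ, ContDiff ℝ 1 h →
      ∫⁻ x, ∫⁻ y, ‖h y - h x‖ₑ ^ 2 ∂(law ρ) ∂(law ρ) ≤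
        K * ∫⁻ z, ‖gradient h z‖ₑ ^ 2 ∂(law ρ) := by
  obtain ⟨U, hU, hne, hb, hc, rfl⟩ | h := hρ
  · refine ⟨ENNReal.ofReal (Metric.diam U) ^ 2 * 2 ^ d, by finiteness, fun h hh => ?_⟩
    refine lintegral_sub_sq_le_uniform hU hne hb hc (fun x hx y hy => ?_) hh
    rw [← ofReal_norm, ← dist_eq_norm]
    exact ENNReal.ofReal_le_ofReal (Metric.dist_le_diam_of_mem hb hy hx)
  · rw [h.law_eq]
    exact ⟨_, ENNReal.mul_ne_top (by finiteness) lintegral_enorm_sq_stdGaussian_ne_top,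
      fun h hh => lintegral_sub_sq_le_stdGaussian hh⟩

lemma evariance_le_lintegral_sub_sq {α : Type*} [MeasurableSpace α] {μ : Measure α}
    [IsProbabilityMeasure μ] {h : α → ℝ} (hh : Integrable h μ) :
    evariance h μ ≤ ∫⁻ x, ∫⁻ y, ‖h y - h x‖ₑ ^ 2 ∂μ ∂μ := by
  rw [evariance]
  refine lintegral_mono fun x => ?_
  have e : h x - ∫ y, h y ∂μ = -∫ y, (h y - h x) ∂μ := by
    rw [integral_sub hh (integrable_const _)]
    simp
  rw [e, enorm_neg]
  exact enorm_integral_sq_le _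

end

/-! ### Square integrability and approximation of unbounded functions -/

section

variable {d : ℕ}

lemma C1Approx.exists_seq {μ : Measure (E d)} {u : E d → ℝ} {v : Fin d → E d → ℝ}
    (h : C1Approx μ u v) : ∃ F : ℕ → E d → ℝ, (∀ n, ContDiff ℝ 1 (F n)) ∧
      (∀ n, HasCompactSupport (F n)) ∧
      Tendsto (fun n => ∫⁻ x, ‖F n x - u x‖ₑ ^ 2 ∂μ) atTop (𝓝 0) ∧
      ∀ i, Tendsto (fun n => ∫⁻ x, ‖partialDeriv (F n) i x - v i x‖ₑ ^ 2 ∂μ) atTop (𝓝 0) := by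
  choose F hF hFs h1 h2 using fun n : ℕ => h ((n : ℝ≥0∞)⁻¹) (by simp)
  have hlim : Tendsto (fun n : ℕ => ((n : ℝ≥0∞)⁻¹) ^ 2) atTop (𝓝 0) := by
    have := (ENNReal.continuous_pow 2).tendsto 0 |>.comp ENNReal.tendsto_inv_nat_nhds_zero
    simpa [Function.comp_def] using! this
  refine ⟨F, hF, hFs, ?_, fun i => ?_⟩
  · refine tendsto_of_tendsto_of_tendsto_of_le_of_le tendsto_const_nhds hlim (fun _ => zero_le)
      fun n => ?_
    simp only
    rw [← eLpNorm_two_sq]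
    exact pow_le_pow_left' (h1 n) 2
  · refine tendsto_of_tendsto_of_tendsto_of_le_of_le tendsto_const_nhds hlim (fun _ => zero_le)
      fun n => ?_
    simp only
    rw [← eLpNorm_two_sq]
    exact pow_le_pow_left' (h2 n i) 2

lemma enorm_add_add_sq_le (a b c : ℝ) :
    ‖a + b + c‖ₑ ^ 2 ≤ 3 * (‖a‖ₑ ^ 2 + ‖b‖ₑ ^ 2 + ‖c‖ₑ ^ 2) := by
  simp only [Real.enorm_eq_ofReal_abs, ← ENNReal.ofReal_pow (abs_nonneg _), sq_abs]
  rw [← ENNReal.ofReal_add (sq_nonneg _) (sq_nonneg _),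
    ← ENNReal.ofReal_add (by positivity) (sq_nonneg _),
    show (3 : ℝ≥0∞) = ENNReal.ofReal 3 by simp, ← ENNReal.ofReal_mul (by norm_num)]
  exact ENNReal.ofReal_le_ofReal
    (by nlinarith [sq_nonneg (a - b), sq_nonneg (b - c), sq_nonneg (a - c)])

lemma enorm_gradient_sq {F : E d → ℝ} (hF : ContDiff ℝ 1 F) (x : E d) :
    ‖gradient F x‖ₑ ^ 2 = ∑ i, ‖partialDeriv F i x‖ₑ ^ 2 := by
  rw [← ofReal_norm, ← ENNReal.ofReal_pow (norm_nonneg _),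
    norm_gradient_sq (hF.differentiable one_ne_zero x),
    ENNReal.ofReal_sum_of_nonneg fun i _ => sq_nonneg _]
  refine Finset.sum_congr rfl fun i _ => ?_
  rw [Real.enorm_eq_ofReal_abs, ← ENNReal.ofReal_pow (abs_nonneg _), sq_abs]

/-- A Poincaré inequality for `C¹` functions passes to approximable pairs, up to a factor. -/
lemma C1Approx.lintegral_sub_sq_le {μ : Measure (E d)} [IsProbabilityMeasure μ] {K : ℝ≥0∞}
    (hK : K ≠ ∞) (hP : ∀ h : E d → ℝ, ContDiff ℝ 1 h →
      ∫⁻ x, ∫⁻ y, ‖h y - h x‖ₑ ^ 2 ∂μ ∂μ ≤ K * ∫⁻ z, ‖gradient h z‖ₑ ^ 2 ∂μ)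
    {u : E d → ℝ} {v : Fin d → E d → ℝ} (hu : Measurable u)
    (hv : ∀ i, AEStronglyMeasurable (v i) μ) (h : C1Approx μ u v) :
    ∫⁻ x, ∫⁻ y, ‖u y - u x‖ₑ ^ 2 ∂μ ∂μ ≤ 6 * (K * ∑ i, ∫⁻ x, ‖v i x‖ₑ ^ 2 ∂μ) := by
  obtain ⟨F, hF, -, h1, h2⟩ := h.exists_seq
  have hbound : ∀ n, ∫⁻ x, ∫⁻ y, ‖u y - u x‖ₑ ^ 2 ∂μ ∂μ ≤
      3 * (2 * ∫⁻ x, ‖F n x - u x‖ₑ ^ 2 ∂μ + K * ∑ i,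
        (2 * (∫⁻ x, ‖partialDeriv (F n) i x - v i x‖ₑ ^ 2 ∂μ + ∫⁻ x, ‖v i x‖ₑ ^ 2 ∂μ))) := by
    intro n
    have hFm := (hF n).continuous.measurable
    have hd : Measurable fun x => ‖F n x - u x‖ₑ ^ 2 := by fun_prop
    have hFF : Measurable fun x => ∫⁻ y, ‖F n y - F n x‖ₑ ^ 2 ∂μ :=
      Measurable.lintegral_prod_right' (f := fun q : E d × E d => ‖F n q.2 - F n q.1‖ₑ ^ 2)
        (by fun_prop)
    have hpt : ∀ x y, ‖u y - u x‖ₑ ^ 2 ≤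
        3 * (‖F n y - u y‖ₑ ^ 2 + ‖F n y - F n x‖ₑ ^ 2 + ‖F n x - u x‖ₑ ^ 2) := fun x y => by
      have := enorm_add_add_sq_le (-(F n y - u y)) (F n y - F n x) (F n x - u x)
      rw [enorm_neg] at this
      refine le_of_eq_of_le ?_ this
      congr 2
      ring
    have hgrad : ∫⁻ z, ‖gradient (F n) z‖ₑ ^ 2 ∂μ ≤ ∑ i,
        (2 * (∫⁻ x, ‖partialDeriv (F n) i x - v i x‖ₑ ^ 2 ∂μ + ∫⁻ x, ‖v i x‖ₑ ^ 2 ∂μ)) := by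
      simp only [enorm_gradient_sq (hF n)]
      rw [lintegral_finsetSum' _ fun i _ =>
        ((continuous_partialDeriv (hF n) i).measurable.enorm.pow_const 2).aemeasurable]
      refine Finset.sum_le_sum fun i _ => ?_
      rw [← lintegral_add_right' _ ((hv i).enorm.pow_const 2), ← lintegral_const_mul' _ _ (by simp)]
      refine lintegral_mono fun x => ?_
      have := enorm_sub_sq_le_two_mul (partialDeriv (F n) i x - v i x) (-v i x)
      rw [enorm_neg] at this
      simpa using this
    calc ∫⁻ x, ∫⁻ y, ‖u y - u x‖ₑ ^ 2 ∂μ ∂μ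
        ≤ ∫⁻ x, ∫⁻ y, 3 * (‖F n y - u y‖ₑ ^ 2 + ‖F n y - F n x‖ₑ ^ 2 + ‖F n x - u x‖ₑ ^ 2)
            ∂μ ∂μ := lintegral_mono fun x => lintegral_mono fun y => hpt x y
      _ = ∫⁻ x, 3 * (∫⁻ y, ‖F n y - u y‖ₑ ^ 2 ∂μ + ∫⁻ y, ‖F n y - F n x‖ₑ ^ 2 ∂μ +
            ‖F n x - u x‖ₑ ^ 2) ∂μ := by
          refine lintegral_congr fun x => ?_
          rw [lintegral_const_mul _ (by fun_prop), lintegral_add_right _ (by fun_prop),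
            lintegral_add_right _ (by fun_prop)]
          simp
      _ = 3 * (∫⁻ y, ‖F n y - u y‖ₑ ^ 2 ∂μ + ∫⁻ x, ∫⁻ y, ‖F n y - F n x‖ₑ ^ 2 ∂μ ∂μ +
            ∫⁻ x, ‖F n x - u x‖ₑ ^ 2 ∂μ) := by
          rw [lintegral_const_mul _ (by fun_prop), lintegral_add_right _ (by fun_prop),
            lintegral_add_right _ hFF]
          simp
      _ = 3 * (2 * ∫⁻ y, ‖F n y - u y‖ₑ ^ 2 ∂μ +
            ∫⁻ x, ∫⁻ y, ‖F n y - F n x‖ₑ ^ 2 ∂μ ∂μ) := by ring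
      _ ≤ _ := by
          gcongr
          exact (hP _ (hF n)).trans (by gcongr)
  have hlim : Tendsto (fun n => 3 * (2 * ∫⁻ x, ‖F n x - u x‖ₑ ^ 2 ∂μ + K * ∑ i,
        (2 * (∫⁻ x, ‖partialDeriv (F n) i x - v i x‖ₑ ^ 2 ∂μ + ∫⁻ x, ‖v i x‖ₑ ^ 2 ∂μ)))) atTop
      (𝓝 (3 * (2 * 0 + K * ∑ i, (2 * (0 + ∫⁻ x, ‖v i x‖ₑ ^ 2 ∂μ))))) := by
    refine ENNReal.Tendsto.const_mul (Tendsto.add (ENNReal.Tendsto.const_mul h1 (by simp))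
      (ENNReal.Tendsto.const_mul (tendsto_finsetSum _ fun i _ => ENNReal.Tendsto.const_mul
        ((h2 i).add_const _) (by simp)) (by simp [hK]))) (by simp)
  refine (ge_of_tendsto' hlim hbound).trans (le_of_eq ?_)
  simp only [mul_zero, zero_add, ← Finset.mul_sum]
  ring

/-- A smooth bounded truncation of the identity at level `M`. -/
def trunc (M t : ℝ) : ℝ := M * Real.arctan (t / M)

lemma hasDerivAt_trunc {M : ℝ} (hM : M ≠ 0) (t : ℝ) :
    HasDerivAt (trunc M) (1 + (t / M) ^ 2)⁻¹ t := by
  have h := ((Real.hasDerivAt_arctan (t / M)).comp t ((hasDerivAt_id t).div_const M)).const_mul M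
  convert! h using 1
  field_simp

lemma continuous_trunc (M : ℝ) : Continuous (trunc M) := by
  unfold trunc
  fun_prop

@[fun_prop]
lemma measurable_trunc (M : ℝ) : Measurable (trunc M) := (continuous_trunc M).measurable

lemma abs_arctan_le (t : ℝ) : |Real.arctan t| ≤ |t| := by
  have h : LipschitzWith 1 Real.arctan := by
    refine lipschitzWith_of_nnnorm_deriv_le Real.differentiable_arctan fun x => ?_
    rw [← NNReal.coe_le_coe, coe_nnnorm, Real.deriv_arctan, Real.norm_of_nonneg (by positivity)]
    exact div_le_one_of_le₀ (by nlinarith [sq_nonneg x]) (by positivity)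
  simpa [Real.dist_eq] using h.dist_le_mul t 0

lemma abs_trunc_le {M : ℝ} (hM : 0 < M) (t : ℝ) : |trunc M t| ≤ |t| := by
  rw [trunc, abs_mul]
  refine (mul_le_mul_of_nonneg_left (abs_arctan_le _) (abs_nonneg _)).trans (le_of_eq ?_)
  rw [← abs_mul, mul_div_cancel₀ _ hM.ne']

lemma abs_trunc_le_bound {M : ℝ} (hM : 0 < M) (t : ℝ) : |trunc M t| ≤ M * (Real.pi / 2) := by
  rw [trunc, abs_mul, abs_of_pos hM]
  gcongr
  rw [abs_le]
  exact ⟨(Real.neg_pi_div_two_lt_arctan _).le, (Real.arctan_lt_pi_div_two _).le⟩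

lemma tendsto_trunc (t : ℝ) :
    Tendsto (fun n : ℕ => trunc ((n : ℝ) + 1) t) atTop (𝓝 t) := by
  have h := (Real.hasDerivAt_arctan 0).hasFDerivAt.lim (l := atTop)
    (c := fun n : ℕ => (n : ℝ) + 1) t (by
      refine tendsto_norm_atTop_atTop.comp ?_
      exact tendsto_atTop_add_const_right _ _ tendsto_natCast_atTop_atTop)
  simp only [zero_add, smul_eq_mul, Real.arctan_zero, sub_zero] at h
  simpa [trunc, div_eq_inv_mul] using! h

lemma tendsto_trunc_deriv (t : ℝ) :
    Tendsto (fun n : ℕ => (1 + (t / ((n : ℝ) + 1)) ^ 2)⁻¹) atTop (𝓝 1) := by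
  have h1 : Tendsto (fun n : ℕ => t / ((n : ℝ) + 1)) atTop (𝓝 0) := by
    have := tendsto_one_div_add_atTop_nhds_zero_nat (𝕜 := ℝ) |>.const_mul t
    simpa [div_eq_mul_inv] using this
  have h2 := ((h1.pow 2).const_add 1).inv₀ (by norm_num)
  simpa using h2

lemma trunc_deriv_mem (M t : ℝ) : 0 < (1 + (t / M) ^ 2)⁻¹ ∧ (1 + (t / M) ^ 2)⁻¹ ≤ 1 :=
  ⟨by positivity, inv_le_one_of_one_le₀ (by nlinarith [sq_nonneg (t / M)])⟩

lemma HasGradOn.trunc {X : Set (E d)} {f : E d → ℝ} {v : Fin d → E d → ℝ} (hf : HasGradOn X f v)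
    {M : ℝ} (hM : M ≠ 0) : HasGradOn X (fun x => trunc M (f x))
      (fun i x => (1 + (f x / M) ^ 2)⁻¹ * v i x) := by
  refine ⟨?_, fun i x hx => ?_⟩
  · have e : X.indicator (fun x => ActiveSubspace.trunc M (f x)) =
        fun x => ActiveSubspace.trunc M (X.indicator f x) := by
      ext x
      by_cases hx : x ∈ X <;> simp [hx, ActiveSubspace.trunc]
    rw [e]
    exact (measurable_trunc M).comp hf.1
  · have h := hf.2 i x hx
    unfold HasLineDerivAt at h ⊢
    exact (hasDerivAt_trunc hM (f x)).comp_of_eq (0 : ℝ) h (by simp)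

lemma HasGradOn.indicator {X : Set (E d)} (hX : IsOpen X) {f : E d → ℝ} {v : Fin d → E d → ℝ}
    (hf : HasGradOn X f v) : HasGradOn X (X.indicator f) v := by
  refine ⟨by rw [indicator_indicator, inter_self]; exact hf.1, fun i x hx => ?_⟩
  refine (hf.2 i x hx).congr_of_eventuallyEq ?_
  filter_upwards [hX.mem_nhds hx] with y hy
  simp [hy]

/-- A function with square integrable partial derivatives is square integrable: Fatou's lemma
carries the Poincaré inequality from its truncations to the function itself. -/
lemma IsModelDensity.memLp_of_measurable {ρ : E d → ℝ} (hρ : IsModelDensity ρ) {f : E d → ℝ}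
    {v : Fin d → E d → ℝ} (hfm : Measurable f) (hf : HasGradOn (posSet ρ) f v)
    (hv : ∀ i, MemLp (v i) 2 (law ρ)) : MemLp f 2 (law ρ) := by
  have := hρ.isProbabilityMeasure
  set μ := law ρ
  obtain ⟨K, hK, hP⟩ := hρ.exists_lintegral_sub_sq_le
  set c : ℕ → ℝ := fun n => (n : ℝ) + 1
  have hc : ∀ n, 0 < c n := fun n => by positivity
  set B : ℝ≥0∞ := 6 * (K * ∑ i, ∫⁻ x, ‖v i x‖ₑ ^ 2 ∂μ) with hB
  have hBtop : B ≠ ∞ := by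
    refine ENNReal.mul_ne_top (by simp) (ENNReal.mul_ne_top hK ?_)
    refine (ENNReal.sum_lt_top.2 fun i _ => ?_).ne
    rw [← eLpNorm_two_sq]
    exact ENNReal.pow_lt_top (hv i).2
  have hvm : ∀ n i, AEStronglyMeasurable (fun x => (1 + (f x / c n) ^ 2)⁻¹ * v i x) μ :=
    fun n i => AEStronglyMeasurable.mul
      (Measurable.aestronglyMeasurable (by fun_prop)) (hv i).1
  have hvle : ∀ n i x, ‖(1 + (f x / c n) ^ 2)⁻¹ * v i x‖ ≤ ‖v i x‖ := fun n i x => by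
    rw [norm_mul, Real.norm_of_nonneg (trunc_deriv_mem _ _).1.le]
    exact mul_le_of_le_one_left (norm_nonneg _) (trunc_deriv_mem _ _).2
  have hbound : ∀ n, ∫⁻ q, ‖trunc (c n) (f q.2) - trunc (c n) (f q.1)‖ₑ ^ 2 ∂(μ.prod μ) ≤ B := by
    intro n
    have htm : Measurable fun x => trunc (c n) (f x) := (measurable_trunc _).comp hfm
    have h1 := hρ.c1Approx_of_bounded (hf.trunc (hc n).ne')
      (M := c n * (Real.pi / 2)) (fun x _ => abs_trunc_le_bound (hc n) _)
      (fun i => (hv i).of_le (hvm n i) (Eventually.of_forall fun x => hvle n i x))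
    have h2 := h1.lintegral_sub_sq_le hK hP htm (hvm n)
    rw [lintegral_prod (fun q : E d × E d => ‖trunc (c n) (f q.2) - trunc (c n) (f q.1)‖ₑ ^ 2)
      (by fun_prop)]
    refine h2.trans ?_
    rw [hB]
    gcongr with i _ x
    exact enorm_le_iff_norm_le.2 (hvle n i x)
  have hfatou : ∫⁻ q, ‖f q.2 - f q.1‖ₑ ^ 2 ∂(μ.prod μ) ≤ B := by
    have hlim : ∀ q : E d × E d, ‖f q.2 - f q.1‖ₑ ^ 2 =
        liminf (fun n => ‖trunc (c n) (f q.2) - trunc (c n) (f q.1)‖ₑ ^ 2) atTop := fun q => by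
      have h2 : Continuous fun t : ℝ => ‖t‖ₑ ^ 2 := by fun_prop
      exact (((h2.tendsto _).comp
        ((tendsto_trunc (f q.2)).sub (tendsto_trunc (f q.1)))).liminf_eq).symm
    simp only [hlim]
    refine (lintegral_liminf_le fun n => ?_).trans ?_
    · have htm : Measurable fun x => trunc (c n) (f x) := (measurable_trunc _).comp hfm
      fun_prop
    · exact liminf_le_of_le (by isBoundedDefault) fun b hb => by
        obtain ⟨n, hn⟩ := hb.exists
        exact hn.trans (hbound n)
  rw [lintegral_prod (fun q : E d × E d => ‖f q.2 - f q.1‖ₑ ^ 2) (by fun_prop)] at hfatou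
  have hae := ae_lt_top (Measurable.lintegral_prod_right'
    (f := fun q : E d × E d => ‖f q.2 - f q.1‖ₑ ^ 2) (ν := μ) (by fun_prop))
    (ne_top_of_le_ne_top hBtop hfatou)
  obtain ⟨x, hx⟩ := hae.exists
  have h1 : MemLp (fun y => f y - f x) 2 μ := by
    refine ⟨(hfm.sub_const _).aestronglyMeasurable, ?_⟩
    by_contra h
    rw [not_lt, top_le_iff] at h
    simp only [← eLpNorm_two_sq (fun y => f y - f x), h] at hx
    simp at hx
  have h2 := h1.add (memLp_const (f x))
  simpa [Pi.add_def] using! h2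

/-- The global approximation statement: a function with square integrable partial derivatives is
square integrable and approximated, together with its gradient, by functions in `C¹_c`. -/
lemma IsModelDensity.memLp_and_c1Approx {ρ : E d → ℝ} (hρ : IsModelDensity ρ) {f : E d → ℝ}
    {v : Fin d → E d → ℝ} (hf : HasGradOn (posSet ρ) f v) (hv : ∀ i, MemLp (v i) 2 (law ρ)) :
    MemLp f 2 (law ρ) ∧ C1Approx (law ρ) f v := by
  have := hρ.isProbabilityMeasure
  have hae : (posSet ρ).indicator f =ᵐ[law ρ] f := by
    filter_upwards [ae_mem_posSet hρ.measurable] with x hx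
    simp [hx]
  have hfi := hf.indicator hρ.isOpen_posSet
  have hL := hρ.memLp_of_measurable hf.1 hfi hv
  refine ⟨(memLp_congr_ae hae).1 hL, ?_⟩
  refine C1Approx.congr_ae ?_ hae fun i => ae_eq_refl (v i)
  have hfm := hf.1
  set f' := (posSet ρ).indicator f
  set c : ℕ → ℝ := fun n => (n : ℝ) + 1
  have hc : ∀ n, 0 < c n := fun n => by positivity
  have htm : ∀ n, AEStronglyMeasurable (fun x => trunc (c n) (f' x)) (law ρ) := fun n =>
    ((measurable_trunc _).comp hfm).aestronglyMeasurable
  have hvm : ∀ n i, AEStronglyMeasurable (fun x => (1 + (f' x / c n) ^ 2)⁻¹ * v i x) (law ρ) :=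
    fun n i => AEStronglyMeasurable.mul
      (Measurable.aestronglyMeasurable (by fun_prop)) (hv i).1
  refine C1Approx.of_tendsto (l := atTop) (U := fun n x => trunc (c n) (f' x))
    (V := fun n i x => (1 + (f' x / c n) ^ 2)⁻¹ * v i x) hL.1 (fun i => (hv i).1)
    (Eventually.of_forall htm) (fun i => Eventually.of_forall fun n => hvm n i)
    (Eventually.of_forall fun n => ?_) ?_ fun i => ?_
  · refine hρ.c1Approx_of_bounded (hfi.trunc (hc n).ne')
      (M := c n * (Real.pi / 2)) (fun x _ => abs_trunc_le_bound (hc n) _) fun i =>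
      (hv i).of_le (hvm n i) (Eventually.of_forall fun x => ?_)
    rw [norm_mul, Real.norm_of_nonneg (trunc_deriv_mem _ _).1.le]
    exact mul_le_of_le_one_left (norm_nonneg _) (trunc_deriv_mem _ _).2
  · refine tendsto_eLpNorm_two_of_dominated (G := fun x => |f' x| + |f' x|) htm hL.1
      (hL.abs.add hL.abs) (fun n => Eventually.of_forall fun x => ?_)
      (Eventually.of_forall fun x => tendsto_trunc (f' x))
    exact (abs_sub _ _).trans (add_le_add (abs_trunc_le (hc n) _) le_rfl)
  · refine tendsto_eLpNorm_two_of_dominated (F := fun n x => (1 + (f' x / c n) ^ 2)⁻¹ * v i x)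
      (G := fun x => |v i x|) (fun n => hvm n i) (hv i).1
      (hv i).abs (fun n => Eventually.of_forall fun x => ?_) (Eventually.of_forall fun x => ?_)
    · have e : (1 + (f' x / c n) ^ 2)⁻¹ * v i x - v i x =
          -(1 - (1 + (f' x / c n) ^ 2)⁻¹) * v i x := by ring
      have h := trunc_deriv_mem (c n) (f' x)
      rw [e, abs_mul, abs_neg, abs_of_nonneg (by linarith)]
      exact mul_le_of_le_one_left (abs_nonneg _) (by linarith)
    · simpa using (tendsto_trunc_deriv (f' x)).mul_const (v i x)

lemma IsAdmissible.hasGradOn {ρ f : E d → ℝ} (hρ : IsModelDensity ρ) (hf : IsAdmissible ρ f) :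
    HasGradOn (posSet ρ) f (partialDeriv f) := by
  refine ⟨?_, fun i x hx => (hf.hasPartialDeriv x hx i).hasLineDerivAt⟩
  refine measurable_of_restrict_of_restrict_compl hρ.isOpen_posSet.measurableSet ?_ ?_
  · convert! hf.measurable using 1
    ext x
    simp [x.2]
  · convert! (measurable_const : Measurable fun _ : ((posSet ρ)ᶜ : Set (E d)) => (0 : ℝ)) using 1
    ext x
    exact indicator_of_notMem x.2 f

end

/-! ### Active and inactive coordinates -/

section

variable {k m : ℕ}

section Coordinates

variable {W : Matrix (Fin (k + m)) (Fin (k + m)) ℝ}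

lemma transpose_mul_self (hW : W ∈ Matrix.orthogonalGroup (Fin (k + m)) ℝ) : Wᵀ * W = 1 :=
  (Matrix.mem_orthogonalGroup_iff' _ _).1 hW

lemma W₁_transpose_mul_W₁ (hW : W ∈ Matrix.orthogonalGroup (Fin (k + m)) ℝ) :
    (W₁ W)ᵀ * W₁ W = 1 := by
  have h := congrArg (fun A => A.submatrix (Fin.castAdd m) (Fin.castAdd m)) (transpose_mul_self hW)
  ext i j
  simpa [Matrix.mul_apply, W₁, Matrix.one_apply] using congrFun₂ h i j

lemma W₁_transpose_mul_W₂ (hW : W ∈ Matrix.orthogonalGroup (Fin (k + m)) ℝ) :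
    (W₁ W)ᵀ * W₂ W = 0 := by
  ext i j
  have h := congrFun₂ (transpose_mul_self hW) (Fin.castAdd m i) (Fin.natAdd k j)
  have hne : Fin.castAdd m i ≠ Fin.natAdd k j := fun h => by
    have := congrArg Fin.val h
    simp at this
    omega
  simpa [Matrix.mul_apply, W₁, W₂, Matrix.one_apply, hne] using h

lemma W₂_transpose_mul_W₂ (hW : W ∈ Matrix.orthogonalGroup (Fin (k + m)) ℝ) :
    (W₂ W)ᵀ * W₂ W = 1 := by
  have h := congrArg (fun A => A.submatrix (Fin.natAdd k) (Fin.natAdd k)) (transpose_mul_self hW)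
  ext i j
  simpa [Matrix.mul_apply, W₂, Matrix.one_apply] using congrFun₂ h i j

lemma active_join (hW : W ∈ Matrix.orthogonalGroup (Fin (k + m)) ℝ) (y : E k) (z : E m) :
    active W (join W y z) = y := by
  simp [active, join, Matrix.mulVec_add, W₁_transpose_mul_W₁ hW, W₁_transpose_mul_W₂ hW]

lemma norm_join_sq (hW : W ∈ Matrix.orthogonalGroup (Fin (k + m)) ℝ) (y : E k) (z : E m) :
    ‖join W y z‖ ^ 2 = ‖y‖ ^ 2 + ‖z‖ ^ 2 := by
  have hdot : ∀ {n : ℕ} (x : E n), ‖x‖ ^ 2 = WithLp.ofLp x ⬝ᵥ WithLp.ofLp x := fun x => by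
    rw [EuclideanSpace.real_norm_sq_eq]
    simp [dotProduct, sq]
  have key : ∀ {p q : ℕ} (A : Matrix (Fin (k + m)) (Fin p) ℝ) (B : Matrix (Fin (k + m)) (Fin q) ℝ)
      (v : Fin p → ℝ) (w : Fin q → ℝ), (A *ᵥ v) ⬝ᵥ (B *ᵥ w) = v ⬝ᵥ ((Aᵀ * B) *ᵥ w) := by
    intro p q A B v w
    rw [← Matrix.mulVec_mulVec, Matrix.dotProduct_mulVec v Aᵀ, Matrix.vecMul_transpose]
  have h21 : (W₂ W)ᵀ * W₁ W = 0 := by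
    rw [← Matrix.transpose_inj, Matrix.transpose_mul, Matrix.transpose_transpose,
      W₁_transpose_mul_W₂ hW, Matrix.transpose_zero]
  rw [hdot, hdot, hdot, join]
  simp only [dotProduct_add, add_dotProduct, key, h21, W₁_transpose_mul_W₁ hW,
    W₂_transpose_mul_W₂ hW, W₁_transpose_mul_W₂ hW, Matrix.one_mulVec, Matrix.zero_mulVec,
    dotProduct_zero, add_zero, zero_add]

/-- `(y, z) ↦ W₁ y + W₂ z` as a linear isometry of the Euclidean product. -/
def joinIsometry (hW : W ∈ Matrix.orthogonalGroup (Fin (k + m)) ℝ) :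
    WithLp 2 (E k × E m) ≃ₗᵢ[ℝ] E (k + m) :=
  LinearIsometry.toLinearIsometryEquiv
    { toFun := fun p => join W p.fst p.snd
      map_add' := fun p q => by
        ext i
        simp [join, Matrix.mulVec_add]
        ring
      map_smul' := fun c p => by
        ext i
        simp [join, Matrix.mulVec_smul]
      norm_map' := fun p => by
        rw [← sq_eq_sq₀ (norm_nonneg _) (norm_nonneg _), WithLp.prod_norm_sq_eq_of_L2]
        exact norm_join_sq hW _ _ }
    (by simp [LinearEquiv.finrank_eq (WithLp.linearEquiv 2 ℝ (E k × E m))])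

lemma continuous_join : Continuous fun p : E k × E m => join W p.1 p.2 := by
  unfold join
  fun_prop

@[fun_prop]
lemma measurable_join : Measurable fun p : E k × E m => join W p.1 p.2 :=
  continuous_join.measurable

lemma measurable_join_right (y : E k) : Measurable fun z : E m => join W y z :=
  measurable_join.comp (f := fun z : E m => (y, z)) (by fun_prop)

lemma continuous_active : Continuous (active W) := by
  unfold active
  fun_prop

lemma exists_join_eq (hW : W ∈ Matrix.orthogonalGroup (Fin (k + m)) ℝ) (x : E (k + m)) :
    ∃ z : E m, join W (active W x) z = x := by
  obtain ⟨p, hp⟩ := (joinIsometry hW).surjective x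
  have hp' : join W p.fst p.snd = x := hp
  refine ⟨p.snd, ?_⟩
  rw [← hp', active_join hW]

lemma measurePreserving_join (hW : W ∈ Matrix.orthogonalGroup (Fin (k + m)) ℝ) :
    MeasurePreserving (fun p : E k × E m => join W p.1 p.2) (volume.prod volume) volume :=
  (joinIsometry hW).measurePreserving.comp (WithLp.volume_preserving_toLp (E k) (E m))

lemma join_add_sub (y : E k) (z z' : E m) :
    join W y z = join W y z' + join W 0 (z - z') := by
  ext i
  simp [join, Matrix.mulVec_sub]

lemma dist_join (hW : W ∈ Matrix.orthogonalGroup (Fin (k + m)) ℝ) (y : E k) (z z' : E m) :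
    dist (join W y z) (join W y z') = dist z z' := by
  rw [dist_eq_norm, dist_eq_norm, join_add_sub y z z', add_sub_cancel_left,
    ← sq_eq_sq₀ (norm_nonneg _) (norm_nonneg _), norm_join_sq hW]
  simp

lemma mem_activeSet_of_join_mem (hW : W ∈ Matrix.orthogonalGroup (Fin (k + m)) ℝ)
    {ρ : E (k + m) → ℝ} {y : E k} {z : E m} (h : join W y z ∈ posSet ρ) : y ∈ activeSet ρ W :=
  ⟨_, h, active_join hW y z⟩

lemma exists_join_mem_of_mem_activeSet (hW : W ∈ Matrix.orthogonalGroup (Fin (k + m)) ℝ)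
    {ρ : E (k + m) → ℝ} {y : E k} (h : y ∈ activeSet ρ W) : ∃ z : E m, join W y z ∈ posSet ρ := by
  obtain ⟨x, hx, rfl⟩ := h
  obtain ⟨z, hz⟩ := exists_join_eq hW x
  exact ⟨z, by rwa [hz]⟩

lemma isOpen_activeSet (hW : W ∈ Matrix.orthogonalGroup (Fin (k + m)) ℝ)
    {ρ : E (k + m) → ℝ} (h : IsOpen (posSet ρ)) : IsOpen (activeSet ρ W) := by
  have e : activeSet ρ W = ⋃ z : E m, (fun y => join W y z) ⁻¹' posSet ρ := by
    ext y
    simp only [mem_iUnion, mem_preimage]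
    exact ⟨exists_join_mem_of_mem_activeSet hW, fun ⟨z, hz⟩ => mem_activeSet_of_join_mem hW hz⟩
  rw [e]
  exact isOpen_iUnion fun z => h.preimage
    (continuous_join.comp (f := fun y : E k => (y, z)) (by fun_prop))

lemma contDiff_join_right (y : E k) : ContDiff ℝ 1 fun z : E m => join W y z := by
  unfold join
  rw [contDiff_piLp]
  intro i
  simp only [Matrix.mulVec, dotProduct, Pi.add_apply]
  fun_prop

lemma contDiff_slice {F : E (k + m) → ℝ} (hF : ContDiff ℝ 1 F) (y : E k) :
    ContDiff ℝ 1 fun z : E m => F (join W y z) :=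
  hF.comp (contDiff_join_right y)

/-- The chain rule in the inactive variables: the gradient of a slice is `W₂ᵀ ∇F`. -/
lemma enorm_gradient_slice_sq {F : E (k + m) → ℝ} (hF : ContDiff ℝ 1 F) (y : E k) (z : E m) :
    ‖gradient (fun z => F (join W y z)) z‖ₑ ^ 2 =
      ∑ j, ‖∑ r, W r (Fin.natAdd k j) * partialDeriv F r (join W y z)‖ₑ ^ 2 := by
  let L : E m →L[ℝ] E (k + m) := LinearMap.toContinuousLinearMap
    { toFun := fun z => join W 0 z
      map_add' := fun p q => by
        ext i
        simp [join, Matrix.mulVec_add]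
      map_smul' := fun c p => by
        ext i
        simp [join, Matrix.mulVec_smul] }
  have hL : ∀ z, L z = join W 0 z := fun z => rfl
  have hj : (fun z => join W y z) = fun z => join W y 0 + L z := by
    ext z : 1
    rw [join_add_sub y z 0, sub_zero, hL]
  have hjd : ∀ z, HasFDerivAt (fun z => join W y z) L z := fun z => by
    rw [hj]
    exact L.hasFDerivAt.const_add _
  have hFj : ∀ z, HasFDerivAt (fun z => F (join W y z)) ((fderiv ℝ F (join W y z)).comp L) z :=
    fun z => (hF.differentiable one_ne_zero _).hasFDerivAt.comp z (hjd z)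
  rw [enorm_gradient_sq (contDiff_slice hF y)]
  refine Finset.sum_congr rfl fun j _ => ?_
  congr 2
  rw [partialDeriv_eq_fderiv (hFj z).differentiableAt, (hFj z).fderiv]
  have hLj : L (EuclideanSpace.single j 1) =
      ∑ r, W r (Fin.natAdd k j) • EuclideanSpace.single r (1 : ℝ) := by
    ext i
    rw [hL]
    simp [join, W₂, Finset.sum_apply, Pi.single_apply]
  rw [ContinuousLinearMap.comp_apply, hLj, map_sum]
  refine Finset.sum_congr rfl fun r _ => ?_
  rw [map_smul, partialDeriv_eq_fderiv (hF.differentiable one_ne_zero _), smul_eq_mul]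

end Coordinates

end

/-! ### Conditional densities -/

section

variable {k m d : ℕ}

lemma IsModelDensity.lintegral_eq_one {ρ : E d → ℝ} (hρ : IsModelDensity ρ) :
    ∫⁻ x, ENNReal.ofReal (ρ x) = 1 := by
  have h := hρ.isProbabilityMeasure.measure_univ
  rwa [law, withDensity_apply _ MeasurableSet.univ, Measure.restrict_univ] at h

lemma IsModelDensity.integral_eq_one {ρ : E d → ℝ} (hρ : IsModelDensity ρ) : ∫ x, ρ x = 1 := by
  rw [integral_eq_lintegral_of_nonneg_ae (Eventually.of_forall hρ.nonneg)
    hρ.measurable.aestronglyMeasurable, hρ.lintegral_eq_one, ENNReal.toReal_one]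

lemma prod_gaussianPDFReal_eq (x : E d) : ∏ i, gaussianPDFReal 0 1 (x i) =
    (√(2 * Real.pi))⁻¹ ^ d * Real.exp (-‖x‖ ^ 2 / 2) := by
  simp only [gaussianPDFReal, NNReal.coe_one, mul_one, sub_zero, Finset.prod_mul_distrib,
    Finset.prod_const, Finset.card_univ, Fintype.card_fin]
  rw [← Real.exp_sum, EuclideanSpace.real_norm_sq_eq, ← Finset.sum_div, Finset.sum_neg_distrib]

section Conditional

variable {W : Matrix (Fin (k + m)) (Fin (k + m)) ℝ}

lemma isOpen_slice {U : Set (E (k + m))} (hU : IsOpen U) (y : E k) :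
    IsOpen ((fun z : E m => join W y z) ⁻¹' U) :=
  hU.preimage (contDiff_join_right y).continuous

lemma convex_slice {U : Set (E (k + m))} (hU : Convex ℝ U) (y : E k) :
    Convex ℝ ((fun z : E m => join W y z) ⁻¹' U) := by
  intro z hz z' hz' a b ha hb hab
  have h := hU hz hz' ha hb hab
  have e : a • join W y z + b • join W y z' = join W y (a • z + b • z') := by
    have hy : y = a • y + b • y := by rw [← add_smul, hab, one_smul]
    conv_rhs => rw [hy]
    ext i
    simp [join, Matrix.mulVec_add, Matrix.mulVec_smul]
    ring
  rwa [e] at h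

lemma isBounded_slice (hW : W ∈ Matrix.orthogonalGroup (Fin (k + m)) ℝ) {U : Set (E (k + m))}
    (hU : Bornology.IsBounded U) (y : E k) :
    Bornology.IsBounded ((fun z : E m => join W y z) ⁻¹' U) := by
  obtain ⟨C, hC⟩ := Metric.isBounded_iff.1 hU
  refine Metric.isBounded_iff.2 ⟨C, fun z hz z' hz' => ?_⟩
  rw [← dist_join hW y]
  exact hC hz hz'

lemma activeDensity_uniform {U : Set (E (k + m))} (hU : IsOpen U) (y : E k) :
    activeDensity (U.indicator fun _ => (volume.real U)⁻¹) W y =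
      volume.real ((fun z : E m => join W y z) ⁻¹' U) * (volume.real U)⁻¹ := by
  have e : (fun z : E m => U.indicator (fun _ => (volume.real U)⁻¹) (join W y z)) =
      ((fun z : E m => join W y z) ⁻¹' U).indicator fun _ => (volume.real U)⁻¹ := by
    ext z
    by_cases hz : join W y z ∈ U <;> simp [hz]
  rw [activeDensity, e, integral_indicator (isOpen_slice hU y).measurableSet, setIntegral_const,
    smul_eq_mul]

/-- Conditioning a uniform distribution gives the uniform distribution on a slice. -/
lemma condDensity_uniform {U : Set (E (k + m))} (hU : IsOpen U) (hne : U.Nonempty)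
    (hb : Bornology.IsBounded U) (y : E k) :
    condDensity (U.indicator fun _ => (volume.real U)⁻¹) W y =
      ((fun z : E m => join W y z) ⁻¹' U).indicator
        fun _ => (volume.real ((fun z : E m => join W y z) ⁻¹' U))⁻¹ := by
  have h0 := measureReal_pos_of_isOpen hU hne hb
  ext z
  rw [condDensity, activeDensity_uniform hU]
  by_cases hz : join W y z ∈ U
  · rw [indicator_of_mem hz, indicator_of_mem (by exact hz), div_mul_eq_div_div_swap,
      div_self (inv_ne_zero h0.ne'), one_div]
  · rw [indicator_of_notMem hz, indicator_of_notMem (by exact hz), zero_div]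

lemma join_gaussianDensity (hW : W ∈ Matrix.orthogonalGroup (Fin (k + m)) ℝ) (y : E k) (z : E m) :
    ∏ i, gaussianPDFReal 0 1 (join W y z i) =
      (∏ i, gaussianPDFReal 0 1 (y i)) * ∏ i, gaussianPDFReal 0 1 (z i) := by
  rw [prod_gaussianPDFReal_eq, prod_gaussianPDFReal_eq, prod_gaussianPDFReal_eq, norm_join_sq hW,
    neg_add, add_div, Real.exp_add, pow_add]
  ring

lemma activeDensity_gaussian (hW : W ∈ Matrix.orthogonalGroup (Fin (k + m)) ℝ) (y : E k) :
    activeDensity (fun x => ∏ i, gaussianPDFReal 0 1 (x i)) W y =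
      ∏ i, gaussianPDFReal 0 1 (y i) := by
  have h : IsModelDensity fun z : E m => ∏ i, gaussianPDFReal 0 1 (z i) := Or.inr rfl
  rw [activeDensity]
  simp only [join_gaussianDensity hW]
  rw [integral_const_mul, h.integral_eq_one, mul_one]

/-- Conditioning a standard normal distribution gives the standard normal distribution. -/
lemma condDensity_gaussian (hW : W ∈ Matrix.orthogonalGroup (Fin (k + m)) ℝ) (y : E k) :
    condDensity (fun x => ∏ i, gaussianPDFReal 0 1 (x i)) W y =
      fun z => ∏ i, gaussianPDFReal 0 1 (z i) := by
  ext z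
  have h0 : 0 < ∏ i, gaussianPDFReal 0 1 (y i) :=
    Finset.prod_pos fun i _ => gaussianPDFReal_pos _ _ _ (by simp)
  rw [condDensity, activeDensity_gaussian hW, join_gaussianDensity hW,
    mul_div_cancel_left₀ _ h0.ne']

variable {ρ : E (k + m) → ℝ}

lemma IsModelDensity.condDensity (hρ : IsModelDensity ρ)
    (hW : W ∈ Matrix.orthogonalGroup (Fin (k + m)) ℝ) {y : E k} (hy : y ∈ activeSet ρ W) :
    IsModelDensity (condDensity ρ W y) := by
  obtain ⟨U, hU, hne, hb, hc, rfl⟩ | h := hρ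
  · obtain ⟨z, hz⟩ := exists_join_mem_of_mem_activeSet hW hy
    rw [posSet_uniform hU hne hb] at hz
    exact Or.inl ⟨_, isOpen_slice hU y, ⟨z, hz⟩, isBounded_slice hW hb y, convex_slice hc y,
      condDensity_uniform hU hne hb y⟩
  · rw [h, condDensity_gaussian hW]
    exact Or.inr rfl

lemma IsModelDensity.activeDensity_pos (hρ : IsModelDensity ρ)
    (hW : W ∈ Matrix.orthogonalGroup (Fin (k + m)) ℝ) {y : E k} (hy : y ∈ activeSet ρ W) :
    0 < activeDensity ρ W y := by
  obtain ⟨U, hU, hne, hb, hc, rfl⟩ | h := hρ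
  · obtain ⟨z, hz⟩ := exists_join_mem_of_mem_activeSet hW hy
    rw [posSet_uniform hU hne hb] at hz
    rw [activeDensity_uniform hU]
    exact mul_pos (measureReal_pos_of_isOpen (isOpen_slice hU y) ⟨z, hz⟩ (isBounded_slice hW hb y))
      (inv_pos.2 (measureReal_pos_of_isOpen hU hne hb))
  · rw [h, activeDensity_gaussian hW]
    exact Finset.prod_pos fun i _ => gaussianPDFReal_pos _ _ _ (by simp)

lemma IsModelDensity.condDensity_nonneg (hρ : IsModelDensity ρ) (y : E k) (z : E m) :
    0 ≤ ActiveSubspace.condDensity ρ W y z :=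
  div_nonneg (hρ.nonneg _) (integral_nonneg fun _ => hρ.nonneg _)

lemma IsModelDensity.isProbabilityMeasure_condLaw (hρ : IsModelDensity ρ)
    (hW : W ∈ Matrix.orthogonalGroup (Fin (k + m)) ℝ) {y : E k} (hy : y ∈ activeSet ρ W) :
    IsProbabilityMeasure (condLaw ρ W y) :=
  (hρ.condDensity hW hy).isProbabilityMeasure

/-- The slices of a bounded convex set are convex with at most the same diameter, so their
Poincaré inequalities hold with a common constant. -/
lemma IsModelDensity.exists_condLaw_lintegral_sub_sq_le (hρ : IsModelDensity ρ)
    (hW : W ∈ Matrix.orthogonalGroup (Fin (k + m)) ℝ) :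
    ∃ K : ℝ≥0∞, K ≠ ∞ ∧ ∀ y ∈ activeSet ρ W, ∀ h : E m → ℝ, ContDiff ℝ 1 h →
      ∫⁻ x, ∫⁻ y, ‖h y - h x‖ₑ ^ 2 ∂(condLaw ρ W y) ∂(condLaw ρ W y) ≤
        K * ∫⁻ z, ‖gradient h z‖ₑ ^ 2 ∂(condLaw ρ W y) := by
  obtain ⟨U, hU, hne, hb, hc, rfl⟩ | h := hρ
  · refine ⟨ENNReal.ofReal (Metric.diam U) ^ 2 * 2 ^ m, by finiteness, fun y hy h hh => ?_⟩
    obtain ⟨z, hz⟩ := exists_join_mem_of_mem_activeSet hW hy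
    rw [posSet_uniform hU hne hb] at hz
    rw [condLaw, condDensity_uniform hU hne hb]
    refine lintegral_sub_sq_le_uniform (isOpen_slice hU y) ⟨z, hz⟩ (isBounded_slice hW hb y)
      (convex_slice hc y) (fun z hz z' hz' => ?_) hh
    rw [← ofReal_norm, ← dist_eq_norm, ← dist_join hW y]
    exact ENNReal.ofReal_le_ofReal (Metric.dist_le_diam_of_mem hb hz' hz)
  · refine ⟨ENNReal.ofReal (Real.pi / 2) ^ 2 * ∫⁻ z, ‖z‖ₑ ^ 2 ∂(stdGaussian (E m)),
      ENNReal.mul_ne_top (by finiteness) lintegral_enorm_sq_stdGaussian_ne_top,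
      fun y _ h' hh => ?_⟩
    rw [condLaw, h, condDensity_gaussian hW, IsStdGaussianDensity.law_eq rfl]
    exact lintegral_sub_sq_le_stdGaussian hh

lemma IsModelDensity.measurable_activeDensity (hρ : IsModelDensity ρ) :
    Measurable (activeDensity ρ W) := by
  have h : Measurable fun p : E k × E m => ρ (join W p.1 p.2) :=
    hρ.measurable.comp measurable_join
  exact (h.stronglyMeasurable.integral_prod_right').measurable

lemma IsModelDensity.measurable_condDensity (hρ : IsModelDensity ρ) :
    Measurable fun p : E k × E m => ActiveSubspace.condDensity ρ W p.1 p.2 :=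
  (hρ.measurable.comp measurable_join).div (hρ.measurable_activeDensity.comp measurable_fst)

lemma lintegral_condLaw (hρ : IsModelDensity ρ) (y : E k) {φ : E m → ℝ≥0∞} (hφ : Measurable φ) :
    ∫⁻ z, φ z ∂(condLaw ρ W y) = ∫⁻ z, ENNReal.ofReal (condDensity ρ W y z) * φ z := by
  have hm : Measurable fun z => ENNReal.ofReal (ActiveSubspace.condDensity ρ W y z) :=
    (hρ.measurable_condDensity.comp (f := fun z : E m => (y, z)) (by fun_prop)).ennreal_ofReal
  rw [condLaw, law, lintegral_withDensity_eq_lintegral_mul _ hm hφ]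
  rfl

lemma lintegral_law (hρ : IsModelDensity ρ) (hW : W ∈ Matrix.orthogonalGroup (Fin (k + m)) ℝ)
    {φ : E (k + m) → ℝ≥0∞} (hφ : Measurable φ) :
    ∫⁻ x, φ x ∂(law ρ) =
      ∫⁻ y, ∫⁻ z : E m, ENNReal.ofReal (ρ (join W y z)) * φ (join W y z) := by
  have hm : Measurable fun x => ENNReal.ofReal (ρ x) * φ x := hρ.measurable.ennreal_ofReal.mul hφ
  rw [law, lintegral_withDensity_eq_lintegral_mul _ hρ.measurable.ennreal_ofReal hφ]
  simp only [Pi.mul_apply]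
  rw [← (measurePreserving_join hW).lintegral_comp hm,
    lintegral_prod (fun p : E k × E m => ENNReal.ofReal (ρ (join W p.1 p.2)) *
      φ (join W p.1 p.2)) (hm.comp measurable_join).aemeasurable]

lemma measurable_lintegral_condLaw (hρ : IsModelDensity ρ) {φ : E k × E m → ℝ≥0∞}
    (hφ : Measurable φ) : Measurable fun y => ∫⁻ z, φ (y, z) ∂(condLaw ρ W y) := by
  have e : (fun y => ∫⁻ z, φ (y, z) ∂(condLaw ρ W y)) =
      fun y => ∫⁻ z, ENNReal.ofReal (condDensity ρ W y z) * φ (y, z) :=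
    funext fun y => lintegral_condLaw hρ y (by fun_prop)
  rw [e]
  exact (hρ.measurable_condDensity.ennreal_ofReal.mul hφ).lintegral_prod_right'

/-- Disintegration of `P_X` along the active variable. -/
lemma lintegral_law_eq (hρ : IsModelDensity ρ) (hW : W ∈ Matrix.orthogonalGroup (Fin (k + m)) ℝ)
    {φ : E (k + m) → ℝ≥0∞} (hφ : Measurable φ) :
    ∫⁻ x, φ x ∂(law ρ) = ∫⁻ y, ∫⁻ z, φ (join W y z) ∂(condLaw ρ W y) ∂(activeLaw ρ W) := by
  have hψ : Measurable fun y => ∫⁻ z, φ (join W y z) ∂(condLaw ρ W y) :=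
    measurable_lintegral_condLaw (φ := fun q : E k × E m => φ (join W q.1 q.2)) hρ
      (hφ.comp measurable_join)
  rw [activeLaw, lintegral_map hψ continuous_active.measurable,
    lintegral_law (φ := fun x => ∫⁻ z, φ (join W (active W x) z) ∂(condLaw ρ W (active W x)))
      hρ hW (hψ.comp continuous_active.measurable), lintegral_law hρ hW hφ]
  refine lintegral_congr fun y => ?_
  simp only [active_join hW]
  have hρy : Measurable fun z : E m => ENNReal.ofReal (ρ (join W y z)) :=
    (hρ.measurable.comp (measurable_join_right y)).ennreal_ofReal
  rw [lintegral_mul_const _ hρy]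
  by_cases hy : y ∈ activeSet ρ W
  · have hpos := hρ.activeDensity_pos hW hy
    have hmul : ∀ z : E m, ρ (join W y z) = activeDensity ρ W y * condDensity ρ W y z := fun z => by
      rw [condDensity, mul_div_cancel₀ _ hpos.ne']
    have hR : ∫⁻ z : E m, ENNReal.ofReal (ρ (join W y z)) =
        ENNReal.ofReal (activeDensity ρ W y) := by
      simp only [hmul, ENNReal.ofReal_mul hpos.le]
      rw [lintegral_const_mul' _ _ ENNReal.ofReal_ne_top, (hρ.condDensity hW hy).lintegral_eq_one,
        mul_one]
    rw [hR, lintegral_condLaw (φ := fun z => φ (join W y z)) hρ y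
      (hφ.comp (measurable_join_right y)),
      ← lintegral_const_mul' _ _ ENNReal.ofReal_ne_top]
    refine lintegral_congr fun z => ?_
    rw [hmul, ENNReal.ofReal_mul hpos.le, mul_assoc]
  · have h0 : ∀ z : E m, ENNReal.ofReal (ρ (join W y z)) = 0 := fun z => by
      rw [ENNReal.ofReal_eq_zero]
      by_contra h
      exact hy (mem_activeSet_of_join_mem hW (not_le.1 h))
    simp [h0]

lemma ae_activeLaw_mem (hρ : IsModelDensity ρ)
    (hW : W ∈ Matrix.orthogonalGroup (Fin (k + m)) ℝ) :
    ∀ᵐ y ∂(activeLaw ρ W), y ∈ activeSet ρ W := by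
  rw [activeLaw]
  refine (ae_map_iff continuous_active.aemeasurable
    (isOpen_activeSet hW hρ.isOpen_posSet).measurableSet).2 ?_
  filter_upwards [ae_mem_posSet hρ.measurable] with x hx
  exact mem_image_of_mem _ hx

lemma isProbabilityMeasure_activeLaw (hρ : IsModelDensity ρ) :
    IsProbabilityMeasure (activeLaw ρ W) := by
  have := hρ.isProbabilityMeasure
  exact Measure.isProbabilityMeasure_map continuous_active.aemeasurable

/-- Almost sure properties of `X` hold almost surely under almost every conditional law. -/
lemma ae_ae_condLaw (hρ : IsModelDensity ρ) (hW : W ∈ Matrix.orthogonalGroup (Fin (k + m)) ℝ)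
    {p : E (k + m) → Prop} (hp : ∀ᵐ x ∂(law ρ), p x) :
    ∀ᵐ y ∂(activeLaw ρ W), ∀ᵐ z ∂(condLaw ρ W y), p (join W y z) := by
  obtain ⟨N, hN, hNm, hN0⟩ := exists_measurable_superset_of_null hp
  have h1 : ∫⁻ x, N.indicator 1 x ∂(law ρ) = 0 := by
    rw [lintegral_indicator_one hNm, hN0]
  rw [lintegral_law_eq hρ hW (measurable_one.indicator hNm), lintegral_eq_zero_iff
    (measurable_lintegral_condLaw hρ (φ := fun q => N.indicator 1 (join W q.1 q.2))
      ((measurable_one.indicator hNm).comp measurable_join))] at h1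
  filter_upwards [h1] with y hy
  have hm : Measurable fun z : E m => N.indicator (1 : E (k + m) → ℝ≥0∞) (join W y z) :=
    (measurable_one.indicator hNm).comp (measurable_join_right y)
  rw [Pi.zero_apply, lintegral_eq_zero_iff hm] at hy
  filter_upwards [hy] with z hz
  by_contra hpz
  have : join W y z ∈ N := hN hpz
  simp [this] at hz

lemma lintegral_law_eq_of_aemeasurable (hρ : IsModelDensity ρ)
    (hW : W ∈ Matrix.orthogonalGroup (Fin (k + m)) ℝ)
    {φ : E (k + m) → ℝ≥0∞} (hφ : AEMeasurable φ (law ρ)) :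
    ∫⁻ x, φ x ∂(law ρ) = ∫⁻ y, ∫⁻ z, φ (join W y z) ∂(condLaw ρ W y) ∂(activeLaw ρ W) := by
  rw [lintegral_congr_ae hφ.ae_eq_mk, lintegral_law_eq hρ hW hφ.measurable_mk]
  refine lintegral_congr_ae ?_
  filter_upwards [ae_ae_condLaw hρ hW hφ.ae_eq_mk] with y hy
  exact lintegral_congr_ae (hy.mono fun z hz => hz.symm)

end Conditional

end

/-! ### The Poincaré constants of the conditional laws -/

section

variable {k m d : ℕ} {W : Matrix (Fin (k + m)) (Fin (k + m)) ℝ} {ρ : E (k + m) → ℝ}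

lemma exists_forall_evariance_condLaw_le (hρ : IsModelDensity ρ)
    (hW : W ∈ Matrix.orthogonalGroup (Fin (k + m)) ℝ) :
    ∃ K : ℝ≥0∞, K ≠ ∞ ∧ ∀ y ∈ activeSet ρ W, ∀ h : E m → ℝ, ContDiff ℝ 1 h →
      MemLp h 2 (condLaw ρ W y) →
      evariance h (condLaw ρ W y) ≤ K * ∫⁻ z, ‖gradient h z‖ₑ ^ 2 ∂(condLaw ρ W y) := by
  obtain ⟨K, hK, H⟩ := hρ.exists_condLaw_lintegral_sub_sq_le hW
  refine ⟨K, hK, fun y hy h hh hL => ?_⟩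
  have := hρ.isProbabilityMeasure_condLaw hW hy
  exact (evariance_le_lintegral_sub_sq (hL.integrable (by norm_num))).trans (H y hy h hh)

lemma poincareSup_lt_top (hρ : IsModelDensity ρ)
    (hW : W ∈ Matrix.orthogonalGroup (Fin (k + m)) ℝ) : poincareSup ρ W < ∞ := by
  obtain ⟨K, hK, H⟩ := exists_forall_evariance_condLaw_le hρ hW
  refine lt_of_le_of_lt (iSup₂_le fun y hy => ?_) (lt_top_iff_ne_top.2 hK)
  exact sInf_le fun h hh hL => H y hy h hh hL

lemma IsModelDensity.memLp_coord {ρ : E d → ℝ} (hρ : IsModelDensity ρ) (i : Fin d) :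
    MemLp (fun z : E d => z i) 2 (law ρ) := by
  have hm : Measurable fun z : E d => z i := by fun_prop
  have := hρ.isProbabilityMeasure
  obtain ⟨U, hU, hne, hb, hc, rfl⟩ | h := hρ
  · obtain ⟨R, hR⟩ := hb.subset_closedBall 0
    refine MemLp.of_bound hm.aestronglyMeasurable R ?_
    filter_upwards [ae_mem_posSet (measurable_const.indicator hU.measurableSet)] with z hz
    rw [posSet_uniform hU hne hb] at hz
    exact (PiLp.norm_apply_le z i).trans (by simpa using hR hz)
  · rw [h.law_eq]
    refine (IsGaussian.memLp_two_id (μ := stdGaussian (E d))).of_le hm.aestronglyMeasurable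
      (Eventually.of_forall fun z => PiLp.norm_apply_le z i)

/-- A coordinate has positive variance under a law with a density, as hyperplanes are null. -/
lemma IsModelDensity.evariance_coord_pos {ρ : E d → ℝ} (hρ : IsModelDensity ρ) (i : Fin d) :
    0 < evariance (fun z : E d => z i) (law ρ) := by
  rw [pos_iff_ne_zero]
  have hm : Measurable fun z : E d => z i := by fun_prop
  have := hρ.isProbabilityMeasure
  intro h0
  rw [evariance_eq_zero_iff hm.aemeasurable] at h0
  set c : ℝ := ∫ z : E d, z i ∂(law ρ)
  have hnull : (volume : Measure (E d)) {z | z i = c} = 0 := by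
    have h1 := (PiLp.volume_preserving_ofLp (Fin d)).measure_preimage
      (s := {x : Fin d → ℝ | x i = c})
      (measurableSet_eq_fun (measurable_pi_apply i) measurable_const).nullMeasurableSet
    have h2 : (volume : Measure (Fin d → ℝ)) {x | x i = c} = 0 := by
      rw [volume_pi]
      exact Measure.pi_hyperplane (fun _ : Fin d => (volume : Measure ℝ)) i c
    exact h1.trans h2
  have hlaw : law ρ {z | z i = c} = 0 := withDensity_absolutelyContinuous _ _ hnull
  have hcompl : law ρ {z | z i = c}ᶜ = 0 := h0
  have huniv := measure_union_le (μ := law ρ) {z : E d | z i = c} {z | z i = c}ᶜ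
  rw [union_compl_self, hlaw, hcompl, measure_univ] at huniv
  simp at huniv

/-- A coordinate function has unit gradient and positive variance, and so bounds the constant from
below. -/
lemma poincareConst_pos {ρ : E d → ℝ} (hρ : IsModelDensity ρ) (i : Fin d) :
    0 < poincareConst (law ρ) := by
  have := hρ.isProbabilityMeasure
  refine (hρ.evariance_coord_pos i).trans_le (le_sInf fun c hc => ?_)
  have hcd : ContDiff ℝ 1 fun z : E d => z i := by fun_prop
  have h1 := hc _ hcd (hρ.memLp_coord i)
  have hgrad : ∀ z : E d, ‖gradient (fun z : E d => z i) z‖ₑ ^ 2 = 1 := fun z => by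
    have hfd : fderiv ℝ (fun z : E d => z i) z = EuclideanSpace.proj i :=
      (EuclideanSpace.proj i : E d →L[ℝ] ℝ).hasFDerivAt.fderiv
    rw [enorm_gradient_sq hcd, Finset.sum_eq_single i]
    · rw [partialDeriv_eq_fderiv (hcd.differentiable one_ne_zero z), hfd]
      simp
    · intro j _ hj
      rw [partialDeriv_eq_fderiv (hcd.differentiable one_ne_zero z), hfd]
      simp [hj.symm]
    · simp
  simpa [hgrad] using h1

lemma poincareSup_pos (hm : 1 ≤ m) (hρ : IsModelDensity ρ)
    (hW : W ∈ Matrix.orthogonalGroup (Fin (k + m)) ℝ) : 0 < poincareSup ρ W := by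
  have := hρ.isProbabilityMeasure
  obtain ⟨x, hx⟩ := (ae_mem_posSet hρ.measurable).exists
  have hy : active W x ∈ activeSet ρ W := mem_image_of_mem _ hx
  exact (poincareConst_pos (hρ.condDensity hW hy) ⟨0, hm⟩).trans_le
    (le_iSup₂ (f := fun y (_ : y ∈ activeSet ρ W) => poincareConst (condLaw ρ W y)) _ hy)

/-- The Poincaré constant is an infimum, so the inequality with this constant follows by dividing by
the integral of the squared gradient, unless that is `0` or `∞`. -/
lemma evariance_le_poincareSup (hm : 1 ≤ m) (hρ : IsModelDensity ρ)
    (hW : W ∈ Matrix.orthogonalGroup (Fin (k + m)) ℝ) {y : E k} (hy : y ∈ activeSet ρ W)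
    {h : E m → ℝ} (hh : ContDiff ℝ 1 h) (hL : MemLp h 2 (condLaw ρ W y)) :
    evariance h (condLaw ρ W y) ≤
      poincareSup ρ W * ∫⁻ z, ‖gradient h z‖ₑ ^ 2 ∂(condLaw ρ W y) := by
  set a := ∫⁻ z, ‖gradient h z‖ₑ ^ 2 ∂(condLaw ρ W y) with ha
  rcases eq_or_ne a 0 with h0 | h0
  · obtain ⟨K, -, H⟩ := exists_forall_evariance_condLaw_le hρ hW
    have := H y hy h hh hL
    rw [← ha, h0, mul_zero] at this
    rw [h0, mul_zero]
    exact this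
  rcases eq_or_ne a ∞ with ht | ht
  · rw [ht, ENNReal.mul_top (poincareSup_pos hm hρ hW).ne']
    exact le_top
  rw [← ENNReal.div_le_iff h0 ht]
  refine le_trans (le_sInf fun c hc => ?_)
    (le_iSup₂ (f := fun y (_ : y ∈ activeSet ρ W) => poincareConst (condLaw ρ W y)) y hy)
  rw [ENNReal.div_le_iff h0 ht]
  exact hc h hh hL

/-! ### The conditional expectation and the conditional variance -/

lemma g_congr (hρ : IsModelDensity ρ) (hW : W ∈ Matrix.orthogonalGroup (Fin (k + m)) ℝ)
    {h h' : E (k + m) → ℝ} (hh : h =ᵐ[law ρ] h') : g ρ h W =ᵐ[activeLaw ρ W] g ρ h' W := by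
  filter_upwards [ae_ae_condLaw hρ hW hh] with y hy
  exact integral_congr_ae hy

lemma aestronglyMeasurable_g (hρ : IsModelDensity ρ)
    (hW : W ∈ Matrix.orthogonalGroup (Fin (k + m)) ℝ) {h : E (k + m) → ℝ}
    (hh : AEStronglyMeasurable h (law ρ)) : AEStronglyMeasurable (g ρ h W) (activeLaw ρ W) := by
  refine AEStronglyMeasurable.congr ?_ (g_congr hρ hW hh.ae_eq_mk).symm
  have hm := hh.stronglyMeasurable_mk.measurable
  have e : g ρ (hh.mk h) W = fun y => ∫ z, condDensity ρ W y z * hh.mk h (join W y z) := by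
    ext y
    have hm1 : Measurable fun z : E m => ENNReal.ofReal (condDensity ρ W y z) :=
      (hρ.measurable_condDensity.comp (f := fun z : E m => (y, z)) (by fun_prop)).ennreal_ofReal
    rw [g, condLaw, law, integral_withDensity_eq_integral_toReal_smul hm1
      (Eventually.of_forall fun _ => ENNReal.ofReal_lt_top)]
    simp [ENNReal.toReal_ofReal (hρ.condDensity_nonneg _ _)]
  rw [e]
  have h2 : Measurable fun p : E k × E m =>
      condDensity ρ W p.1 p.2 * hh.mk h (join W p.1 p.2) :=
    hρ.measurable_condDensity.mul (hm.comp measurable_join)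
  exact h2.stronglyMeasurable.integral_prod_right'.aestronglyMeasurable

lemma aestronglyMeasurable_fg (hρ : IsModelDensity ρ)
    (hW : W ∈ Matrix.orthogonalGroup (Fin (k + m)) ℝ) {h : E (k + m) → ℝ}
    (hh : AEStronglyMeasurable h (law ρ)) : AEStronglyMeasurable (fg ρ h W) (law ρ) :=
  (aestronglyMeasurable_g hρ hW hh).comp_aemeasurable continuous_active.aemeasurable

lemma ae_aestronglyMeasurable_slice (hρ : IsModelDensity ρ)
    (hW : W ∈ Matrix.orthogonalGroup (Fin (k + m)) ℝ) {h : E (k + m) → ℝ}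
    (hh : AEStronglyMeasurable h (law ρ)) :
    ∀ᵐ y ∂(activeLaw ρ W), AEStronglyMeasurable (fun z => h (join W y z)) (condLaw ρ W y) := by
  filter_upwards [ae_ae_condLaw hρ hW hh.ae_eq_mk] with y hy
  exact ⟨fun z => hh.mk h (join W y z),
    (hh.stronglyMeasurable_mk.measurable.comp (measurable_join_right y)).stronglyMeasurable, hy⟩

/-- By the disintegration of `P_X`, the second moments of almost all slices are finite. -/
lemma ae_memLp_slice (hρ : IsModelDensity ρ)
    (hW : W ∈ Matrix.orthogonalGroup (Fin (k + m)) ℝ) {h : E (k + m) → ℝ}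
    (hh : MemLp h 2 (law ρ)) :
    ∀ᵐ y ∂(activeLaw ρ W), MemLp (fun z => h (join W y z)) 2 (condLaw ρ W y) := by
  have h1 : ∫⁻ x, ‖hh.1.mk h x‖ₑ ^ 2 ∂(law ρ) ≠ ∞ := by
    rw [← eLpNorm_two_sq, ← eLpNorm_congr_ae hh.1.ae_eq_mk]
    exact ENNReal.pow_ne_top hh.2.ne
  have hm := hh.1.stronglyMeasurable_mk.measurable
  rw [lintegral_law_eq hρ hW (by fun_prop)] at h1
  have hlt := ae_lt_top (measurable_lintegral_condLaw hρ
    (φ := fun q => ‖hh.1.mk h (join W q.1 q.2)‖ₑ ^ 2) (by fun_prop)) h1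
  filter_upwards [hlt, ae_ae_condLaw hρ hW hh.1.ae_eq_mk] with y hy hy2
  have hy3 : (fun z => h (join W y z)) =ᵐ[condLaw ρ W y] fun z => hh.1.mk h (join W y z) := hy2
  refine (memLp_congr_ae hy3).2
    ⟨(hm.comp (measurable_join_right y)).aestronglyMeasurable, ?_⟩
  by_contra hcon
  rw [not_lt, top_le_iff] at hcon
  simp only [← eLpNorm_two_sq (fun z => hh.1.mk h (join W y z))] at hy
  rw [hcon] at hy
  simp at hy

/-- The mean of the conditional variance is the squared distance to the conditional expectation. -/
lemma eLpNorm_sub_fg_sq (hρ : IsModelDensity ρ)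
    (hW : W ∈ Matrix.orthogonalGroup (Fin (k + m)) ℝ) {h : E (k + m) → ℝ}
    (hh : AEStronglyMeasurable h (law ρ)) :
    eLpNorm (fun x => h x - fg ρ h W x) 2 (law ρ) ^ 2 =
      ∫⁻ y, evariance (fun z => h (join W y z)) (condLaw ρ W y) ∂(activeLaw ρ W) := by
  rw [eLpNorm_two_sq, lintegral_law_eq_of_aemeasurable
    (φ := fun x => ‖h x - fg ρ h W x‖ₑ ^ 2) hρ hW
    ((hh.sub (aestronglyMeasurable_fg hρ hW hh)).enorm.pow_const 2)]
  refine lintegral_congr fun y => ?_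
  rw [evariance]
  simp only [fg, active_join hW]
  rfl

lemma evariance_le_lintegral_sq {α : Type*} [MeasurableSpace α] {μ : Measure α}
    [IsProbabilityMeasure μ] {X : α → ℝ} (hX : AEStronglyMeasurable X μ) :
    evariance X μ ≤ ∫⁻ x, ‖X x‖ₑ ^ 2 ∂μ := by
  rw [evariance_def' hX]
  exact tsub_le_self

/-- Subtracting the conditional expectation does not increase the `L²` norm. -/
lemma eLpNorm_sub_fg_le (hρ : IsModelDensity ρ)
    (hW : W ∈ Matrix.orthogonalGroup (Fin (k + m)) ℝ) {h : E (k + m) → ℝ}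
    (hh : AEStronglyMeasurable h (law ρ)) :
    eLpNorm (fun x => h x - fg ρ h W x) 2 (law ρ) ≤ eLpNorm h 2 (law ρ) := by
  rw [← ENNReal.pow_le_pow_left_iff (n := 2) (by norm_num), eLpNorm_sub_fg_sq hρ hW hh,
    eLpNorm_two_sq, lintegral_law_eq_of_aemeasurable hρ hW (hh.enorm.pow_const 2)]
  refine lintegral_mono_ae ?_
  filter_upwards [ae_aestronglyMeasurable_slice hρ hW hh, ae_activeLaw_mem hρ hW] with y hy hyA
  have := hρ.isProbabilityMeasure_condLaw hW hyA
  exact evariance_le_lintegral_sq hy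

lemma fg_sub (hρ : IsModelDensity ρ) (hW : W ∈ Matrix.orthogonalGroup (Fin (k + m)) ℝ)
    {h h' : E (k + m) → ℝ} (hh : MemLp h 2 (law ρ)) (hh' : MemLp h' 2 (law ρ)) :
    fg ρ (fun x => h x - h' x) W =ᵐ[law ρ] fun x => fg ρ h W x - fg ρ h' W x := by
  have key : ∀ᵐ y ∂(activeLaw ρ W), g ρ (fun x => h x - h' x) W y = g ρ h W y - g ρ h' W y := by
    filter_upwards [ae_memLp_slice hρ hW hh, ae_memLp_slice hρ hW hh', ae_activeLaw_mem hρ hW]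
      with y h1 h2 hy
    have := hρ.isProbabilityMeasure_condLaw hW hy
    exact integral_sub (h1.integrable (by norm_num)) (h2.integrable (by norm_num))
  exact ae_of_ae_map continuous_active.aemeasurable key

/-- The Poincaré inequality on the slices, integrated over the active variable. -/
lemma eLpNorm_sub_fg_sq_le_of_contDiff (hm : 1 ≤ m) (hρ : IsModelDensity ρ)
    (hW : W ∈ Matrix.orthogonalGroup (Fin (k + m)) ℝ) {F : E (k + m) → ℝ}
    (hF : ContDiff ℝ 1 F) (hFL : MemLp F 2 (law ρ)) :
    eLpNorm (fun x => F x - fg ρ F W x) 2 (law ρ) ^ 2 ≤ poincareSup ρ W *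
      ∑ j, eLpNorm (fun x => ∑ r, W r (Fin.natAdd k j) * partialDeriv F r x) 2 (law ρ) ^ 2 := by
  have hGm : ∀ j, Measurable fun x =>
      ‖∑ r, W r (Fin.natAdd k j) * partialDeriv F r x‖ₑ ^ 2 := fun j => by
    have := fun r => (continuous_partialDeriv hF r).measurable
    fun_prop
  rw [eLpNorm_sub_fg_sq hρ hW hF.continuous.aestronglyMeasurable]
  calc ∫⁻ y, evariance (fun z => F (join W y z)) (condLaw ρ W y) ∂(activeLaw ρ W)
      ≤ ∫⁻ y, poincareSup ρ W * ∫⁻ z, ∑ j,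
          ‖∑ r, W r (Fin.natAdd k j) * partialDeriv F r (join W y z)‖ₑ ^ 2
            ∂(condLaw ρ W y) ∂(activeLaw ρ W) := by
        refine lintegral_mono_ae ?_
        filter_upwards [ae_memLp_slice hρ hW hFL, ae_activeLaw_mem hρ hW] with y h1 hy
        have := evariance_le_poincareSup hm hρ hW hy (contDiff_slice hF y) h1
        simpa only [enorm_gradient_slice_sq hF] using this
    _ = poincareSup ρ W * ∫⁻ x, ∑ j,
          ‖∑ r, W r (Fin.natAdd k j) * partialDeriv F r x‖ₑ ^ 2 ∂(law ρ) := by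
        rw [lintegral_const_mul' _ _ (poincareSup_lt_top hρ hW).ne,
          lintegral_law_eq hρ hW (Finset.measurable_fun_sum _ fun j _ => hGm j)]
    _ = _ := by
        congr 1
        rw [lintegral_finsetSum _ fun j _ => hGm j]
        exact Finset.sum_congr rfl fun j _ => (eLpNorm_two_sq _ _).symm

/-- The integrated Poincaré inequality extends to all approximable pairs, with the same constant,
because both sides are continuous under the approximation. -/
lemma C1Approx.eLpNorm_sub_fg_sq_le (hm : 1 ≤ m) (hρ : IsModelDensity ρ)
    (hW : W ∈ Matrix.orthogonalGroup (Fin (k + m)) ℝ) {f : E (k + m) → ℝ}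
    {v : Fin (k + m) → E (k + m) → ℝ} (h : C1Approx (law ρ) f v) (hf : MemLp f 2 (law ρ))
    (hv : ∀ i, MemLp (v i) 2 (law ρ)) :
    eLpNorm (fun x => f x - fg ρ f W x) 2 (law ρ) ^ 2 ≤ poincareSup ρ W *
      ∑ j, eLpNorm (fun x => ∑ r, W r (Fin.natAdd k j) * v r x) 2 (law ρ) ^ 2 := by
  have := hρ.isProbabilityMeasure
  choose F hF hFs h1 h2 using fun n : ℕ => h ((n : ℝ≥0∞)⁻¹) (by simp)
  set C := poincareSup ρ W
  set e : ℕ → ℝ≥0∞ := fun n => (n : ℝ≥0∞)⁻¹ with he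
  have helim : Tendsto e atTop (𝓝 0) := ENNReal.tendsto_inv_nat_nhds_zero
  set b : Fin m → ℝ≥0∞ := fun j =>
    eLpNorm (fun x => ∑ r, W r (Fin.natAdd k j) * v r x) 2 (law ρ)
  set c : Fin m → ℝ≥0∞ := fun j => ∑ r, ‖W r (Fin.natAdd k j)‖ₑ
  have hgrad : ∀ n j, eLpNorm (fun x => ∑ r, W r (Fin.natAdd k j) * partialDeriv (F n) r x) 2
      (law ρ) ≤ b j + c j * e n := by
    intro n j
    have hFm := fun r => (continuous_partialDeriv (hF n) r).aestronglyMeasurable (μ := law ρ)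
    have hs : ∀ r, AEStronglyMeasurable
        (fun x => W r (Fin.natAdd k j) * (partialDeriv (F n) r x - v r x)) (law ρ) :=
      fun r => ((hFm r).sub (hv r).1).const_mul _
    have e1 : (fun x => ∑ r, W r (Fin.natAdd k j) * partialDeriv (F n) r x) =
        (fun x => ∑ r, W r (Fin.natAdd k j) * v r x) +
          ∑ r, fun x => W r (Fin.natAdd k j) * (partialDeriv (F n) r x - v r x) := by
      ext x
      simp [mul_sub, Finset.sum_sub_distrib]
    rw [e1]
    refine (eLpNorm_add_le (Finset.aestronglyMeasurable_fun_sum _ fun r _ =>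
      (hv r).1.const_mul _) (Finset.aestronglyMeasurable_sum _ fun r _ => hs r)
      (by norm_num)).trans ?_
    gcongr
    refine (eLpNorm_sum_le (fun r _ => hs r) (by norm_num)).trans ?_
    rw [Finset.sum_mul]
    refine Finset.sum_le_sum fun r _ => ?_
    change eLpNorm (W r (Fin.natAdd k j) • fun x => partialDeriv (F n) r x - v r x) 2 (law ρ) ≤ _
    rw [eLpNorm_const_smul]
    gcongr
    exact h2 n r
  have hbound : ∀ n, eLpNorm (fun x => f x - fg ρ f W x) 2 (law ρ) ^ 2 ≤
      ((C * ∑ j, (b j + c j * e n) ^ 2) ^ (1 / 2 : ℝ) + e n) ^ 2 := by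
    intro n
    have hFL : MemLp (F n) 2 (law ρ) := (hF n).continuous.memLp_of_hasCompactSupport (hFs n)
    have hD := hf.sub hFL
    have hFbound : eLpNorm (fun x => F n x - fg ρ (F n) W x) 2 (law ρ) ≤
        (C * ∑ j, (b j + c j * e n) ^ 2) ^ (1 / 2 : ℝ) := by
      have h3 := (eLpNorm_sub_fg_sq_le_of_contDiff hm hρ hW (hF n) hFL).trans
        (mul_le_mul_right (Finset.sum_le_sum fun j _ => pow_le_pow_left' (hgrad n j) 2) _)
      have h4 := ENNReal.rpow_le_rpow h3 (by norm_num : (0 : ℝ) ≤ 1 / 2)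
      rw [← ENNReal.rpow_natCast, ← ENNReal.rpow_mul] at h4
      norm_num at h4
      norm_num
      exact h4
    have e2 : (fun x => f x - fg ρ f W x) =ᵐ[law ρ] (fun x => F n x - fg ρ (F n) W x) +
        fun x => (f x - F n x) - fg ρ (fun x => f x - F n x) W x := by
      filter_upwards [fg_sub hρ hW hf hFL] with x hx
      simp only [Pi.add_apply, hx]
      ring
    gcongr
    rw [eLpNorm_congr_ae e2]
    refine (eLpNorm_add_le (hFL.1.sub (aestronglyMeasurable_fg hρ hW hFL.1))
      (hD.1.sub (aestronglyMeasurable_fg hρ hW hD.1)) (by norm_num)).trans ?_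
    refine add_le_add hFbound ((eLpNorm_sub_fg_le hρ hW hD.1).trans ?_)
    rw [eLpNorm_sub_comm]
    exact h1 n
  have hlim : Tendsto (fun n => ((C * ∑ j, (b j + c j * e n) ^ 2) ^ (1 / 2 : ℝ) + e n) ^ 2) atTop
      (𝓝 (((C * ∑ j, (b j + c j * 0) ^ 2) ^ (1 / 2 : ℝ) + 0) ^ 2)) := by
    have hc : ∀ j, c j ≠ ∞ := fun j => (ENNReal.sum_lt_top.2 fun r _ => enorm_lt_top).ne
    refine ENNReal.Tendsto.pow (Tendsto.add ?_ helim)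
    refine (ENNReal.continuous_rpow_const.tendsto _).comp ?_
    refine ENNReal.Tendsto.const_mul (tendsto_finsetSum _ fun j _ => ?_)
      (Or.inr (poincareSup_lt_top hρ hW).ne)
    exact ENNReal.Tendsto.pow (tendsto_const_nhds.add
      (ENNReal.Tendsto.const_mul helim (Or.inr (hc j))))
  refine (ge_of_tendsto' hlim hbound).trans (le_of_eq ?_)
  simp only [mul_zero, add_zero]
  rw [← ENNReal.rpow_natCast, ← ENNReal.rpow_mul]
  norm_num
  rfl

/-! ### The trailing eigenvalues -/

lemma gradMatrix_apply {f : E d → ℝ} {ρ : E d → ℝ} (hρ : IsModelDensity ρ) (i j : Fin d) :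
    gradMatrix ρ f i j = ∫ x, partialDeriv f i x * partialDeriv f j x ∂(law ρ) := by
  rw [gradMatrix, Matrix.of_apply, setIntegral_eq_integral_of_forall_compl_eq_zero, law,
    integral_withDensity_eq_integral_toReal_smul hρ.measurable.ennreal_ofReal
      (Eventually.of_forall fun _ => ENNReal.ofReal_lt_top)]
  · refine integral_congr_ae (Eventually.of_forall fun x => ?_)
    simp only [ENNReal.toReal_ofReal (hρ.nonneg x), smul_eq_mul]
    ring
  · intro x hx
    have : ρ x = 0 := le_antisymm (not_lt.1 hx) (hρ.nonneg x)
    rw [this, mul_zero]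

/-- The eigenvalue `lam j` is the mean square of the derivative in the direction of the `j`-th
column of `W`. -/
lemma eLpNorm_columnDeriv_sq {f : E d → ℝ} {ρ : E d → ℝ} (hρ : IsModelDensity ρ)
    (hf : IsAdmissible ρ f) {W : Matrix (Fin d) (Fin d) ℝ} {lam : Fin d → ℝ}
    (hW : IsEigendecomposition (gradMatrix ρ f) W lam) (j : Fin d) :
    0 ≤ lam j ∧ eLpNorm (fun x => ∑ r, W r j * partialDeriv f r x) 2 (law ρ) ^ 2 =
      ENNReal.ofReal (lam j) := by
  have hL : MemLp (fun x => ∑ r, W r j * partialDeriv f r x) 2 (law ρ) :=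
    memLp_finsetSum _ fun r _ => (hf.memLp_partialDeriv r).const_mul _
  have hWW : Wᵀ * W = 1 := (Matrix.mem_orthogonalGroup_iff' _ _).1 hW.orthogonal
  -- `lam j` is the quadratic form of the matrix at the `j`-th column of `W`
  have hdiag : Wᵀ * gradMatrix ρ f * W = Matrix.diagonal lam := by
    rw [hW.eq, ← Matrix.mul_assoc, ← Matrix.mul_assoc, hWW, Matrix.one_mul, Matrix.mul_assoc, hWW,
      Matrix.mul_one]
  have hint : ∀ r s, Integrable
      (fun x => W r j * partialDeriv f r x * (W s j * partialDeriv f s x)) (law ρ) := fun r s =>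
    ((hf.memLp_partialDeriv r).const_mul (W r j)).integrable_mul
      ((hf.memLp_partialDeriv s).const_mul (W s j))
  have hval : ∫ x, (∑ r, W r j * partialDeriv f r x) ^ 2 ∂(law ρ) = lam j := by
    have h1 := congrFun₂ hdiag j j
    rw [Matrix.diagonal_apply_eq] at h1
    rw [← h1]
    simp only [sq, Finset.sum_mul_sum]
    rw [integral_finsetSum _ fun r _ => integrable_finsetSum _ fun s _ => hint r s]
    simp only [Matrix.mul_apply, Matrix.transpose_apply, Finset.sum_mul]
    rw [Finset.sum_comm]
    refine Finset.sum_congr rfl fun r _ => ?_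
    rw [integral_finsetSum _ fun s _ => hint r s]
    refine Finset.sum_congr rfl fun s _ => ?_
    rw [gradMatrix_apply hρ, ← integral_const_mul, ← integral_mul_const]
    refine integral_congr_ae (Eventually.of_forall fun x => ?_)
    simp only
    ring
  refine ⟨hval ▸ integral_nonneg fun x => sq_nonneg _, ?_⟩
  rw [eLpNorm_two_sq, ← hval, ofReal_integral_eq_lintegral_ofReal hL.integrable_sq
    (Eventually.of_forall fun x => sq_nonneg _)]
  refine lintegral_congr fun x => ?_
  rw [Real.enorm_eq_ofReal_abs, ← ENNReal.ofReal_pow (abs_nonneg _), sq_abs]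

end

/-! ### Existence of Monte Carlo samples -/

section

variable {k m N : ℕ} {W : Matrix (Fin (k + m)) (Fin (k + m)) ℝ} {ρ : E (k + m) → ℝ}

/-- The conditional laws as a kernel from the domain of the active variable. -/
def condKernel (hρ : IsModelDensity ρ) : Kernel (activeSet ρ W) (E m) where
  toFun y := condLaw ρ W y
  measurable' := by
    refine Measure.measurable_of_measurable_coe _ fun s hs => ?_
    have e : ∀ y : E k, condLaw ρ W y s = ∫⁻ z, s.indicator 1 z ∂(condLaw ρ W y) := fun y =>
      (lintegral_indicator_one hs).symm
    simp only [e]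
    exact (measurable_lintegral_condLaw hρ (φ := fun q => s.indicator 1 q.2)
      ((measurable_one.indicator hs).comp measurable_snd)).comp measurable_subtype_coe

/-- Transporting independent uniform variables on `[0, 1]` by a measurable representation of the
conditional kernel gives samples that are jointly measurable in `(y, ω)`. -/
lemma exists_isMonteCarloSample (hρ : IsModelDensity ρ)
    (hW : W ∈ Matrix.orthogonalGroup (Fin (k + m)) ℝ) (N : ℕ) :
    ∃ (Ω : Type) (_ : MeasurableSpace Ω) (P : Measure Ω) (_ : IsProbabilityMeasure P)
      (Z : Fin N → E k → Ω → E m), IsMonteCarloSample P ρ W Z := by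
  classical
  have hM : IsMarkovKernel (condKernel (W := W) hρ) :=
    ⟨fun y => hρ.isProbabilityMeasure_condLaw hW y.2⟩
  obtain ⟨F, hF, hFmap⟩ := (condKernel (W := W) hρ).exists_measurable_map_eq_unitInterval
  have hFy : ∀ y, Measurable (F y) := fun y => hF.comp (f := fun t => (y, t)) (by fun_prop)
  refine ⟨Fin N → unitInterval, inferInstance, Measure.pi fun _ => volume, inferInstance,
    fun j y ω => if h : y ∈ activeSet ρ W then F ⟨y, h⟩ (ω j) else 0, ?_, ?_, ?_⟩
  · intro j
    have : Measurable fun p : activeSet ρ W × (Fin N → unitInterval) => F p.1 (p.2 j) :=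
      hF.comp (f := fun p : activeSet ρ W × (Fin N → unitInterval) => (p.1, p.2 j)) (by fun_prop)
    simpa using this
  · intro y hy
    simp only [hy, dif_pos]
    exact iIndepFun_pi (X := fun _ => F ⟨y, hy⟩) fun _ => (hFy _).aemeasurable
  · intro y hy j
    simp only [hy, dif_pos]
    have h1 := (measurePreserving_eval (fun _ : Fin N => (volume : Measure unitInterval)) j)
    have h2 := Measure.map_map (μ := Measure.pi fun _ : Fin N => (volume : Measure unitInterval))
      (hFy ⟨y, hy⟩) h1.measurable
    rw [h1.map_eq, hFmap] at h2
    exact h2.symm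

/-! ### The Monte Carlo average -/

section Sample

variable {Ω : Type*} [MeasurableSpace Ω] {P : Measure Ω}
  {Z : Fin N → E k → Ω → E m} {f : E (k + m) → ℝ}

lemma IsMonteCarloSample.measurable_apply (h : IsMonteCarloSample P ρ W Z) {y : E k}
    (hy : y ∈ activeSet ρ W) (j : Fin N) : Measurable (Z j y) :=
  (h.measurable j).comp (f := fun ω => ((⟨y, hy⟩ : activeSet ρ W), ω)) (by fun_prop)

variable [IsProbabilityMeasure P]

/-- Values of `f` outside `𝒳` are arbitrary, but for almost every `y` the points `⟦y, Z_j^y⟧` lie in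
`𝒳` almost surely, so `f` may be replaced by its extension by zero. -/
lemma IsMonteCarloSample.aemeasurable_gN (hρ : IsModelDensity ρ)
    (hW : W ∈ Matrix.orthogonalGroup (Fin (k + m)) ℝ) (h : IsMonteCarloSample P ρ W Z)
    (hf : Measurable ((posSet ρ).indicator f)) :
    AEMeasurable (fun p : E k × Ω => gN f W Z p.1 p.2) ((activeLaw ρ W).prod P) := by
  classical
  have hA : MeasurableSet (activeSet ρ W) := (isOpen_activeSet hW hρ.isOpen_posSet).measurableSet
  have hX := hρ.isOpen_posSet.measurableSet
  set A := activeSet ρ W ×ˢ (univ : Set Ω) with hAdef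
  have hAm : MeasurableSet A := hA.prod MeasurableSet.univ
  refine AEMeasurable.const_mul (Finset.aemeasurable_fun_sum _ fun j _ => ?_) _
  -- outside the domain of the active variable the samples are replaced by a constant
  set Z' : E k × Ω → E m := A.indicator fun p => Z j p.1 p.2 with hZ'
  have hZ'm : Measurable Z' := by
    refine measurable_of_restrict_of_restrict_compl hAm ?_ ?_
    · have e : A.domRestrict Z' = (fun q : activeSet ρ W × Ω => Z j q.1 q.2) ∘
          fun p : A => (⟨p.1.1, p.2.1⟩, p.1.2) := by
        ext1 p
        exact indicator_of_mem p.2 fun p => Z j p.1 p.2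
      rw [e]
      exact (h.measurable j).comp (by fun_prop)
    · have e : Aᶜ.domRestrict Z' = fun _ => 0 := by
        ext1 p
        exact indicator_of_notMem p.2 fun p => Z j p.1 p.2
      rw [e]
      exact measurable_const
  have hj : Measurable fun p : E k × Ω => join W p.1 (Z' p) :=
    measurable_join.comp (f := fun p : E k × Ω => (p.1, Z' p)) (by fun_prop)
  refine ⟨fun p => (posSet ρ).indicator f (join W p.1 (Z' p)), hf.comp hj, ?_⟩
  have hae : ∀ᵐ p ∂((activeLaw ρ W).prod P), p ∈ A ∧ join W p.1 (Z' p) ∈ posSet ρ := by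
    refine (Measure.ae_prod_iff_ae_ae (hAm.inter (hj hX))).2 ?_
    filter_upwards [ae_activeLaw_mem hρ hW, ae_ae_condLaw hρ hW (ae_mem_posSet hρ.measurable)]
      with y hy hy2
    rw [← h.map_eq y hy j] at hy2
    filter_upwards [ae_of_ae_map (h.measurable_apply hy j).aemeasurable hy2] with ω hω
    have hyA : (y, ω) ∈ A := ⟨hy, mem_univ _⟩
    refine ⟨hyA, ?_⟩
    change join W y (Z' (y, ω)) ∈ posSet ρ
    rwa [hZ', indicator_of_mem hyA]
  filter_upwards [hae] with p hp
  rw [indicator_of_mem hp.2, hZ', indicator_of_mem hp.1]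

/-- The mean square error of the average of `N` independent samples is the variance divided
by `N`. -/
lemma IsMonteCarloSample.lintegral_sub_gN_sq (hρ : IsModelDensity ρ)
    (hW : W ∈ Matrix.orthogonalGroup (Fin (k + m)) ℝ) (h : IsMonteCarloSample P ρ W Z)
    (hN : 0 < N) {y : E k} (hy : y ∈ activeSet ρ W)
    (hf : MemLp (fun z => f (join W y z)) 2 (condLaw ρ W y)) :
    ∫⁻ ω, ENNReal.ofReal ((g ρ f W y - gN f W Z y ω) ^ 2) ∂P =
      evariance (fun z => f (join W y z)) (condLaw ρ W y) / N := by
  have := hρ.isProbabilityMeasure_condLaw hW hy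
  set φ : E m → ℝ := fun z => f (join W y z)
  have hZ := fun j => (h.measurable_apply hy j).aemeasurable (μ := P)
  have hfZ : ∀ j, MemLp φ 2 (P.map (Z j y)) := fun j => by rwa [h.map_eq y hy j]
  have hL : ∀ j, MemLp (φ ∘ Z j y) 2 P := fun j =>
    (memLp_map_measure_iff (hfZ j).1 (hZ j)).1 (hfZ j)
  have hind : iIndepFun (fun j => φ ∘ Z j y) P :=
    (h.indep y hy).comp₀ (fun _ => φ) hZ fun j => (hfZ j).1.aemeasurable
  have hmean : ∀ j, ∫ ω, (φ ∘ Z j y) ω ∂P = g ρ f W y := fun j => by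
    rw [g, ← h.map_eq y hy j, integral_map (hZ j) (hfZ j).1]
    rfl
  have hvar : ∀ j, variance (φ ∘ Z j y) P = variance φ (condLaw ρ W y) := fun j => by
    rw [← h.map_eq y hy j, variance_map (hfZ j).1.aemeasurable (hZ j)]
  have hN0 : (N : ℝ) ≠ 0 := by positivity
  have hgN : gN f W Z y = fun ω => (1 / (N : ℝ)) * (∑ j, φ ∘ Z j y) ω := by
    ext ω
    simp [gN, φ]
  have hsum : MemLp (∑ j, φ ∘ Z j y) 2 P := memLp_finsetSum' _ fun j _ => hL j
  have hgL : MemLp (gN f W Z y) 2 P := by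
    rw [hgN]
    exact hsum.const_mul _
  have hgmean : ∫ ω, gN f W Z y ω ∂P = g ρ f W y := by
    simp only [hgN, Finset.sum_apply]
    rw [integral_const_mul, integral_finsetSum _ fun j _ => (hL j).integrable (by norm_num)]
    simp only [hmean, Finset.sum_const, Finset.card_univ, Fintype.card_fin, nsmul_eq_mul]
    field_simp
  have hgvar : variance (gN f W Z y) P = variance φ (condLaw ρ W y) / N := by
    rw [hgN, variance_const_mul, IndepFun.variance_sum (fun j _ => hL j)
      fun i _ j _ hij => hind.indepFun hij]
    simp only [hvar, Finset.sum_const, Finset.card_univ, Fintype.card_fin, nsmul_eq_mul]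
    field_simp
  calc ∫⁻ ω, ENNReal.ofReal ((g ρ f W y - gN f W Z y ω) ^ 2) ∂P
      = evariance (gN f W Z y) P := by
        rw [evariance_eq_lintegral_ofReal, hgmean]
        simp only [sub_sq_comm]
    _ = evariance φ (condLaw ρ W y) / N := by
        rw [← hgL.ofReal_variance_eq, hgvar, ← hf.ofReal_variance_eq,
          ENNReal.ofReal_div_of_pos (by positivity), ENNReal.ofReal_natCast]

end Sample

/-! ### Collecting the estimates -/

/-- The mean conditional variance of `f(X)` given `Y` is bounded by the trailing eigenvalues. -/
lemma lintegral_evariance_le {f : E (k + m) → ℝ} {lam : Fin (k + m) → ℝ} (hm : 1 ≤ m)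
    (hρ : IsModelDensity ρ) (hf : IsAdmissible ρ f)
    (hW : IsEigendecomposition (gradMatrix ρ f) W lam) :
    ∫⁻ y, evariance (fun z => f (join W y z)) (condLaw ρ W y) ∂(activeLaw ρ W) ≤
      poincareSup ρ W * ENNReal.ofReal (∑ i : Fin m, lam (Fin.natAdd k i)) := by
  obtain ⟨hfL, hC⟩ := hρ.memLp_and_c1Approx (hf.hasGradOn hρ) hf.memLp_partialDeriv
  rw [← eLpNorm_sub_fg_sq hρ hW.orthogonal hfL.1, ENNReal.ofReal_sum_of_nonneg
    fun j _ => (eLpNorm_columnDeriv_sq hρ hf hW _).1]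
  simp only [← (eLpNorm_columnDeriv_sq hρ hf hW _).2]
  exact hC.eLpNorm_sub_fg_sq_le hm hρ hW.orthogonal hfL hf.memLp_partialDeriv

end

end ActiveSubspace

end

theorem mainTheorem1 {k m : ℕ} (hk : 1 ≤ k) (hm : 1 ≤ m)
    (ρ : E (k + m) → ℝ) (hρ : IsUniformOnBoundedConvex ρ ∨ IsStdGaussianDensity ρ)
    (f : E (k + m) → ℝ) (hf : IsAdmissible ρ f)
    (W : Matrix (Fin (k + m)) (Fin (k + m)) ℝ) (lam : Fin (k + m) → ℝ)
    (hW : IsEigendecomposition (gradMatrix ρ f) W lam)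
    (N : ℕ) (hN : 0 < N) :
    -- the constant is positive and finite
    (0 < poincareSup ρ W ∧ poincareSup ρ W < ∞) ∧
    -- `g` is well defined almost everywhere
    (∀ᵐ y ∂(activeLaw ρ W), Integrable (fun z => f (join W y z)) (condLaw ρ W y)) ∧
    -- Monte Carlo samples exist on some probability space
    (∃ (Ω : Type) (_ : MeasurableSpace Ω) (P : Measure Ω) (_ : IsProbabilityMeasure P)
      (Z : Fin N → E k → Ω → E m), IsMonteCarloSample P ρ W Z) ∧
    -- and for every choice of them the error identity and the error bound hold
    ∀ (Ω : Type*) [MeasurableSpace Ω] (P : Measure Ω) [IsProbabilityMeasure P]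
      (Z : Fin N → E k → Ω → E m), IsMonteCarloSample P ρ W Z →
      AEMeasurable (fun p : E k × Ω => g ρ f W p.1 - gN f W Z p.1 p.2)
        ((activeLaw ρ W).prod P) ∧
      ∫⁻ ω, ∫⁻ x, ENNReal.ofReal ((fg ρ f W x - fgN f W Z x ω) ^ 2) ∂(law ρ) ∂P =
        ∫⁻ ω, ∫⁻ y, ENNReal.ofReal ((g ρ f W y - gN f W Z y ω) ^ 2) ∂(activeLaw ρ W) ∂P ∧
      ∫⁻ ω, ∫⁻ y, ENNReal.ofReal ((g ρ f W y - gN f W Z y ω) ^ 2) ∂(activeLaw ρ W) ∂P ≤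
        poincareSup ρ W / (N : ℝ≥0∞) * ENNReal.ofReal (∑ i : Fin m, lam (Fin.natAdd k i)) := by
  have hWo := hW.orthogonal
  have hρ' : IsModelDensity ρ := hρ
  have hgrad := hf.hasGradOn hρ'
  have hfL := (hρ'.memLp_and_c1Approx hgrad hf.memLp_partialDeriv).1
  have hslice := ae_memLp_slice hρ' hWo hfL
  have hmem := ae_activeLaw_mem hρ' hWo
  refine ⟨⟨poincareSup_pos hm hρ' hWo, poincareSup_lt_top hρ' hWo⟩, ?_,
    exists_isMonteCarloSample hρ' hWo N, ?_⟩
  · filter_upwards [hslice, hmem] with y h1 hy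
    have := hρ'.isProbabilityMeasure_condLaw hWo hy
    exact h1.integrable (by norm_num)
  intro Ω _ P _ Z hZ
  have := isProbabilityMeasure_activeLaw (W := W) hρ'
  have hmeas : AEMeasurable (fun p : E k × Ω => g ρ f W p.1 - gN f W Z p.1 p.2)
      ((activeLaw ρ W).prod P) :=
    ((aestronglyMeasurable_g hρ' hWo hfL.1).aemeasurable.comp_quasiMeasurePreserving
      Measure.quasiMeasurePreserving_fst).sub (hZ.aemeasurable_gN hρ' hWo hgrad.measurable)
  have hsq : AEMeasurable
      (fun p : E k × Ω => ENNReal.ofReal ((g ρ f W p.1 - gN f W Z p.1 p.2) ^ 2))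
      ((activeLaw ρ W).prod P) := (hmeas.pow_const 2).ennreal_ofReal
  refine ⟨hmeas, ?_, ?_⟩
  · refine lintegral_congr_ae ?_
    filter_upwards [hsq.prod_swap.aestronglyMeasurable.prodMk_left] with ω hω
    exact (lintegral_map' hω.aemeasurable continuous_active.aemeasurable).symm
  · rw [lintegral_lintegral_swap (f := fun (ω : Ω) (y : E k) =>
      ENNReal.ofReal ((g ρ f W y - gN f W Z y ω) ^ 2)) hsq.prod_swap]
    have hN0 : (N : ℝ≥0∞) ≠ 0 := by positivity
    calc ∫⁻ y, ∫⁻ ω, ENNReal.ofReal ((g ρ f W y - gN f W Z y ω) ^ 2) ∂P ∂(activeLaw ρ W)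
        = ∫⁻ y, evariance (fun z => f (join W y z)) (condLaw ρ W y) * (N : ℝ≥0∞)⁻¹
            ∂(activeLaw ρ W) := by
          refine lintegral_congr_ae ?_
          filter_upwards [hslice, hmem] with y h1 hy
          rw [hZ.lintegral_sub_gN_sq hρ' hWo hN hy h1, div_eq_mul_inv]
      _ = (∫⁻ y, evariance (fun z => f (join W y z)) (condLaw ρ W y) ∂(activeLaw ρ W)) *
            (N : ℝ≥0∞)⁻¹ := lintegral_mul_const' _ _ (ENNReal.inv_ne_top.2 hN0)
      _ ≤ poincareSup ρ W * ENNReal.ofReal (∑ i : Fin m, lam (Fin.natAdd k i)) *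
            (N : ℝ≥0∞)⁻¹ := by
          gcongr
          exact lintegral_evariance_le hm hρ' hf hW
      _ = _ := by
          rw [div_eq_mul_inv]
          ring
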